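/- **Setting.** Let $\mathcal{BC}_\infty$ be the group of finitary signed permutations, that is, permutations $w$ of $\mathbb Z\setminus\{0\}$ with $w(-i)=-w(i)$ and $w(i)=i$ for all but finitely many $i$. It is generated by $s_0=(1\leftrightarrow-1)$ and $s_i=(i\leftrightarrow i+1)$ (together with $-i\leftrightarrow-(i+1)$), $i\ge1$. Let $\ell(w)$ be the least length of a word in the $s_i$ representing $w$, and let $R(w)$ be the set of words of length $\ell(w)$ representing $w$ (reduced words). The hyperoctahedral group $\mathcal{BC}_n$ consists of the $w$ that fix every $i$ with $|i|>n$, and $\mathcal S_n\subset\mathcal{BC}_n$ consists of those without sign changes. *Schubert polynomials.* On the polynomial ring $\mathbb Q[z_1,z_2,\dots,p_1(x),p_3(x),p_5(x),\dots]$, graded by $\deg z_i=1$, $\deg p_m(x)=m$, let $s_i$ ($i\ge1$) exchange $z_i$ and $z_{i+1}$, and let $s_0$ send $z_1\mapsto -z_1$ and $p_m(x)\mapsto p_m(x)+z_1^m$, fixing the other generators in each case. Put $\partial_0f=\frac{f-s_0f}{-2z_1}$ and $\partial_if=\frac{f-s_if}{z_i-z_{i+1}}$ for $i\ge1$. The type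 $C$ (Billey–Haiman) Schubert polynomials are homogeneous elements $\mathfrak C_w$ ($w\in\mathcal{BC}_\infty$) of this ring with $\mathfrak C_{\mathrm{id}}=1$ and, for all $i\ge0$, $\partial_i\mathfrak C_w=\mathfrak C_{ws_i}$ if $\ell(ws_i)<\ell(w)$ and $\partial_i\mathfrak C_w=0$ otherwise. The $k$-truncation $\mathfrak C_w^{[k]}(z,x)$ is obtained by substituting $p_m(x)=x_1^m+\dots+x_k^m$. *Admissible monomials.* For a word $\mathbf a=s_{a_1}\cdots s_{a_l}$, the set $\mathscr A_x(\mathbf a)$ consists of the monomials $x^\alpha=x_{j_1}\cdots x_{j_l}$ with positive integers $j_1\ge\dots\ge j_l$ such that there is no $1<i<l$ with $j_{i-1}=j_i=j_{i+1}$ and $a_{i-1}<a_i>a_{i+1}$. The set $\mathscr A_z(\mathbf a)$ consists of the monomials $z^\beta=z_{j_1}\cdots z_{j_l}$ with positive integers $j_1\le\dots\le j_l$ such that $j_i\le a_i$ for all $i$, and $j_i=j_{i+1}$ implies $a_i>a_{i+1}$. Let $i(\alpha)$ be the number of distinct variables occurring in $x^\alpha$. *Pipe dreams.* The base consists, from bottom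 to top, of a staircase with rows of $n-1,n-2,\dots,1$ boxes (listed from top to bottom) and of $\Gamma$-blocks number $1,\dots,k$. The box in row $r$, column $c$ of the staircase carries the number $r+c-1$ and the variable $z_r$. Each $\Gamma$-block is a horizontal row of $n$ boxes, numbered $0,\dots,n-1$ from left to right, above a vertical column of $n$ boxes, numbered $0,\dots,n-1$ from top to bottom; every box of the $j$-th $\Gamma$-block carries the variable $x_j$. A $c$-signed pipe dream $D$ of size $n$ with $k$ $\Gamma$-blocks fills each box numbered $0$ with a single elbow or an elbow with a faucet, and each other box with an elbow joint or a cross. Crosses and elbows with faucets are called significant. The monomial $x^{\alpha(D)}z^{\beta(D)}$ is the product of the variables of the boxes containing significant elements. The word of $D$ is obtained by reading the base row by row, from top to bottom, each row from right to left, and recording $s_i$ for each significant element in a box numbered $i$. $D$ is reduced of shape $w$ if its word lies in $R(w)$; let $\mathrm{PD}^k_{\mathcal C_n}(w)$ be the set of all such $D$. **Theorem 3.2.** The Schubert polynomials $\mathfrak C_w$, $w\in\mathcal{BC}_\infty$, exist and are uniquely determined by the conditions above. For all $n\ge0$, $k\ge0$ and $w\in\mathcal{BC}_n$, the following sums are finite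 and $$\sum_{D\in \mathrm{PD}^k_{\mathcal C_n}(w)}x^{\alpha(D)}z^{\beta(D)} =\sum_{\substack{uv=w\\ \ell(u)+\ell(v)=\ell(w)\\ v\in\mathcal S_n}}\ \sum_{\substack{\mathbf a\in R(u)\\ x^\alpha\in\mathscr A_x(\mathbf a)\\ \alpha_{k+1}=\alpha_{k+2}=\dots=0}}\ \sum_{\substack{\mathbf b\in R(v)\\ z^\beta\in\mathscr A_z(\mathbf b)}}2^{i(\alpha)}x^\alpha z^\beta =\mathfrak C_w^{[k]}(z,x).$$ -/

import Mathlib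

open scoped BigOperators

namespace TypeC

/-! ### Signed permutations -/

/-- The group of finitary signed permutations: permutations `w` of `ℤ` (equivalently of
`ℤ ∖ {0}`, since the first condition forces `w 0 = 0`) with `w (-i) = -w i` that fix all but
finitely many integers. -/
def BCInf : Subgroup (Equiv.Perm ℤ) where
  carrier := {w | (∀ i : ℤ, w (-i) = -w i) ∧ ∃ N : ℕ, ∀ i : ℤ, (N : ℤ) < |i| → w i = i}
  one_mem' := ⟨fun _ => rfl, 0, fun _ _ => rfl⟩
  mul_mem' := by
    rintro a b ⟨ha, N, hN⟩ ⟨hb, M, hM⟩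
    refine ⟨fun i => by simp [ha, hb], max N M, fun i hi => ?_⟩
    have h1 : (N : ℤ) < |i| := lt_of_le_of_lt (by exact_mod_cast le_max_left N M) hi
    have h2 : (M : ℤ) < |i| := lt_of_le_of_lt (by exact_mod_cast le_max_right N M) hi
    rw [Equiv.Perm.mul_apply, hM i h2, hN i h1]
  inv_mem' := by
    rintro a ⟨ha, N, hN⟩
    refine ⟨fun i => ?_, N, fun i hi => ?_⟩
    · rw [Equiv.Perm.inv_eq_iff_eq, ha]; simp
    · rw [Equiv.Perm.inv_eq_iff_eq, hN i hi]

/-- The hyperoctahedral group `BC_n`, inside the group of all finitary signed permutations: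
the signed permutations of `{±1, …, ±n}`. -/
def BC (n : ℕ) : Set BCInf := {w | ∀ i : ℤ, (n : ℤ) < |i| → w.1 i = i}

/-- The symmetric group `S_n` inside `BC_n`: the signed permutations without sign changes. -/
def Sym (n : ℕ) : Set BCInf := {w | w ∈ BC n ∧ ∀ i : ℤ, 0 < i → 0 < w.1 i}

/-- The permutation of `ℤ` underlying a simple reflection: `s_0 = (1 ↔ -1)`, and
`s_i = (i ↔ i+1)` (together with `-i ↔ -(i+1)`) for `i ≥ 1`. -/
def simplePerm : ℕ → Equiv.Perm ℤ
  | 0 => Equiv.swap 1 (-1)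
  | i + 1 => Equiv.swap ((i : ℤ) + 1) ((i : ℤ) + 2) * Equiv.swap (-((i : ℤ) + 1)) (-((i : ℤ) + 2))

theorem simplePerm_mem (i : ℕ) : simplePerm i ∈ BCInf := by
  cases i with
  | zero =>
    refine ⟨fun i => ?_, 1, fun i hi => ?_⟩
    · simp only [simplePerm, Equiv.swap_apply_def]
      split_ifs <;> omega
    · simp only [simplePerm, Equiv.swap_apply_def]
      push_cast at hi
      rw [lt_abs] at hi
      split_ifs <;> omega
  | succ n =>
    refine ⟨fun i => ?_, n + 2, fun i hi => ?_⟩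
    · simp only [simplePerm, Equiv.Perm.mul_apply, Equiv.swap_apply_def]
      split_ifs <;> omega
    · simp only [simplePerm, Equiv.Perm.mul_apply, Equiv.swap_apply_def]
      push_cast at hi
      rw [lt_abs] at hi
      split_ifs <;> omega

/-- The simple reflections `s_0, s_1, s_2, …`, as elements of the group. -/
def s (i : ℕ) : BCInf := ⟨simplePerm i, simplePerm_mem i⟩

/-- The product `s_{a_1} s_{a_2} ⋯ s_{a_l}` of a word. -/
def wordProd (a : List ℕ) : BCInf := (a.map s).prod

/-- The length of `w`: the least length of a word that represents `w`. -/
noncomputable def length (w : BCInf) : ℕ :=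
  sInf {l | ∃ a : List ℕ, wordProd a = w ∧ a.length = l}

/-- The set `R(w)` of reduced words of `w`. -/
def redWords (w : BCInf) : Set (List ℕ) := {a | wordProd a = w ∧ a.length = length w}

/-! ### Schubert polynomials of type `C` -/

/-- The ring `ℚ[z_1, z_2, …, p_1(x), p_3(x), p_5(x), …]`, a polynomial ring in these generators.
The variable `Sum.inl i` is `z_{i+1}`, and `Sum.inr m` is the odd power sum `p_{2m+1}(x)`. -/
abbrev SRing : Type := MvPolynomial (ℕ ⊕ ℕ) ℚ

/-- `zS i` is `z_{i+1}`. -/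
noncomputable def zS (i : ℕ) : SRing := MvPolynomial.X (Sum.inl i)

/-- `pS m` is `p_{2m+1}(x)`. -/
noncomputable def pS (m : ℕ) : SRing := MvPolynomial.X (Sum.inr m)

/-- The action of the simple reflections: for `i ≥ 1`, `s_i` interchanges `z_i` and `z_{i+1}`;
`s_0` sends `f(z_1, z_2, …; x_1, x_2, …)` to `f(-z_1, z_2, …; z_1, x_1, x_2, …)`, so it sends
`z_1` to `-z_1` and `p_k(x)` to `p_k(x) + z_1 ^ k`. -/
noncomputable def act : ℕ → SRing →ₐ[ℚ] SRing
  | 0 => MvPolynomial.aeval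
      (Sum.elim (fun j => if j = 0 then -zS 0 else zS j) (fun m => pS m + zS 0 ^ (2 * m + 1)))
  | i + 1 => MvPolynomial.aeval (Sum.elim (fun j => zS (Equiv.swap i (i + 1) j)) pS)

/-- The denominators of the divided differences: `-2 z_1` for `i = 0`, and `z_i - z_{i+1}` for
`i ≥ 1`. -/
noncomputable def denom : ℕ → SRing
  | 0 => -2 * zS 0
  | i + 1 => zS i - zS (i + 1)

theorem denom_dvd (i : ℕ) (f : SRing) : denom i ∣ f - act i f := by
  have key : (Ideal.Quotient.mkₐ ℚ (Ideal.span {denom i})) =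
      (Ideal.Quotient.mkₐ ℚ (Ideal.span {denom i})).comp (act i) := by
    apply MvPolynomial.algHom_ext
    intro v
    rw [AlgHom.comp_apply, Ideal.Quotient.mkₐ_eq_mk, Ideal.Quotient.mk_eq_mk_iff_sub_mem,
      Ideal.mem_span_singleton]
    cases i with
    | zero =>
      have h2 : (MvPolynomial.C (1 / 2 : ℚ) : SRing) * 2 = 1 := by
        have : (2 : SRing) = MvPolynomial.C (2 : ℚ) := (map_ofNat MvPolynomial.C 2).symm
        rw [this, ← MvPolynomial.C_mul]; norm_num
      rcases v with j | m
      · simp only [act, MvPolynomial.aeval_X, Sum.elim_inl, denom]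
        split_ifs with h
        · subst h; exact ⟨-1, by simp only [zS]; ring⟩
        · exact ⟨0, by simp [zS]⟩
      · refine ⟨MvPolynomial.C (1 / 2 : ℚ) * zS 0 ^ (2 * m), ?_⟩
        simp only [act, MvPolynomial.aeval_X, Sum.elim_inr, denom]
        simp only [pS]
        linear_combination (zS 0 ^ (2 * m + 1)) * h2
    | succ i =>
      rcases v with j | m
      · simp only [act, MvPolynomial.aeval_X, Sum.elim_inl, denom, Equiv.swap_apply_def]
        split_ifs with h h'
        · subst h; exact ⟨1, by simp only [zS]; ring⟩
        · subst h'; exact ⟨-1, by simp only [zS]; ring⟩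
        · exact ⟨0, by simp [zS]⟩
      · exact ⟨0, by simp [act, pS]⟩
  have h := congrArg (fun φ => φ f) key
  simp only [AlgHom.comp_apply, Ideal.Quotient.mkₐ_eq_mk] at h
  rwa [Ideal.Quotient.mk_eq_mk_iff_sub_mem, Ideal.mem_span_singleton] at h

/-- The divided difference operators
`∂_0 f = (f - s_0 f) / (-2 z_1)` and `∂_i f = (f - s_i f) / (z_i - z_{i+1})` for `i ≥ 1`.
The quotient is unique since `SRing` is a domain; see `denom_mul_divDiff`. -/
noncomputable def divDiff (i : ℕ) (f : SRing) : SRing := (denom_dvd i f).choose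

theorem denom_mul_divDiff (i : ℕ) (f : SRing) : denom i * divDiff i f = f - act i f :=
  (denom_dvd i f).choose_spec.symm

/-- The grading of `SRing`: `z_i` has degree `1` and `p_k(x)` has degree `k`. -/
def deg : ℕ ⊕ ℕ → ℕ := Sum.elim (fun _ => 1) (fun m => 2 * m + 1)

open Classical in
/-- The defining properties of the family of Schubert polynomials of type `C`. -/
structure IsSchubertFamily (C : BCInf → SRing) : Prop where
  homogeneous : ∀ w, ∃ d : ℕ, MvPolynomial.IsWeightedHomogeneous deg (C w) d
  one : C 1 = 1
  divDiff_eq : ∀ (i : ℕ) (w : BCInf),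
    divDiff i (C w) = if length (w * s i) < length w then C (w * s i) else 0

/-- The ring `ℚ[z_1, z_2, …, x_1, x_2, …]`. The variable `Sum.inl i` is `z_{i+1}`, and `Sum.inr j`
is `x_{j+1}`. -/
abbrev PRing : Type := MvPolynomial (ℕ ⊕ ℕ) ℚ

/-- `zP i` is `z_{i+1}`. -/
noncomputable def zP (i : ℕ) : PRing := MvPolynomial.X (Sum.inl i)

/-- `xP j` is `x_{j+1}`. -/
noncomputable def xP (j : ℕ) : PRing := MvPolynomial.X (Sum.inr j)

/-- The `k`-truncation `F ↦ F(z; x_1, …, x_k, 0, 0, …)`: it sends `p_m(x)` to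
`x_1 ^ m + ⋯ + x_k ^ m`. -/
noncomputable def trunc (k : ℕ) : SRing →ₐ[ℚ] PRing :=
  MvPolynomial.aeval (Sum.elim zP (fun m => ∑ j ∈ Finset.range k, xP j ^ (2 * m + 1)))

/-! ### Admissible monomials

Words and sequences are lists, whose positions are counted from `0`; an entry `j` of a sequence
of variable numbers stands for the variable `x_{j+1}`, respectively `z_{j+1}`. -/

/-- The peaks of a word: the interior positions `i` with `a_{i-1} < a_i > a_{i+1}`. -/
def peaks (a : List ℕ) : Set ℕ :=
  {i | 1 ≤ i ∧ i + 1 < a.length ∧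
    a.getD (i - 1) 0 < a.getD i 0 ∧ a.getD (i + 1) 0 < a.getD i 0}

/-- A weakly decreasing sequence `j` is `x`-admissible for `a` if `j_{i-1} = j_i = j_{i+1}` implies
that `i` is not a peak of `a`. -/
def IsXAdmissible (a j : List ℕ) : Prop :=
  j.length = a.length ∧ j.Pairwise (· ≥ ·) ∧
    ∀ i, 1 ≤ i → i + 1 < a.length →
      j.getD (i - 1) 0 = j.getD i 0 → j.getD i 0 = j.getD (i + 1) 0 → i ∉ peaks a

/-- A weakly increasing sequence `j` is `z`-admissible for `b` if the number of the variable at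
position `i` (that is, `j_i + 1`) is at most `b_i`, and `j_i = j_{i+1}` implies `b_i > b_{i+1}`. -/
def IsZAdmissible (b j : List ℕ) : Prop :=
  j.length = b.length ∧ j.Pairwise (· ≤ ·) ∧
    (∀ i, i < b.length → j.getD i 0 + 1 ≤ b.getD i 0) ∧
    ∀ i, i + 1 < b.length → j.getD i 0 = j.getD (i + 1) 0 → b.getD (i + 1) 0 < b.getD i 0

/-- The exponent vector of the monomial that is the product of the variables numbered by `j`. -/
noncomputable def expVec (j : List ℕ) : ℕ →₀ ℕ := Multiset.toFinsupp (j : Multiset ℕ)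

/-- The set of `x`-admissible monomials for `a`, as exponent vectors `α`. -/
def xAdm (a : List ℕ) : Set (ℕ →₀ ℕ) := {α | ∃ j, IsXAdmissible a j ∧ α = expVec j}

/-- The set of `z`-admissible monomials for `b`, as exponent vectors `β`. -/
def zAdm (b : List ℕ) : Set (ℕ →₀ ℕ) := {β | ∃ j, IsZAdmissible b j ∧ β = expVec j}

/-- The index of a summand in the Billey–Haiman sum. -/
structure BHIndex where
  u : BCInf
  v : BCInf
  a : List ℕ
  α : ℕ →₀ ℕ
  b : List ℕ
  β : ℕ →₀ ℕ

/-- The indices of the `k`-truncated Billey–Haiman sum for `w ∈ BC_n`: length-additive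
factorizations `w = u v` with `v ∈ S_n`, reduced words `a` of `u` and `b` of `v`, an `x`-admissible
monomial for `a` in `x_1, …, x_k` only, and a `z`-admissible monomial for `b`. -/
def bhIndices (n k : ℕ) (w : BCInf) : Set BHIndex :=
  {q | q.u * q.v = w ∧ length q.u + length q.v = length w ∧ q.v ∈ Sym n ∧
    q.a ∈ redWords q.u ∧ q.α ∈ xAdm q.a ∧ (∀ j, k ≤ j → q.α j = 0) ∧
    q.b ∈ redWords q.v ∧ q.β ∈ zAdm q.b}

/-- The summand `2^{i(α)} x^α z^β`, where `i(α)` is the number of variables that occur in `x^α`. -/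
noncomputable def bhTerm (q : BHIndex) : PRing :=
  2 ^ q.α.support.card * (q.α.prod fun j e => xP j ^ e) * (q.β.prod fun i e => zP i ^ e)

/-! ### `c`-signed pipe dreams -/

/-- The boxes of the base with a staircase block `(n-1, …, 2, 1)` and `k` `Γ`-blocks:
* `Sum.inl (r, c)` is the box of the staircase in row `r + 1` (from above) and column `c + 1`
  (from the left); row `r + 1` has `n - 1 - r` boxes;
* `Sum.inr (Sum.inl (g, i))` is the box number `i` (from left to right, starting from `0`) of
  the horizontal part of the `(g + 1)`-st `Γ`-block, counted from below;
* `Sum.inr (Sum.inr (g, i))` is the box number `i` (from top to bottom, starting from `0`) of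
  the vertical part of that `Γ`-block. -/
abbrev Box (n k : ℕ) : Type :=
  {p : Fin n × Fin n // p.1.val + p.2.val + 1 < n} ⊕ ((Fin k × Fin n) ⊕ (Fin k × Fin n))

/-- The number written in a box: the number of its diagonal in the staircase, the position in a
part of a `Γ`-block. -/
def label {n k : ℕ} : Box n k → ℕ
  | Sum.inl p => p.1.1.val + p.1.2.val + 1
  | Sum.inr (Sum.inl (_, i)) => i.val
  | Sum.inr (Sum.inr (_, i)) => i.val

/-- The elements that may fill a box with a given number: a single elbow or an elbow with a
faucet if the number is `0`, a pair of elbows or a cross otherwise. -/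
inductive Tile : ℕ → Type
  | elbow : Tile 0
  | faucet : Tile 0
  | elbows (i : ℕ) : Tile (i + 1)
  | cross (i : ℕ) : Tile (i + 1)

/-- The weight: `1` for the significant elements (crosses and elbows with faucets), else `0`. -/
def Tile.wt : {i : ℕ} → Tile i → ℕ
  | _, .elbow => 0
  | _, .faucet => 1
  | _, .elbows _ => 0
  | _, .cross _ => 1

/-- The letter of an element, as a word of length at most one: `s_i` for a cross in a box
numbered `i > 0`, `s_0` for an elbow with a faucet, nothing for the other elements. -/
def Tile.letter : {i : ℕ} → Tile i → List ℕ
  | _, .elbow => []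
  | _, .faucet => [0]
  | _, .elbows _ => []
  | _, .cross i => [i + 1]

/-- A box can be filled in exactly two ways. -/
def tileEquiv : (i : ℕ) → Bool ≃ Tile i
  | 0 =>
    { toFun := fun b => if b then .faucet else .elbow
      invFun := fun t => match t with
        | .faucet => true
        | .elbow => false
      left_inv := by intro b; cases b <;> rfl
      right_inv := by intro t; cases t <;> rfl }
  | i + 1 =>
    { toFun := fun b => if b then .cross i else .elbows i
      invFun := fun t => match t with
        | .cross _ => true
        | .elbows _ => false
      left_inv := by intro b; cases b <;> rfl
      right_inv := by intro t; cases t <;> rfl }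

instance (i : ℕ) : Fintype (Tile i) := Fintype.ofEquiv Bool (tileEquiv i)

/-- A `c`-signed pipe dream of size `n` with `k` `Γ`-blocks. (All places outside the base are
filled with elbows.) -/
abbrev PipeDream (n k : ℕ) : Type := (b : Box n k) → Tile (label b)

/-- The boxes of the base in reading order, rows from top to bottom and every row from right to
left. The topmost `Γ`-block is the `k`-th one; the horizontal part of a `Γ`-block forms one row and
lies above the vertical part; the staircase is at the bottom. -/
def readingOrder (n k : ℕ) : List (Box n k) :=
  ((List.finRange k).reverse.flatMap fun g =>
    ((List.finRange n).reverse.map fun i => Sum.inr (Sum.inl (g, i))) ++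
      ((List.finRange n).map fun i => Sum.inr (Sum.inr (g, i)))) ++
  ((List.finRange n).flatMap fun r =>
    (List.finRange n).reverse.filterMap fun c =>
      if h : r.val + c.val + 1 < n then some (Sum.inl ⟨(r, c), h⟩) else none)

/-- The word of a pipe dream. -/
def word {n k : ℕ} (D : PipeDream n k) : List ℕ :=
  (readingOrder n k).flatMap fun b => (D b).letter

/-- The variable of a box: `z_i` in the `i`-th row of the staircase, counted from above, and `x_i`
in the `i`-th `Γ`-block, counted from below. -/
noncomputable def var {n k : ℕ} : Box n k → PRing
  | Sum.inl p => zP p.1.1.val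
  | Sum.inr (Sum.inl (g, _)) => xP g.val
  | Sum.inr (Sum.inr (g, _)) => xP g.val

/-- The monomial `x^{α(D)} z^{β(D)}` of a pipe dream. -/
noncomputable def monomial {n k : ℕ} (D : PipeDream n k) : PRing :=
  ∏ b : Box n k, var b ^ (D b).wt

open Classical in
/-- The set of reduced `c`-signed pipe dreams of size `n` with `k` `Γ`-blocks and of shape `w`:
those whose word is a reduced word of `w`. -/
noncomputable def PD (n k : ℕ) (w : BCInf) : Finset (PipeDream n k) :=
  Finset.univ.filter fun D => word D ∈ redWords w

end TypeC

/-! All three expressions are the coefficient of w in one product over the nilCoxeter algebra, in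
the manner of Fomin and Kirillov. Let u_0, …, u_{n-1} be the nilCoxeter generators of BC_n, realised
as matrices of right multiplication, and put h_i(x) = 1 + x u_i. Multiplying the factors h_i of all
boxes of the base in reading order gives Γ(x_k) ⋯ Γ(x_1) · Stair(z), where Γ(x) = h_{n-1}(x) ⋯
h_0(x) h_0(x) ⋯ h_{n-1}(x). A product of generators survives only along reduced words, so the
coefficient of w is the sum, over the reduced words c of w, of the weights of the subwords of the
base that spell c (`nilCoeff_listProd`). A pipe dream is the same as its set of significant boxes,
that is, such a subword (`sum_PD_eq`).

For the Billey–Haiman sum, cut c at the end of the Γ-blocks and then at the end of every block and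
every row (`subwordSum_append`). A nonempty piece of a reduced word fits into a Γ-block exactly when
it has no peak, and then in two ways, because its lowest letter may go to either half
(`card_valley_splits`); this is x-admissibility with the factor 2^{i(α)}. A piece fits into row r of
the staircase exactly when it is strictly decreasing with letters at least r; this is
z-admissibility. The result is `finsum_bhTerm`.

For the Schubert polynomials, the Yang–Baxter equations of types A and C give Γ(x)Γ(y) = Γ(y)Γ(x)
and Γ(x)Γ(-x) = 1. Hence Γ(x) is the exponential of a sum of x^{2m+1} L_m with commuting nilpotent
L_m (`exists_gammaLog`). A product of Γ-blocks thus depends only on odd power sums, and it lifts to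
exp(∑ p_{2m+1} L_m) · Stair(z) with the p_{2m+1} as free variables (`schubertGen`). Acting by s_i
multiplies this matrix on the right by h_i(-`denom i`) (`act_schubertGen`), which is the divided
difference recurrence coefficient by coefficient. Truncation turns the exponential back into the
product of Γ-blocks.

Uniqueness is by induction on length: the difference of two candidates at w is fixed by every s_i,
so it is a constant (`eq_C_of_act_eq`), and constant terms vanish for w ≠ 1. Uniqueness on each BC_n
also makes the coefficients independent of n, so they form one family on BC_∞. -/

namespace TypeC

/-! ### The Coxeter combinatorics of signed permutations -/

/-- The smaller of the two neighbouring numbers that `s i` interchanges. -/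
def lo : ℕ → ℤ
  | 0 => -1
  | i + 1 => (i : ℤ) + 1

/-- The larger of the two neighbouring numbers that `s i` interchanges. -/
def hi : ℕ → ℤ
  | 0 => 1
  | i + 1 => (i : ℤ) + 2

theorem s_apply (i : ℕ) (x : ℤ) : (s i).1 x =
    if x = lo i then hi i else if x = hi i then lo i else
      if x = -lo i then -hi i else if x = -hi i then -lo i else x := by
  cases i with
  | zero =>
    simp only [s, simplePerm, Equiv.swap_apply_def, lo, hi]
    split_ifs <;> omega
  | succ i =>
    simp only [s, simplePerm, Equiv.swap_apply_def, lo, hi, Equiv.Perm.mul_apply]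
    split_ifs <;> omega

theorem lo_lt_hi (i : ℕ) : lo i < hi i := by
  cases i <;> simp only [lo, hi] <;> omega

theorem lo_ne_zero (i : ℕ) : lo i ≠ 0 := by
  cases i <;> simp only [lo] <;> omega

theorem hi_pos (i : ℕ) : 0 < hi i := by
  cases i <;> simp only [hi] <;> omega

theorem BCInf.ext' {v w : BCInf} (h : ∀ x, v.1 x = w.1 x) : v = w :=
  Subtype.ext (Equiv.ext h)

theorem mul_apply (v w : BCInf) (x : ℤ) : (v * w).1 x = v.1 (w.1 x) := rfl

theorem one_apply (x : ℤ) : (1 : BCInf).1 x = x := rfl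

theorem map_neg' (w : BCInf) (x : ℤ) : w.1 (-x) = -w.1 x := w.2.1 x

theorem map_zero' (w : BCInf) : w.1 0 = 0 := by
  have := map_neg' w 0
  simp only [neg_zero] at this
  omega

theorem map_ne_zero' (w : BCInf) {x : ℤ} (h : x ≠ 0) : w.1 x ≠ 0 := fun h' =>
  h (w.1.injective (h'.trans (map_zero' w).symm))

theorem s_mul_self (i : ℕ) : s i * s i = 1 := by
  apply BCInf.ext'
  intro x
  rw [mul_apply, one_apply, s_apply, s_apply]
  cases i <;> simp only [lo, hi] <;> split_ifs <;> omega

theorem s_inv (i : ℕ) : (s i)⁻¹ = s i := inv_eq_of_mul_eq_one_left (s_mul_self i)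

theorem mul_s_mul_s (w : BCInf) (i : ℕ) : w * s i * s i = w := by
  rw [mul_assoc, s_mul_self, mul_one]

theorem s_lo (i : ℕ) : (s i).1 (lo i) = hi i := by rw [s_apply]; simp

theorem s_hi (i : ℕ) : (s i).1 (hi i) = lo i := by
  rw [s_apply]; simp [(lo_lt_hi i).ne']

theorem s_apply_of_ne {i : ℕ} {x : ℤ} (h1 : x ≠ lo i) (h2 : x ≠ hi i) (h3 : x ≠ -lo i)
    (h4 : x ≠ -hi i) : (s i).1 x = x := by
  rw [s_apply]; simp [h1, h2, h3, h4]

/-- `lo c` and `hi c` are adjacent in ℤ ∖ {0}, so exchanging them reverses no pair besides this one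
and its negative. Zero has to be excluded: `s 0` also reverses 0 < 1. -/
theorem s_reverses {c : ℕ} {x y : ℤ} (hx : x ≠ 0) (hy : y ≠ 0) (h : x < y)
    (h' : (s c).1 y < (s c).1 x) : (x = lo c ∧ y = hi c) ∨ (x = -hi c ∧ y = -lo c) := by
  rw [s_apply, s_apply] at h'
  cases c <;> simp only [lo, hi] at * <;> split_ifs at h' <;> omega

/-- The conjugate of the reflection `s c` by `w` is again a reflection, determined by the pair that
it exchanges. It serves the exchange property and the braid relations. -/
theorem s_mul_eq_mul_s {c i : ℕ} {w : BCInf}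
    (h : (w.1 (lo i) = lo c ∧ w.1 (hi i) = hi c) ∨
      (w.1 (lo i) = -hi c ∧ w.1 (hi i) = -lo c)) : s c * w = w * s i := by
  apply BCInf.ext'
  intro x
  have key : ∀ x, x = lo i ∨ x = hi i → (s c).1 (w.1 x) = w.1 ((s i).1 x) := by
    rintro x (rfl | rfl) <;> rcases h with ⟨h1, h2⟩ | ⟨h1, h2⟩ <;>
      simp only [s_lo, s_hi, h1, h2, map_neg']
  rw [mul_apply, mul_apply]
  by_cases h1 : x = lo i ∨ x = hi i
  · exact key x h1
  by_cases h2 : -x = lo i ∨ -x = hi i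
  · have := key _ h2
    rw [map_neg', map_neg', map_neg', map_neg'] at this
    omega
  rw [not_or] at h1 h2
  have e : (s i).1 x = x := s_apply_of_ne h1.1 h1.2 (by omega) (by omega)
  rw [e]
  have inj : ∀ y, w.1 x = w.1 y → x = y := fun y hy => w.1.injective hy
  have i1 := inj (lo i)
  have i2 := inj (hi i)
  have i3 := inj (-lo i)
  have i4 := inj (-hi i)
  rw [map_neg'] at i3 i4
  apply s_apply_of_ne <;> intro hx <;> rcases h with ⟨h3, h4⟩ | ⟨h3, h4⟩ <;>
    rw [h3] at i1 i3 <;> rw [h4] at i2 i4 <;> omega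

/-! ### Words, the exchange property and length. -/

@[simp] theorem wordProd_nil : wordProd [] = 1 := rfl

@[simp] theorem wordProd_cons (i : ℕ) (a : List ℕ) : wordProd (i :: a) = s i * wordProd a := by
  simp [wordProd]

@[simp] theorem wordProd_append (a b : List ℕ) :
    wordProd (a ++ b) = wordProd a * wordProd b := by
  simp [wordProd]

theorem wordProd_reverse (a : List ℕ) : wordProd a.reverse = (wordProd a)⁻¹ := by
  induction a with
  | nil => simp
  | cons i a ih => simp [ih, s_inv]

/-- The exchange property. -/
theorem exists_delete (i : ℕ) (a : List ℕ) (h : (wordProd a).1 (hi i) < (wordProd a).1 (lo i)) :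
    ∃ b : List ℕ, b.length + 1 = a.length ∧ wordProd b = wordProd a * s i := by
  induction a with
  | nil => exact absurd h (not_lt.2 (lo_lt_hi i).le)
  | cons c a ih =>
    by_cases h' : (wordProd a).1 (hi i) < (wordProd a).1 (lo i)
    · obtain ⟨b, hb, hb'⟩ := ih h'
      exact ⟨c :: b, by simp [hb], by simp [hb', mul_assoc]⟩
    -- Here the letter `c` creates the inversion, so `s c * wordProd a = wordProd a * s i`, and
    -- deleting `c` has the effect of multiplying by `s i`.
    · have hne : (wordProd a).1 (lo i) ≠ (wordProd a).1 (hi i) := fun e =>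
        (lo_lt_hi i).ne ((wordProd a).1.injective e)
      have hlt := lt_of_le_of_ne (not_lt.1 h') hne
      rw [wordProd_cons, mul_apply, mul_apply] at h
      have := s_mul_eq_mul_s (s_reverses (map_ne_zero' _ (lo_ne_zero i))
        (map_ne_zero' _ (hi_pos i).ne') hlt h)
      exact ⟨a, by simp, by rw [wordProd_cons, this, mul_s_mul_s]⟩

theorem one_mem_BC (n : ℕ) : (1 : BCInf) ∈ BC n := fun _ _ => rfl

theorem mul_mem_BC {n : ℕ} {v w : BCInf} (hv : v ∈ BC n) (hw : w ∈ BC n) : v * w ∈ BC n :=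
  fun i hi => by rw [mul_apply, hw i hi, hv i hi]

theorem s_mem_BC {n i : ℕ} (h : i < n) : s i ∈ BC n := fun x hx => by
  rw [lt_abs] at hx
  apply s_apply_of_ne <;> cases i <;> simp only [lo, hi] <;> omega

theorem BC_mono {m n : ℕ} (h : m ≤ n) : BC m ⊆ BC n := fun _ hw i hi =>
  hw i (lt_of_le_of_lt (by exact_mod_cast h) hi)

theorem exists_mem_BC (w : BCInf) : ∃ n, w ∈ BC n := w.2.2

theorem wordProd_mem_BC {n : ℕ} {a : List ℕ} (h : ∀ i ∈ a, i < n) : wordProd a ∈ BC n := by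
  induction a with
  | nil => exact one_mem_BC n
  | cons i a ih =>
    rw [wordProd_cons]
    exact mul_mem_BC (s_mem_BC (h i (by simp))) (ih fun j hj => h j (by simp [hj]))

/-- Starting from `m`, one climbs to `n + 1` through ℤ ∖ {0}, each letter moving to the next
neighbour on the right. The number `d` is only the measure of the induction. -/
theorem exists_word_apply_eq (n : ℕ) (d : ℕ) : ∀ m : ℤ, m ≠ 0 → |m| ≤ n + 1 → m + d = n + 1 →
    ∃ a : List ℕ, (∀ i ∈ a, i < n + 1) ∧ (wordProd a).1 m = n + 1 := by
  induction d using Nat.strong_induction_on with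
  | _ d ih =>
    intro m hm hmn hd
    rw [abs_le] at hmn
    rcases Nat.eq_zero_or_pos d with rfl | hd0
    · exact ⟨[], by simp, by rw [wordProd_nil, one_apply]; push_cast at hd; omega⟩
    obtain ⟨c, hc, hcm⟩ : ∃ c : ℕ, c < n + 1 ∧ m < (s c).1 m ∧ |(s c).1 m| ≤ n + 1 := by
      rcases lt_trichotomy m (-1) with h | h | h
      · refine ⟨(-m - 1).toNat, by omega, ?_⟩
        obtain ⟨k, hk⟩ : ∃ k : ℕ, (-m - 1).toNat = k + 1 := ⟨(-m - 2).toNat, by omega⟩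
        rw [hk, s_apply, abs_le]; simp only [lo, hi]; split_ifs <;> omega
      · refine ⟨0, by omega, ?_⟩
        rw [s_apply, abs_le]; simp only [lo, hi]; omega
      · refine ⟨m.toNat, by omega, ?_⟩
        obtain ⟨k, hk⟩ : ∃ k : ℕ, m.toNat = k + 1 := ⟨(m - 1).toNat, by omega⟩
        rw [hk, s_apply, abs_le]; simp only [lo, hi]; split_ifs <;> omega
    have hcm' := abs_le.1 hcm.2
    obtain ⟨a, ha, ham⟩ := ih (n + 1 - (s c).1 m).toNat (by omega) ((s c).1 m)
      (map_ne_zero' _ hm) hcm.2 (by omega)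
    refine ⟨a ++ [c], ?_, ?_⟩
    · intro i hi
      rcases List.mem_append.1 hi with h | h
      · exact ha i h
      · rw [List.mem_singleton.1 h]; exact hc
    · simp only [wordProd_append, wordProd_cons, wordProd_nil, mul_one, mul_apply, ham]

/-- A word that brings the image of `n + 1` back to `n + 1`, multiplied on the left, reduces `w` to
an element of `BC n`. -/
theorem exists_wordProd_eq_of_mem_BC (n : ℕ) : ∀ w ∈ BC n, ∃ a : List ℕ, wordProd a = w := by
  induction n with
  | zero =>
    intro w hw
    refine ⟨[], BCInf.ext' fun x => ?_⟩
    rcases eq_or_ne x 0 with rfl | hx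
    · rw [map_zero', map_zero']
    · exact (hw x (by simpa using hx)).symm
  | succ n ih =>
    intro w hw
    have hb : |w.1 ((n : ℤ) + 1)| ≤ n + 1 := by
      by_contra h
      have := w.1.injective (hw (w.1 ((n : ℤ) + 1)) (by push_cast; omega))
      rw [this, abs_of_nonneg (by omega)] at h
      omega
    have hb' := abs_le.1 hb
    obtain ⟨a, ha, ham⟩ := exists_word_apply_eq n (n + 1 - w.1 ((n : ℤ) + 1)).toNat
      (w.1 ((n : ℤ) + 1)) (map_ne_zero' _ (by omega)) hb (by omega)
    have hv : wordProd a * w ∈ BC n := by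
      intro x hx
      by_cases h1 : x = n + 1
      · rw [h1, mul_apply, ham]
      by_cases h2 : x = -(n + 1)
      · rw [h2, map_neg', mul_apply, ham]
      · refine mul_mem_BC (wordProd_mem_BC ha) hw x ?_
        rw [lt_abs] at hx ⊢
        push_cast
        omega
    obtain ⟨b, hb⟩ := ih _ hv
    exact ⟨a.reverse ++ b, by rw [wordProd_append, hb, wordProd_reverse]; group⟩

theorem exists_wordProd_eq (w : BCInf) : ∃ a : List ℕ, wordProd a = w := by
  obtain ⟨n, hn⟩ := exists_mem_BC w
  exact exists_wordProd_eq_of_mem_BC n w hn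

theorem length_wordProd_le (a : List ℕ) : length (wordProd a) ≤ a.length :=
  Nat.sInf_le ⟨a, rfl, rfl⟩

theorem exists_redWord (w : BCInf) : ∃ a, a ∈ redWords w := by
  obtain ⟨a, ha⟩ := exists_wordProd_eq w
  exact Nat.sInf_mem (s := {l | ∃ a : List ℕ, wordProd a = w ∧ a.length = l}) ⟨_, a, ha, rfl⟩

theorem length_mul_le (v w : BCInf) : length (v * w) ≤ length v + length w := by
  obtain ⟨a, ha, ha'⟩ := exists_redWord v
  obtain ⟨b, hb, hb'⟩ := exists_redWord w
  have := length_wordProd_le (a ++ b)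
  rwa [wordProd_append, ha, hb, List.length_append, ha', hb'] at this

@[simp] theorem length_one : length 1 = 0 := Nat.le_zero.1 (length_wordProd_le [])

theorem length_s_le (i : ℕ) : length (s i) ≤ 1 := by
  simpa using length_wordProd_le [i]

theorem length_mul_s_le (w : BCInf) (i : ℕ) : length (w * s i) ≤ length w + 1 :=
  (length_mul_le w (s i)).trans (Nat.add_le_add_left (length_s_le i) _)

theorem length_le_mul_s (w : BCInf) (i : ℕ) : length w ≤ length (w * s i) + 1 := by
  simpa [mul_s_mul_s] using length_mul_s_le (w * s i) i

/-- Without a descent of `w`, the element `w * s i` has one, and the exchange property shortens a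
reduced word of it to a word for `w`. Then `w` would be the shorter of the two. -/
theorem descent_of_length_lt {w : BCInf} {i : ℕ} (h : length (w * s i) < length w) :
    w.1 (hi i) < w.1 (lo i) := by
  by_contra h'
  have hne : w.1 (lo i) ≠ w.1 (hi i) := fun e => (lo_lt_hi i).ne (w.1.injective e)
  obtain ⟨a, ha, ha'⟩ := exists_redWord (w * s i)
  obtain ⟨b, hb, hb'⟩ := exists_delete i a (by
    rw [ha, mul_apply, mul_apply, s_hi, s_lo]
    omega)
  rw [ha, mul_s_mul_s] at hb'
  have := length_wordProd_le b
  rw [hb'] at this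
  omega

/-- For `i ≥ n` the number `hi i` exceeds `n` and is fixed by `w`, while `w` cannot send `lo i`
above it; so there is no descent at `i`. -/
theorem lt_of_length_mul_s_lt {n : ℕ} {w : BCInf} (hw : w ∈ BC n) {i : ℕ}
    (h : length (w * s i) < length w) : i < n := by
  by_contra hi'
  have hd := descent_of_length_lt h
  have h1 : w.1 (hi i) = hi i := hw _ (by
    rw [abs_of_pos (hi_pos i)]; cases i <;> simp only [hi] <;> omega)
  have h2 : w.1 (lo i) ≤ hi i := by
    by_contra h3
    have h4 : w.1 (w.1 (lo i)) = w.1 (lo i) := hw _ (by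
      rw [lt_abs]; rw [← h1] at h3; left
      have : hi i ≥ n := by cases i <;> simp only [hi] <;> omega
      omega)
    have := w.1.injective h4
    have := lo_lt_hi i
    omega
  omega

/-- Subadditivity of length leaves no slack in either part. This converts length-additive
factorizations with reduced words of both factors into a reduced word with a cut. -/
theorem redWords_append_iff {a b : List ℕ} {w : BCInf} : a ++ b ∈ redWords w ↔
    wordProd a * wordProd b = w ∧ length (wordProd a) + length (wordProd b) = length w ∧
      a ∈ redWords (wordProd a) ∧ b ∈ redWords (wordProd b) := by
  simp only [redWords, Set.mem_ofPred_eq, wordProd_append, List.length_append, true_and]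
  constructor
  · rintro ⟨h1, h2⟩
    have := length_wordProd_le a
    have := length_wordProd_le b
    have := length_mul_le (wordProd a) (wordProd b)
    rw [h1] at this
    refine ⟨h1, ?_, ?_, ?_⟩ <;> omega
  · rintro ⟨h1, h2, h3, h4⟩
    exact ⟨h1, by omega⟩

theorem mem_redWords_mul {u v : BCInf} {a b : List ℕ} (ha : a ∈ redWords u) (hb : b ∈ redWords v)
    (h : length u + length v = length (u * v)) : a ++ b ∈ redWords (u * v) :=
  ⟨by rw [wordProd_append, ha.1, hb.1], by rw [List.length_append, ha.2, hb.2, h]⟩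

/-- The last letter of a reduced word is a descent, hence smaller than `n`, and removing it does not
leave `BC n`. -/
theorem lt_of_mem_redWords {n : ℕ} (a : List ℕ) : ∀ {w : BCInf}, w ∈ BC n → a ∈ redWords w →
    ∀ i ∈ a, i < n := by
  induction a using List.reverseRecOn with
  | nil => simp
  | append_singleton a c ih =>
    intro w hw ha
    obtain ⟨h1, h2, h3, h4⟩ := redWords_append_iff.1 ha
    have e : wordProd [c] = s c := by simp
    rw [e] at h1 h2 h4
    have hc1 : 1 = length (s c) := h4.2
    have e2 : w * s c = wordProd a := by rw [← h1, mul_s_mul_s]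
    have hc : c < n := lt_of_length_mul_s_lt hw (i := c) (by rw [e2]; omega)
    intro i hi
    rcases List.mem_append.1 hi with h | h
    · exact ih (e2 ▸ mul_mem_BC hw (s_mem_BC hc)) h3 i h
    · rwa [List.mem_singleton.1 h]

theorem mem_BC_of_length_add {n : ℕ} {u v : BCInf} (h : u * v ∈ BC n)
    (hl : length u + length v = length (u * v)) : u ∈ BC n ∧ v ∈ BC n := by
  obtain ⟨a, ha⟩ := exists_redWord u
  obtain ⟨b, hb⟩ := exists_redWord v
  have := lt_of_mem_redWords _ h (mem_redWords_mul ha hb hl)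
  constructor
  · rw [← ha.1]
    exact wordProd_mem_BC fun i hi => this i (List.mem_append_left _ hi)
  · rw [← hb.1]
    exact wordProd_mem_BC fun i hi => this i (List.mem_append_right _ hi)

theorem mul_s_mem_BC {n i : ℕ} {w : BCInf} (hw : w ∈ BC n) (h : length (w * s i) < length w) :
    w * s i ∈ BC n :=
  mul_mem_BC hw (s_mem_BC (lt_of_length_mul_s_lt hw h))

theorem exists_length_mul_s_lt {w : BCInf} (h : w ≠ 1) :
    ∃ i, length (w * s i) < length w := by
  obtain ⟨a, ha⟩ := exists_redWord w
  rcases List.eq_nil_or_concat' a with rfl | ⟨b, c, rfl⟩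
  · exact absurd ha.1.symm h
  · refine ⟨c, ?_⟩
    have e : w * s c = wordProd b := by rw [← ha.1]; simp [mul_assoc, s_mul_self]
    have := length_wordProd_le b
    have h2 := ha.2
    rw [List.length_append, List.length_singleton] at h2
    rw [e]; omega

theorem finite_BC (n : ℕ) : (BC n).Finite := by
  have hfin : (Set.pi Set.univ fun _ : Set.Icc (-n : ℤ) n => Set.Icc (-n : ℤ) n).Finite :=
    Set.Finite.pi fun _ => Set.finite_Icc _ _
  refine Set.Finite.of_injOn (f := fun (w : BCInf) (i : Set.Icc (-n : ℤ) n) => w.1 i) ?_ ?_ hfin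
  · intro w hw i _
    by_contra h
    have h' : (n : ℤ) < |w.1 i| := by
      rw [← not_le, abs_le]; exact h
    exact h (by simpa only [w.1.injective (hw _ h')] using i.2)
  · intro v hv w hw h
    apply BCInf.ext'
    intro x
    by_cases hx : (n : ℤ) < |x|
    · rw [hv x hx, hw x hx]
    · exact congrFun h ⟨x, abs_le.1 (not_lt.1 hx)⟩

theorem finite_redWords (w : BCInf) : (redWords w).Finite := by
  obtain ⟨n, hn⟩ := exists_mem_BC w
  refine ((List.finite_length_eq (Fin n) (length w)).image (List.map Fin.val)).subset ?_
  intro a ha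
  have := lt_of_mem_redWords a hn ha
  refine ⟨a.attach.map fun i => ⟨i.1, this i.1 i.2⟩, ?_, ?_⟩
  · simp [ha.2]
  · rw [List.map_map]; exact a.attach_map_subtype_val

end TypeC

namespace TypeC

/-! ### The nilCoxeter relations of type `C` -/

/-- Elements of a ring that satisfy the relations of the nilCoxeter algebra of type `C`. -/
structure IsNilCoxeter {T : Type*} [Ring T] (u : ℕ → T) : Prop where
  sq : ∀ i, u i * u i = 0
  comm : ∀ i j, i + 2 ≤ j → u i * u j = u j * u i
  braid : ∀ i, u (i + 1) * u (i + 2) * u (i + 1) = u (i + 2) * u (i + 1) * u (i + 2)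
  braid_zero : u 0 * u 1 * u 0 * u 1 = u 1 * u 0 * u 1 * u 0

/-! ### Yang–Baxter equations, commuting Γ-blocks and exchange of staircase rows. -/

section

variable {R T : Type*} [CommRing R] [Ring T] [Algebra R T]

/-- The factor `1 + x u_i`. -/
def hFac (u : ℕ → T) (i : ℕ) (x : R) : T := 1 + x • u i

/-- The product `h_{i+d-1}(x) ⋯ h_{i+1}(x) h_i(x)`. -/
def descProd (u : ℕ → T) (x : R) : ℕ → ℕ → T
  | _, 0 => 1
  | i, d + 1 => descProd u x (i + 1) d * hFac u i x

/-- The product `h_i(x) h_{i+1}(x) ⋯ h_{i+d-1}(x)`. -/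
def ascProd (u : ℕ → T) (x : R) : ℕ → ℕ → T
  | _, 0 => 1
  | i, d + 1 => hFac u i x * ascProd u x (i + 1) d

/-- The product of the factors of a `Γ`-block. -/
def gammaProd (u : ℕ → T) (N : ℕ) (x : R) : T := descProd u x 0 N * ascProd u x 0 N

/-- The product of the factors of the rows `q, …, q+d-1` of a staircase. -/
def stairProd (u : ℕ → T) (z : ℕ → R) : ℕ → ℕ → T
  | _, 0 => 1
  | q, d + 1 => descProd u (z q) (q + 1) (d + 1) * stairProd u z (q + 1) d

variable {u : ℕ → T}

@[simp] theorem hFac_zero (i : ℕ) : hFac u i (0 : R) = 1 := by simp [hFac]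

/-- The generators square to zero, so x ↦ h_i(x) is a one-parameter group. -/
theorem hFac_mul (hu : IsNilCoxeter u) (i : ℕ) (x y : R) :
    hFac u i x * hFac u i y = hFac u i (x + y) := by
  simp only [hFac, mul_add, add_mul, smul_mul_assoc, mul_smul_comm, hu.sq, one_mul, mul_one,
    smul_zero]
  module

theorem hFac_commute (hu : IsNilCoxeter u) {i j : ℕ} (h : i + 2 ≤ j) (x y : R) :
    Commute (hFac u i x) (hFac u j y) := by
  have : Commute (u i) (u j) := hu.comm i j h
  exact ((Commute.one_left _).add_left
    (((Commute.one_right _).add_right (this.smul_right y)).smul_left x))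

/-- The Yang–Baxter equation of type A: expand, cancel the squares and apply the braid relation to
the cubic term. -/
theorem hFac_braid (hu : IsNilCoxeter u) (i : ℕ) (x y : R) :
    hFac u (i + 1) x * hFac u (i + 2) (x + y) * hFac u (i + 1) y =
      hFac u (i + 2) y * hFac u (i + 1) (x + y) * hFac u (i + 2) x := by
  have h1 := hu.sq (i + 1)
  have h2 := hu.sq (i + 2)
  have h3 := hu.braid i
  simp only [hFac, mul_add, add_mul, smul_mul_assoc, mul_smul_comm, one_mul, mul_one, h1, h2, h3,
    smul_zero]
  module

/-- The Yang–Baxter equation of type C, which rests on the relation of length four between `u 0` and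
`u 1`. -/
theorem hFac_braid_zero (hu : IsNilCoxeter u) (x y : R) :
    hFac u 1 (x - y) * hFac u 0 (2 * x) * hFac u 1 (x + y) * hFac u 0 (2 * y) =
      hFac u 0 (2 * y) * hFac u 1 (x + y) * hFac u 0 (2 * x) * hFac u 1 (x - y) := by
  have h0 := hu.sq 0
  have h1 := hu.sq 1
  have h00 : ∀ t, t * u 0 * u 0 = 0 := fun t => by rw [mul_assoc, h0, mul_zero]
  have h11 : ∀ t, t * u 1 * u 1 = 0 := fun t => by rw [mul_assoc, h1, mul_zero]
  have h3 := hu.braid_zero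
  simp only [hFac, mul_add, add_mul, smul_mul_assoc, mul_smul_comm, one_mul, mul_one, h0, h1,
    h00, h11, h3, smul_zero, zero_mul]
  module

theorem hFac_neg_mul (hu : IsNilCoxeter u) (i : ℕ) (x : R) :
    hFac u i (-x) * hFac u i x = 1 := by simp [hFac_mul hu]

theorem hFac_mul_neg (hu : IsNilCoxeter u) (i : ℕ) (x : R) :
    hFac u i x * hFac u i (-x) = 1 := by simp [hFac_mul hu]

theorem descProd_mul_ascProd_neg (hu : IsNilCoxeter u) (x : R) (i d : ℕ) :
    descProd u x i d * ascProd u (-x) i d = 1 := by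
  induction d generalizing i with
  | zero => simp [descProd, ascProd]
  | succ d ih =>
    rw [descProd, ascProd, mul_assoc, ← mul_assoc (hFac u i x), hFac_mul_neg hu, one_mul, ih]

theorem ascProd_neg_mul_descProd (hu : IsNilCoxeter u) (x : R) (i d : ℕ) :
    ascProd u (-x) i d * descProd u x i d = 1 := by
  induction d generalizing i with
  | zero => simp [descProd, ascProd]
  | succ d ih =>
    rw [descProd, ascProd, mul_assoc, ← mul_assoc (ascProd u (-x) (i + 1) d), ih, one_mul,
      hFac_neg_mul hu]

theorem hFac_commute_descProd (hu : IsNilCoxeter u) (x y : R) {i j : ℕ} (d : ℕ) (h : i + 2 ≤ j) :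
    Commute (hFac u i x) (descProd u y j d) := by
  induction d generalizing j with
  | zero => exact Commute.one_right _
  | succ d ih => exact (ih (by omega)).mul_right (hFac_commute hu h x y)

/-- Induction on the number of factors. Moving the lowest factor of the first product to the right
splits off two shorter products, which commute by induction, and leaves a tail in h_{i+1} and
h_{i+2} that is symmetric in x and y by the Yang–Baxter equation. -/
theorem descProd_commute (hu : IsNilCoxeter u) (x y : R) (i d : ℕ) :
    Commute (descProd u x (i + 1) d) (descProd u y (i + 1) d) := by
  induction d generalizing i with
  | zero => exact Commute.one_right _
  | succ d ih =>
    cases d with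
    | zero =>
      simp only [descProd, one_mul]
      rw [Commute, SemiconjBy, hFac_mul hu, hFac_mul hu, add_comm x]
    | succ d =>
      have key : ∀ x y : R, descProd u x (i + 1) (d + 2) * descProd u y (i + 1) (d + 2) =
          descProd u x (i + 2) (d + 1) * descProd u y (i + 2) (d + 1) *
            (hFac u (i + 2) (-y) * hFac u (i + 1) x * hFac u (i + 2) y * hFac u (i + 1) y) := by
        intro x y
        have e1 : descProd u y (i + 3) d = descProd u y (i + 2) (d + 1) * hFac u (i + 2) (-y) := by
          rw [descProd, mul_assoc, hFac_mul_neg hu, mul_one]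
        calc descProd u x (i + 1) (d + 2) * descProd u y (i + 1) (d + 2)
            = descProd u x (i + 2) (d + 1) * (hFac u (i + 1) x * descProd u y (i + 3) d) *
                hFac u (i + 2) y * hFac u (i + 1) y := by
              simp only [descProd, mul_assoc]
          _ = _ := by
              rw [(hFac_commute_descProd hu x y d (by omega : i + 1 + 2 ≤ i + 3)).eq, e1]
              simp only [mul_assoc]
      have key2 : ∀ x y : R,
          hFac u (i + 2) (-y) * hFac u (i + 1) x * hFac u (i + 2) y * hFac u (i + 1) y =
          hFac u (i + 2) (-x) * hFac u (i + 1) y * hFac u (i + 2) x * hFac u (i + 1) x := by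
        intro x y
        have h := hFac_braid hu i x (y - x)
        have e : hFac u (i + 1) y = hFac u (i + 1) (y - x) * hFac u (i + 1) x := by
          rw [hFac_mul hu, sub_add_cancel]
        rw [add_sub_cancel] at h
        have e' : hFac u (i + 2) (-x) = hFac u (i + 2) (-y) * hFac u (i + 2) (y - x) := by
          rw [hFac_mul hu]; congr 1; ring
        rw [e']
        calc _ = hFac u (i + 2) (-y) * (hFac u (i + 1) x * hFac u (i + 2) y *
              hFac u (i + 1) (y - x)) * hFac u (i + 1) x := by
              simp only [mul_assoc]; rw [← e]
          _ = _ := by rw [h]; simp only [mul_assoc]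
      rw [Commute, SemiconjBy, key x y, key y x, key2 x y, (ih (i + 1)).eq]

/-- The shorter of two adjacent staircase rows is the longer one without its lowest factor. Since
full rows commute, exchanging the variables costs a single factor. -/
theorem descProd_swap (hu : IsNilCoxeter u) (x y : R) (i d : ℕ) :
    descProd u y (i + 1) (d + 1) * descProd u x (i + 2) d =
      descProd u x (i + 1) (d + 1) * descProd u y (i + 2) d * hFac u (i + 1) (y - x) := by
  have e : ∀ x : R, descProd u x (i + 2) d =
      descProd u x (i + 1) (d + 1) * hFac u (i + 1) (-x) := by
    intro x
    rw [descProd, mul_assoc, hFac_mul_neg hu, mul_one]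
  rw [e x, e y, ← mul_assoc, ← mul_assoc, mul_assoc _ (hFac u (i + 1) (-y)), hFac_mul hu,
    (descProd_commute hu y x i (d + 1)).eq]
  congr 2
  ring

theorem gammaProd_mul_neg (hu : IsNilCoxeter u) (N : ℕ) (x : R) :
    gammaProd u N x * gammaProd u N (-x) = 1 := by
  have h := ascProd_neg_mul_descProd hu (-x) 0 N
  rw [neg_neg] at h
  rw [gammaProd, gammaProd, mul_assoc, ← mul_assoc (ascProd u x 0 N), h, one_mul,
    descProd_mul_ascProd_neg hu]

theorem gammaProd_succ (hu : IsNilCoxeter u) (N : ℕ) (x : R) :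
    gammaProd u (N + 1) x =
      descProd u x 1 N * hFac u 0 (2 * x) * ascProd u x 1 N := by
  rw [gammaProd, descProd, ascProd, mul_assoc, ← mul_assoc (hFac u 0 x), hFac_mul hu, two_mul,
    ← mul_assoc]

/-- Let D and A be the descending and ascending products of the factors of index at least 1. As A(x)
is inverse to D(-x), all D and A commute with one another. Moving them outwards leaves a word in h_0
and h_1 that is symmetric by the type C Yang–Baxter equation. The size `N + 2` ensures that both
indices occur. -/
theorem gammaProd_commute (hu : IsNilCoxeter u) (N : ℕ) (x y : R) :
    Commute (gammaProd u (N + 2) x) (gammaProd u (N + 2) y) := by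
  set D : R → T := fun x => descProd u x 1 (N + 1) with hD
  set A : R → T := fun x => ascProd u x 1 (N + 1) with hA
  have hDA : ∀ x, D x * A (-x) = 1 := fun x => descProd_mul_ascProd_neg hu x 1 (N + 1)
  have hAD : ∀ x, A x * D (-x) = 1 := fun x => by
    simpa using ascProd_neg_mul_descProd hu (-x) 1 (N + 1)
  have hDD : ∀ x y, D x * D y = D y * D x := fun x y => descProd_commute hu x y 0 (N + 1)
  have hAA : ∀ x y, A x * A y = A y * A x := by
    intro x y
    have h1 : A x * A y * (D (-y) * D (-x)) = 1 := by
      rw [mul_assoc, ← mul_assoc (A y), hAD, one_mul, hAD]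
    have h2 : D (-y) * D (-x) * (A y * A x) = 1 := by
      have := hDA (-x)
      have := hDA (-y)
      rw [neg_neg] at *
      rw [hDD, mul_assoc, ← mul_assoc (D (-y)), ‹D (-y) * A y = 1›, one_mul, ‹D (-x) * A x = 1›]
    exact left_inv_eq_right_inv h1 h2
  have hADc : ∀ x y, A x * D y = D y * A x := by
    intro x y
    calc A x * D y = A x * (D y * D (-x)) * A x := by
          rw [mul_assoc, mul_assoc]
          have := hDA (-x)
          rw [neg_neg] at this
          rw [this, mul_one]
      _ = D y * A x := by rw [hDD, ← mul_assoc, hAD, one_mul]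
  have eD : ∀ y, D y = descProd u y 2 N * hFac u 1 y := fun y => rfl
  have eD2 : ∀ y, descProd u y 2 N = D y * hFac u 1 (-y) := fun y => by
    rw [eD, mul_assoc, hFac_mul_neg hu, mul_one]
  have eA : ∀ y, A y = hFac u 1 y * ascProd u y 2 N := fun y => rfl
  have eA2 : ∀ y, ascProd u y 2 N = hFac u 1 (-y) * A y := fun y => by
    rw [eA, ← mul_assoc, hFac_neg_mul hu, one_mul]
  have c1 : ∀ x y : R, hFac u 0 (2 * x) * descProd u y 2 N = descProd u y 2 N * hFac u 0 (2 * x) :=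
    fun x y => hFac_commute_descProd hu _ _ _ le_rfl
  have c2 : ∀ x y : R, hFac u 0 (2 * y) * ascProd u x 2 N = ascProd u x 2 N * hFac u 0 (2 * y) := by
    intro x y
    have h1 := descProd_mul_ascProd_neg hu (-x) 2 N
    have h2 := ascProd_neg_mul_descProd hu (-x) 2 N
    rw [neg_neg] at h1 h2
    calc _ = ascProd u x 2 N * (descProd u (-x) 2 N * hFac u 0 (2 * y)) * ascProd u x 2 N := by
          rw [← mul_assoc (ascProd u x 2 N), h2, one_mul]
      _ = _ := by rw [← c1, mul_assoc, mul_assoc, h1, mul_one]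
  have key : ∀ x y, gammaProd u (N + 2) x * gammaProd u (N + 2) y =
      D x * D y * (hFac u 1 (-y) * hFac u 0 (2 * x) * hFac u 1 (x + y) * hFac u 0 (2 * y) *
        hFac u 1 (-x)) * (A x * A y) := by
    intro x y
    calc gammaProd u (N + 2) x * gammaProd u (N + 2) y
        = D x * hFac u 0 (2 * x) * (A x * D y) * hFac u 0 (2 * y) * A y := by
          rw [gammaProd_succ hu, gammaProd_succ hu]
          simp only [hD, hA, mul_assoc]
      _ = D x * (hFac u 0 (2 * x) * descProd u y 2 N) * (hFac u 1 y * hFac u 1 x) *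
            (ascProd u x 2 N * hFac u 0 (2 * y)) * A y := by
          rw [hADc, eD y, eA x]
          simp only [mul_assoc]
      _ = _ := by
          rw [c1, ← c2, eD2, eA2, hFac_mul hu, add_comm y x]
          simp only [mul_assoc]
  -- Splitting off h_1(-x) on the left exposes the four factors of `hFac_braid_zero`.
  have key2 : ∀ x y : R,
      hFac u 1 (-y) * hFac u 0 (2 * x) * hFac u 1 (x + y) * hFac u 0 (2 * y) * hFac u 1 (-x) =
      hFac u 1 (-x) * (hFac u 1 (x - y) * hFac u 0 (2 * x) * hFac u 1 (x + y) *
        hFac u 0 (2 * y)) * hFac u 1 (-x) := by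
    intro x y
    have e : hFac u 1 (-y) = hFac u 1 (-x) * hFac u 1 (x - y) := by
      rw [hFac_mul hu]; congr 1; ring
    rw [e]; simp only [mul_assoc]
  rw [Commute, SemiconjBy, key x y, key y x, hDD y x, hAA y x, key2 x y, hFac_braid_zero hu]
  congr 2
  have e : hFac u 1 (-y) = hFac u 1 (x - y) * hFac u 1 (-x) := by
    rw [hFac_mul hu]; congr 1; ring
  rw [e, add_comm y x]
  simp only [mul_assoc]

/-- This drives the action of s_0: the Γ-block in z_1 that the shift of the power sums creates turns
the first row at -z_1 back into the row at z_1, at the cost of h_0(2 z_1). -/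
theorem gammaProd_mul_descProd_neg (hu : IsNilCoxeter u) (N : ℕ) (x : R) :
    gammaProd u (N + 1) x * descProd u (-x) 1 N = descProd u x 1 N * hFac u 0 (2 * x) := by
  have h := ascProd_neg_mul_descProd hu (-x) 1 N
  rw [neg_neg] at h
  rw [gammaProd_succ hu, mul_assoc, h, mul_one]

theorem hFac_commute_stairProd (hu : IsNilCoxeter u) (x : R) (z : ℕ → R) {i q : ℕ} (d : ℕ)
    (h : i + 1 ≤ q) : Commute (hFac u i x) (stairProd u z q d) := by
  induction d generalizing q with
  | zero => exact Commute.one_right _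
  | succ d ih =>
    exact (hFac_commute_descProd hu _ _ _ (by omega)).mul_right (ih (by omega))

theorem stairProd_congr {z z' : ℕ → R} {q : ℕ} (d : ℕ) (h : ∀ j, q ≤ j → z j = z' j) :
    stairProd u z q d = stairProd u z' q d := by
  induction d generalizing q with
  | zero => rfl
  | succ d ih => rw [stairProd, stairProd, h q le_rfl, ih fun j hj => h j (by omega)]

/-- Only the rows `i` and `i + 1` are affected. The extra factor h_{i+1} passes through the rows
below, whose indices are at least `i + 3`. -/
theorem stairProd_swap (hu : IsNilCoxeter u) {z z' : ℕ → R} {i q d : ℕ} (hq : q ≤ i)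
    (hd : i < q + d) (h1 : z' i = z (i + 1)) (h2 : z' (i + 1) = z i)
    (h : ∀ j, j ≠ i → j ≠ i + 1 → z' j = z j) :
    stairProd u z' q d = stairProd u z q d * hFac u (i + 1) (z (i + 1) - z i) := by
  induction d generalizing q with
  | zero => omega
  | succ d ih =>
    rcases eq_or_lt_of_le hq with rfl | hq
    · cases d with
      -- Row `i` is the last one and consists of the single factor h_{i+1}, so there is no second
      -- row to exchange it with.
      | zero =>
        simp only [stairProd, descProd, one_mul, mul_one, h1]
        rw [hFac_mul hu, add_sub_cancel]
      | succ d =>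
        have hc := (hFac_commute_stairProd hu (z (q + 1) - z q) z d
          (le_refl (q + 1 + 1))).eq
        rw [stairProd, stairProd, stairProd, stairProd, h1, h2, ← mul_assoc, ← mul_assoc,
          descProd_swap hu, stairProd_congr d fun j hj => h j (by omega) (by omega)]
        simp only [mul_assoc, hc]
    · rw [stairProd, stairProd, h q (by omega) (by omega), ih (by omega) (by omega), mul_assoc]

/-- Generators of index at least `n` vanish and contribute trivial factors, so sizes may be enlarged
to make room for the identities above. -/
theorem descProd_add (x : R) {n : ℕ} (hn : ∀ j, n ≤ j → u j = 0) (e i d : ℕ) (h : n ≤ i + d) :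
    descProd u x i (d + e) = descProd u x i d := by
  have h0 : ∀ e i, n ≤ i → descProd u x i e = 1 := by
    intro e
    induction e with
    | zero => intros; rfl
    | succ e ih => intro i hi; rw [descProd, ih _ (by omega), hFac, hn i hi, smul_zero]; simp
  induction d generalizing i with
  | zero => rw [zero_add, h0 e i (by omega)]; rfl
  | succ d ih => rw [add_right_comm, descProd, descProd, ih _ (by omega)]

theorem ascProd_add (x : R) {n : ℕ} (hn : ∀ j, n ≤ j → u j = 0) (e i d : ℕ) (h : n ≤ i + d) :
    ascProd u x i (d + e) = ascProd u x i d := by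
  have h0 : ∀ e i, n ≤ i → ascProd u x i e = 1 := by
    intro e
    induction e with
    | zero => intros; rfl
    | succ e ih => intro i hi; rw [ascProd, ih _ (by omega), hFac, hn i hi, smul_zero]; simp
  induction d generalizing i with
  | zero => rw [zero_add, h0 e i (by omega)]; rfl
  | succ d ih => rw [add_right_comm, ascProd, ascProd, ih _ (by omega)]

theorem gammaProd_add (x : R) {n : ℕ} (hn : ∀ j, n ≤ j → u j = 0) (e : ℕ) :
    gammaProd u (n + e) x = gammaProd u n x := by
  rw [gammaProd, gammaProd, descProd_add x hn e 0 n (by omega), ascProd_add x hn e 0 n (by omega)]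

theorem stairProd_add (z : ℕ → R) {n : ℕ} (hn : ∀ j, n ≤ j → u j = 0) (e q d : ℕ)
    (h : n ≤ q + d + 1) : stairProd u z q (d + e) = stairProd u z q d := by
  have h0 : ∀ e q, n ≤ q + 1 → stairProd u z q e = 1 := by
    intro e
    induction e with
    | zero => intros; rfl
    | succ e ih =>
      intro q hq
      have := descProd_add (z q) hn (e + 1) (q + 1) 0 (by omega)
      rw [zero_add] at this
      rw [stairProd, ih _ (by omega), this, descProd, one_mul]
  induction d generalizing q with
  | zero => rw [zero_add, h0 e q (by omega)]; rfl
  | succ d ih =>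
    have := descProd_add (z q) hn e (q + 1) (d + 1) (by omega)
    rw [add_right_comm] at this
    rw [add_right_comm, stairProd, stairProd, ih _ (by omega), this]

end

/-! ### Base change along ring homomorphisms. -/

section

variable {R R' T T' : Type*} [CommRing R] [Ring T] [Algebra R T] [CommRing R'] [Ring T']
  [Algebra R' T'] (f : T →+* T') (g : R →+* R') {u : ℕ → T}

theorem map_hFac (hf : ∀ (r : R) (t : T), f (r • t) = g r • f t) (i : ℕ) (x : R) :
    f (hFac u i x) = hFac (f ∘ u) i (g x) := by
  simp [hFac, hf]

theorem map_descProd (hf : ∀ (r : R) (t : T), f (r • t) = g r • f t) (x : R) (i d : ℕ) :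
    f (descProd u x i d) = descProd (f ∘ u) (g x) i d := by
  induction d generalizing i with
  | zero => simp [descProd]
  | succ d ih => rw [descProd, map_mul, ih, map_hFac f g hf, descProd]

theorem map_ascProd (hf : ∀ (r : R) (t : T), f (r • t) = g r • f t) (x : R) (i d : ℕ) :
    f (ascProd u x i d) = ascProd (f ∘ u) (g x) i d := by
  induction d generalizing i with
  | zero => simp [ascProd]
  | succ d ih => rw [ascProd, map_mul, ih, map_hFac f g hf, ascProd]

theorem map_gammaProd (hf : ∀ (r : R) (t : T), f (r • t) = g r • f t) (x : R) (N : ℕ) :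
    f (gammaProd u N x) = gammaProd (f ∘ u) N (g x) := by
  rw [gammaProd, map_mul, map_descProd f g hf, map_ascProd f g hf, gammaProd]

theorem map_stairProd (hf : ∀ (r : R) (t : T), f (r • t) = g r • f t) (z : ℕ → R) (q d : ℕ) :
    f (stairProd u z q d) = stairProd (f ∘ u) (g ∘ z) q d := by
  induction d generalizing q with
  | zero => simp [stairProd]
  | succ d ih => rw [stairProd, map_mul, ih, map_descProd f g hf, stairProd]; rfl

end

end TypeC

namespace TypeC

/-! ### Exponentials of nilpotent elements -/

section

variable {A : Type*} [CommRing A] [Algebra ℚ A]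

open Polynomial in
-- The exponential on the left is truncated one term later than the one on the right, so that
-- differentiation, which loses a term, matches them termwise.
theorem derivative_exp {P : A[X]} (hP : IsNilpotent P) :
    derivative (IsNilpotent.exp P) = derivative P * IsNilpotent.exp P := by
  obtain ⟨n, hn⟩ := hP
  have hn' : P ^ (n + 1) = 0 := by rw [pow_succ, hn, zero_mul]
  have e1 := IsNilpotent.exp_eq_sum hn'
  have e2 := IsNilpotent.exp_eq_sum hn
  conv_rhs => rw [e2]
  rw [e1, Finset.sum_range_succ', derivative_add, Finset.mul_sum]
  simp only [pow_zero, derivative_smul, derivative_one, smul_zero, add_zero, derivative_sum]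
  refine Finset.sum_congr rfl fun i _ => ?_
  rw [derivative_pow_succ, mul_smul_comm]
  have h : (((i + 1).factorial : ℚ)⁻¹) * (i + 1 : ℚ) = ((i.factorial : ℚ)⁻¹) := by
    rw [Nat.factorial_succ]
    push_cast
    field_simp
  have h2 : (C ((i : A) + 1) : A[X]) = algebraMap ℚ A[X] (i + 1) := by
    simp
  rw [h2, ← h, mul_assoc, ← Algebra.smul_def, smul_smul, mul_comm (P ^ i)]

open Polynomial in
/-- The coefficients of the odd powers in the logarithm of `c`, when `c(X) c(-X) = 1`. -/
noncomputable def logCoeff (c : A[X]) (m : ℕ) : A :=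
  ((2 * m + 1 : ℕ) : ℚ)⁻¹ • (derivative c * c.comp (-X)).coeff (2 * m)

open Polynomial in
theorem isNilpotent_logCoeff {c : A[X]} (hc : ∀ i, 1 ≤ i → IsNilpotent (c.coeff i)) (m : ℕ) :
    IsNilpotent (logCoeff c m) := by
  refine IsNilpotent.smul ?_ _
  rw [coeff_mul]
  rw [← mem_nilradical]
  refine Ideal.sum_mem _ fun p _ => Ideal.mul_mem_right _ _ ?_
  rw [coeff_derivative]
  exact Ideal.mul_mem_right _ _ (mem_nilradical.2 (hc _ (by omega)))

open Polynomial in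
-- As c(X) c(-X) = 1, the logarithmic derivative of c is c'(X) c(-X), a polynomial. It is even, so
-- its primitive P without constant term is odd. Then exp(P) c(-X) has derivative 0 and constant
-- term 1, hence equals 1. Nilpotency of the coefficients keeps the exponential a finite sum.
theorem exp_log {c : A[X]} (h0 : c.coeff 0 = 1) (h : c * c.comp (-X) = 1)
    (hc : ∀ i, 1 ≤ i → IsNilpotent (c.coeff i)) {M : ℕ} (hM : 2 * c.natDegree ≤ 2 * M) :
    IsNilpotent.exp (∑ m ∈ Finset.range M, C (logCoeff c m) * X ^ (2 * m + 1)) = c := by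
  set P : A[X] := ∑ m ∈ Finset.range M, C (logCoeff c m) * X ^ (2 * m + 1) with hPdef
  have hPn : IsNilpotent P := by
    rw [← mem_nilradical]
    refine Ideal.sum_mem _ fun m _ => Ideal.mul_mem_right _ _ (mem_nilradical.2 ?_)
    exact (isNilpotent_logCoeff hc m).map C
  set c' : A[X] := c.comp (-X) with hc'
  have hcc : c'.comp (-X) = c := by rw [hc', comp_assoc]; simp
  set Q : A[X] := derivative c * c' with hQ
  have hd' : derivative c' = -(derivative c).comp (-X) := by
    rw [hc', derivative_comp]; simp
  have hQ2 : Q = c * (derivative c).comp (-X) := by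
    have h2 : derivative (c * c') = 0 := by rw [h, derivative_one]
    rw [derivative_mul, hd'] at h2
    linear_combination h2
  have hQeven : Q.comp (-X) = Q := by
    rw [hQ, mul_comp, hcc, mul_comm]; exact hQ2.symm
  have hQodd : ∀ m, Odd m → Q.coeff m = 0 := by
    intro m hm
    have h1 := congrArg (fun p => coeff p m) hQeven
    have h3 : (-X : A[X]) = C (-1) * X := by simp
    rw [h3, comp_C_mul_X_coeff, hm.neg_one_pow] at h1
    have h4 : (2 : ℚ) • Q.coeff m = 0 := by rw [two_smul]; linear_combination -h1
    simpa using h4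
  have hPQ : derivative P = Q := by
    ext m
    -- The degree of Q is at most deg c - 1 + deg c, so the range of `M` odd powers misses no
    -- coefficient. A constant c is treated apart because its derivative does not drop the degree.
    have hb : Q.coeff m ≠ 0 → m < 2 * M := by
      intro hne
      by_contra hge
      apply hne
      rcases Nat.eq_zero_or_pos c.natDegree with hz | hz
      · rw [hQ, eq_C_of_natDegree_eq_zero hz]; simp
      apply coeff_eq_zero_of_natDegree_lt
      refine lt_of_le_of_lt natDegree_mul_le ?_
      have h1 := natDegree_derivative_lt hz.ne'
      have h2 : c'.natDegree ≤ c.natDegree := by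
        refine natDegree_comp_le.trans ?_
        have : (-X : A[X]).natDegree ≤ 1 := by rw [natDegree_neg]; exact natDegree_X_le
        nlinarith
      omega
    rw [coeff_derivative, hPdef, finsetSum_coeff]
    simp only [coeff_C_mul, coeff_X_pow]
    rcases Nat.even_or_odd m with hm | hm
    · obtain ⟨t, rfl⟩ := even_iff_exists_two_mul.1 hm
      simp only [Nat.add_right_cancel_iff, mul_eq_mul_left_iff, mul_ite, mul_one,
        mul_zero, OfNat.ofNat_ne_zero, or_false, Finset.sum_ite_eq, Finset.mem_range]
      have e : logCoeff c t * (((2 * t : ℕ) : A) + 1) = Q.coeff (2 * t) := by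
        have : (((2 * t : ℕ) : A) + 1) = algebraMap ℚ A ((2 * t + 1 : ℕ) : ℚ) := by
          rw [map_natCast]; push_cast; rfl
        rw [this, mul_comm, ← Algebra.smul_def, logCoeff, smul_smul, mul_inv_cancel₀, one_smul]
        exact_mod_cast Nat.succ_ne_zero (2 * t)
      split_ifs with hlt
      · exact e
      · rw [zero_mul]
        by_contra hne
        have := hb (Ne.symm hne)
        omega
    · rw [hQodd m hm, Finset.sum_eq_zero, zero_mul]
      intro t _
      rw [if_neg, mul_zero]
      rintro h'
      rw [Nat.odd_iff] at hm
      omega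
  have hz : derivative (IsNilpotent.exp P * c') = 0 := by
    rw [derivative_mul, derivative_exp hPn, hPQ, hQ2, hd']
    linear_combination (IsNilpotent.exp P * (derivative c).comp (-X)) * h
  have hconst : ∃ a, IsNilpotent.exp P * c' = C a := by
    refine ⟨(IsNilpotent.exp P * c').coeff 0, ?_⟩
    ext m
    rw [coeff_C]
    split_ifs with hm
    · rw [hm]
    · obtain ⟨t, rfl⟩ := Nat.exists_eq_succ_of_ne_zero hm
      have h1 := congrArg (fun p => coeff p t) hz
      have h2 : ((t : A) + 1) = algebraMap ℚ A ((t + 1 : ℕ) : ℚ) := by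
        rw [map_natCast]; push_cast; rfl
      simp only [coeff_derivative, coeff_zero] at h1
      rw [h2, mul_comm, ← Algebra.smul_def] at h1
      exact (smul_eq_zero.1 h1).resolve_left (by exact_mod_cast Nat.succ_ne_zero t)
  obtain ⟨a, ha⟩ := hconst
  have hP0 : P.coeff 0 = 0 := by
    rw [hPdef, finsetSum_coeff]
    refine Finset.sum_eq_zero fun m _ => ?_
    rw [coeff_C_mul, coeff_X_pow, if_neg (by omega), mul_zero]
  have he0 : (IsNilpotent.exp P).coeff 0 = 1 := by
    have := IsNilpotent.map_exp hPn (constantCoeff (R := A))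
    rw [constantCoeff_apply, constantCoeff_apply, hP0, IsNilpotent.exp_zero] at this
    exact this
  have hc0 : c'.coeff 0 = 1 := by
    rw [coeff_zero_eq_eval_zero, hc', eval_comp]
    simp [← coeff_zero_eq_eval_zero, h0]
  have ha1 : a = 1 := by
    have := congrArg (fun p => coeff p 0) ha
    simp only [mul_coeff_zero, he0, hc0, coeff_C_zero, mul_one] at this
    exact this.symm
  rw [ha1, C_1] at ha
  linear_combination c * ha - IsNilpotent.exp P * h

end

end TypeC

namespace TypeC

/-! ### The regular representation of the nilCoxeter algebra -/

/-- The type of elements of `BC n`. -/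
abbrev Idx (n : ℕ) : Type := {w : BCInf // w ∈ BC n}

noncomputable instance (n : ℕ) : Fintype (Idx n) := (finite_BC n).fintype

noncomputable instance (n : ℕ) : DecidableEq (Idx n) := Classical.decEq _

/-- The identity, as an element of `BC n`. -/
def idxOne (n : ℕ) : Idx n := ⟨1, one_mem_BC n⟩

open Classical in
/-- Right multiplication by a generator of the nilCoxeter algebra. -/
noncomputable def nilGen (R : Type*) [CommRing R] (n i : ℕ) : Matrix (Idx n) (Idx n) R :=
  Matrix.of fun v w => if w.1 = v.1 * s i ∧ length w.1 = length v.1 + 1 then 1 else 0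

section

variable {R : Type*} [CommRing R] {n : ℕ}

open Classical in
theorem nilGen_apply (i : ℕ) (v w : Idx n) : nilGen R n i v w =
    if w.1 = v.1 * s i ∧ length w.1 = length v.1 + 1 then 1 else 0 := rfl

open Classical in
-- Each letter raises the length by at most one, so a nonzero entry needs every letter to raise it.
-- The intermediate elements are then determined and stay in `BC n` by length additivity.
theorem prod_nilGen_apply (a : List ℕ) (v w : Idx n) : (a.map (nilGen R n)).prod v w =
    if w.1 = v.1 * wordProd a ∧ length w.1 = length v.1 + a.length then 1 else 0 := by
  induction a generalizing v with
  | nil =>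
    simp only [List.map_nil, List.prod_nil, Matrix.one_apply, wordProd_nil, mul_one,
      List.length_nil, add_zero]
    refine if_congr ⟨?_, ?_⟩ rfl rfl
    · rintro rfl; exact ⟨rfl, rfl⟩
    · rintro ⟨h, -⟩; exact (Subtype.ext h).symm
  | cons i a ih =>
    rw [List.map_cons, List.prod_cons, Matrix.mul_apply]
    simp only [ih, nilGen_apply, wordProd_cons, List.length_cons, ite_mul, one_mul, zero_mul]
    by_cases h : w.1 = v.1 * (s i * wordProd a) ∧ length w.1 = length v.1 + (a.length + 1)
    · rw [if_pos h]
      have h1 := length_mul_s_le v.1 i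
      have h2 := length_mul_le (v.1 * s i) (wordProd a)
      have h3 := length_wordProd_le a
      rw [mul_assoc, ← h.1] at h2
      have h4 : length (v.1 * s i) = length v.1 + 1 := by omega
      have hm : v.1 * s i * wordProd a ∈ BC n := by rw [mul_assoc, ← h.1]; exact w.2
      have h5 := (mem_BC_of_length_add hm (by rw [mul_assoc, ← h.1]; omega)).1
      rw [Finset.sum_eq_single ⟨v.1 * s i, h5⟩]
      · simp only [h4, and_self, if_true]
        rw [if_pos ⟨by rw [h.1, mul_assoc], by omega⟩]
      · intro t _ ht
        rw [if_neg]
        rintro ⟨h6, -⟩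
        exact ht (Subtype.ext h6)
      · simp
    · rw [if_neg h]
      refine Finset.sum_eq_zero fun t _ => ?_
      split_ifs with h1 h2
      · exfalso
        refine h ⟨?_, ?_⟩
        · rw [h2.1, h1.1, mul_assoc]
        · omega
      · rfl
      · rfl

/-- The matrix of a word depends only on the group element and the number of letters, so relations
between words of equal length carry over from the group. -/
theorem prod_nilGen_eq {a b : List ℕ} (h : wordProd a = wordProd b) (hl : a.length = b.length) :
    (a.map (nilGen R n)).prod = (b.map (nilGen R n)).prod := by
  ext v w
  rw [prod_nilGen_apply, prod_nilGen_apply, h, hl]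

theorem s_mul_comm {i j : ℕ} (h : i + 2 ≤ j) : s i * s j = s j * s i := by
  apply BCInf.ext'
  intro x
  obtain ⟨j, rfl⟩ : ∃ k, j = k + 1 := ⟨j - 1, by omega⟩
  simp only [mul_apply, s_apply]
  cases i <;> simp only [lo, hi] <;> split_ifs <;> omega

theorem s_braid (i : ℕ) :
    s (i + 1) * s (i + 2) * s (i + 1) = s (i + 2) * s (i + 1) * s (i + 2) := by
  have h : s (i + 2) * (s (i + 1) * s (i + 2)) = (s (i + 1) * s (i + 2)) * s (i + 1) := by
    apply s_mul_eq_mul_s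
    left
    simp only [mul_apply, s_apply, lo, hi]
    constructor <;> push_cast <;> split_ifs <;> omega
  rw [← h, mul_assoc]

theorem s_braid_zero : s 0 * s 1 * s 0 * s 1 = s 1 * s 0 * s 1 * s 0 := by
  have h : s 0 * (s 1 * s 0 * s 1) = (s 1 * s 0 * s 1) * s 0 := by
    apply s_mul_eq_mul_s
    simp only [mul_apply, s_apply, lo, hi]
    norm_num
  rw [← h]
  simp only [mul_assoc]

theorem isNilCoxeter_nilGen : IsNilCoxeter (nilGen R n) where
  sq i := by
    ext v w
    have := prod_nilGen_apply (R := R) [i, i] v w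
    simp only [List.map_cons, List.map_nil, List.prod_cons, List.prod_nil, mul_one] at this
    rw [this, if_neg, Matrix.zero_apply]
    rintro ⟨h1, h2⟩
    simp only [wordProd_cons, wordProd_nil, mul_one, s_mul_self] at h1
    rw [h1] at h2
    simp at h2
  comm i j h := by
    have := prod_nilGen_eq (R := R) (n := n) (a := [i, j]) (b := [j, i])
      (by simp [s_mul_comm h]) rfl
    simpa using this
  braid i := by
    have := prod_nilGen_eq (R := R) (n := n) (a := [i + 1, i + 2, i + 1])
      (b := [i + 2, i + 1, i + 2]) (by simpa [mul_assoc] using s_braid i) rfl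
    simpa [mul_assoc] using this
  braid_zero := by
    have := prod_nilGen_eq (R := R) (n := n) (a := [0, 1, 0, 1])
      (b := [1, 0, 1, 0]) (by simpa [mul_assoc] using s_braid_zero) rfl
    simpa [mul_assoc] using this

theorem nilGen_eq_zero {i : ℕ} (h : n ≤ i) : nilGen R n i = 0 := by
  ext v w
  rw [nilGen_apply, if_neg, Matrix.zero_apply]
  rintro ⟨h1, h2⟩
  have h3 : w.1 * s i = v.1 := by rw [h1, mul_s_mul_s]
  have := lt_of_length_mul_s_lt w.2 (i := i) (by rw [h3]; omega)
  omega

theorem map_nilGen {R' : Type*} [CommRing R'] (f : R →+* R') (i : ℕ) :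
    f.mapMatrix (nilGen R n i) = nilGen R' n i := by
  ext v w
  simp only [RingHom.mapMatrix_apply, Matrix.map_apply, nilGen_apply]
  split_ifs <;> simp

theorem mapMatrix_smul {R' : Type*} [CommRing R'] (f : R →+* R') (r : R)
    (X : Matrix (Idx n) (Idx n) R) : f.mapMatrix (r • X) = f r • f.mapMatrix X := by
  ext v w
  simp

theorem mapMatrix_gammaProd {R' : Type*} [CommRing R'] (f : R →+* R') (N : ℕ) (x : R) :
    f.mapMatrix (gammaProd (nilGen R n) N x) = gammaProd (nilGen R' n) N (f x) := by
  have h : f.mapMatrix ∘ nilGen R n = nilGen R' n := funext fun i => map_nilGen f i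
  rw [← h]
  exact map_gammaProd (T := Matrix (Idx n) (Idx n) R) (T' := Matrix (Idx n) (Idx n) R')
    (u := nilGen R n) f.mapMatrix f (mapMatrix_smul f) x N

theorem mapMatrix_stairProd {R' : Type*} [CommRing R'] (f : R →+* R') (z : ℕ → R) (q d : ℕ) :
    f.mapMatrix (stairProd (nilGen R n) z q d) = stairProd (nilGen R' n) (f ∘ z) q d := by
  have h : f.mapMatrix ∘ nilGen R n = nilGen R' n := funext fun i => map_nilGen f i
  rw [← h]
  exact map_stairProd (T := Matrix (Idx n) (Idx n) R) (T' := Matrix (Idx n) (Idx n) R')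
    (u := nilGen R n) f.mapMatrix f (mapMatrix_smul f) z q d

/-- Enlarging the size by two changes nothing and covers `n = 0` and `n = 1` as well. -/
theorem gammaProd_nilGen_commute (x y : R) :
    Commute (gammaProd (nilGen R n) n x) (gammaProd (nilGen R n) n y) := by
  have h := gammaProd_commute (isNilCoxeter_nilGen (R := R) (n := n)) n x y
  rwa [gammaProd_add x (fun j hj => nilGen_eq_zero hj) 2,
    gammaProd_add y (fun j hj => nilGen_eq_zero hj) 2] at h

open Classical in
/-- The coefficient at `w` of an element of the nilCoxeter algebra. -/
noncomputable def nilCoeff (X : Matrix (Idx n) (Idx n) R) (w : BCInf) : R :=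
  if h : w ∈ BC n then X (idxOne n) ⟨w, h⟩ else 0

theorem nilCoeff_of_mem (X : Matrix (Idx n) (Idx n) R) {w : BCInf} (h : w ∈ BC n) :
    nilCoeff X w = X (idxOne n) ⟨w, h⟩ := dif_pos h

theorem nilCoeff_add (X Y : Matrix (Idx n) (Idx n) R) (w : BCInf) :
    nilCoeff (X + Y) w = nilCoeff X w + nilCoeff Y w := by
  unfold nilCoeff; split_ifs <;> simp

theorem nilCoeff_smul (r : R) (X : Matrix (Idx n) (Idx n) R) (w : BCInf) :
    nilCoeff (r • X) w = r * nilCoeff X w := by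
  unfold nilCoeff; split_ifs <;> simp

theorem nilCoeff_map {R' : Type*} [CommRing R'] (f : R →+* R') (X : Matrix (Idx n) (Idx n) R)
    (w : BCInf) : nilCoeff (f.mapMatrix X) w = f (nilCoeff X w) := by
  unfold nilCoeff; split_ifs <;> simp

open Classical in
theorem nilCoeff_one {w : BCInf} :
    nilCoeff (1 : Matrix (Idx n) (Idx n) R) w = if w = 1 then 1 else 0 := by
  by_cases h : w ∈ BC n
  · rw [nilCoeff_of_mem _ h, Matrix.one_apply]
    refine if_congr ?_ rfl rfl
    rw [Subtype.ext_iff]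
    exact eq_comm
  · rw [nilCoeff, dif_neg h, if_neg]
    rintro rfl
    exact h (one_mem_BC n)

open Classical in
-- Column `w` of `nilGen R n i` has at most one nonzero entry, in row `w * s i` when this is
-- shorter: the shape of the divided difference recurrence.
theorem nilCoeff_mul_nilGen (X : Matrix (Idx n) (Idx n) R) {w : BCInf} (hw : w ∈ BC n) (i : ℕ) :
    nilCoeff (X * nilGen R n i) w =
      if length (w * s i) < length w then nilCoeff X (w * s i) else 0 := by
  rw [nilCoeff_of_mem _ hw, Matrix.mul_apply]
  simp only [nilGen_apply, mul_ite, mul_one, mul_zero]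
  split_ifs with h
  · have hm := mul_s_mem_BC hw h
    rw [nilCoeff_of_mem _ hm, Finset.sum_eq_single ⟨w * s i, hm⟩]
    · rw [if_pos]
      refine ⟨(mul_s_mul_s w i).symm, ?_⟩
      have := length_le_mul_s w i
      simp only
      omega
    · intro t _ ht
      rw [if_neg]
      rintro ⟨h1, -⟩
      exact ht (Subtype.ext ((mul_s_mul_s t.1 i).symm.trans (congrArg (· * s i) h1.symm)))
    · simp
  · refine Finset.sum_eq_zero fun t _ => if_neg ?_
    rintro ⟨h1, h2⟩
    apply h
    have h3 : w * s i = t.1 := by rw [h1, mul_s_mul_s]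
    rw [h3]
    exact h2 ▸ Nat.lt_succ_self _

open Classical in
theorem nilCoeff_mul_hFac (X : Matrix (Idx n) (Idx n) R) {w : BCInf} (hw : w ∈ BC n) (i : ℕ)
    (x : R) : nilCoeff (X * hFac (nilGen R n) i x) w = nilCoeff X w +
      x * if length (w * s i) < length w then nilCoeff X (w * s i) else 0 := by
  rw [hFac, mul_add, mul_one, mul_smul_comm, nilCoeff_add, nilCoeff_smul,
    nilCoeff_mul_nilGen X hw]

end

/-! ### Matrices graded by length. -/

section

variable {R : Type*} [CommRing R] [Algebra ℚ R] {n : ℕ}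

/-- The matrices whose entry at `(v, w)` is homogeneous of degree `ℓ(w) - ℓ(v)`. -/
noncomputable def gradedMat (𝒜 : ℕ → Submodule ℚ R) [SetLike.GradedMonoid 𝒜] (n : ℕ) :
    Subalgebra ℚ (Matrix (Idx n) (Idx n) R) where
  carrier := {X | ∀ v w, (∀ d, length w.1 = length v.1 + d → X v w ∈ 𝒜 d) ∧
    (length w.1 < length v.1 → X v w = 0)}
  mul_mem' := by
    intro X Y hX hY v w
    simp only [Matrix.mul_apply]
    constructor
    · intro d hd
      refine Submodule.sum_mem _ fun t _ => ?_
      rcases lt_or_ge (length t.1) (length v.1) with h | h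
      · rw [(hX v t).2 h, zero_mul]; exact Submodule.zero_mem _
      rcases lt_or_ge (length w.1) (length t.1) with h' | h'
      · rw [(hY t w).2 h', mul_zero]; exact Submodule.zero_mem _
      have := SetLike.GradedMul.mul_mem ((hX v t).1 (length t.1 - length v.1) (by omega))
        ((hY t w).1 (length w.1 - length t.1) (by omega))
      convert this using 2
      omega
    · intro h
      refine Finset.sum_eq_zero fun t _ => ?_
      rcases lt_or_ge (length t.1) (length v.1) with h' | h'
      · rw [(hX v t).2 h', zero_mul]
      · rw [(hY t w).2 (by omega), mul_zero]
  add_mem' := by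
    intro X Y hX hY v w
    refine ⟨fun d hd => Submodule.add_mem _ ((hX v w).1 d hd) ((hY v w).1 d hd), fun h => ?_⟩
    rw [Matrix.add_apply, (hX v w).2 h, (hY v w).2 h, add_zero]
  algebraMap_mem' := by
    intro q v w
    rw [Algebra.algebraMap_eq_smul_one, Matrix.smul_apply, Matrix.one_apply]
    constructor
    · intro d hd
      refine Submodule.smul_mem _ _ ?_
      split_ifs with h
      · subst h
        obtain rfl : d = 0 := by omega
        exact SetLike.GradedOne.one_mem
      · exact Submodule.zero_mem _
    · intro h
      rw [if_neg, smul_zero]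
      rintro rfl
      omega

variable {𝒜 : ℕ → Submodule ℚ R} [SetLike.GradedMonoid 𝒜]

theorem mem_gradedMat {X : Matrix (Idx n) (Idx n) R} : X ∈ gradedMat 𝒜 n ↔
    ∀ v w, (∀ d, length w.1 = length v.1 + d → X v w ∈ 𝒜 d) ∧
    (length w.1 < length v.1 → X v w = 0) := Iff.rfl

theorem smul_mem_gradedMat {d : ℕ} {x : R} (hx : x ∈ 𝒜 d) {X : Matrix (Idx n) (Idx n) ℚ}
    (hX : ∀ v w, length w.1 ≠ length v.1 + d → X v w = 0) :
    x • (algebraMap ℚ R).mapMatrix X ∈ gradedMat 𝒜 n := by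
  intro v w
  simp only [Matrix.smul_apply, RingHom.mapMatrix_apply, Matrix.map_apply, smul_eq_mul]
  constructor
  · intro e he
    by_cases h : e = d
    · subst h
      rw [mul_comm, ← Algebra.smul_def]
      exact Submodule.smul_mem _ _ hx
    · rw [hX v w (by omega), map_zero, mul_zero]; exact Submodule.zero_mem _
  · intro h
    rw [hX v w (by omega), map_zero, mul_zero]

theorem hFac_mem_gradedMat {x : R} (hx : x ∈ 𝒜 1) (i : ℕ) :
    hFac (nilGen R n) i x ∈ gradedMat 𝒜 n := by
  refine Subalgebra.add_mem _ (Subalgebra.one_mem _) ?_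
  rw [← map_nilGen (algebraMap ℚ R)]
  refine smul_mem_gradedMat hx fun v w h => ?_
  rw [nilGen_apply, if_neg]
  exact fun h' => h h'.2

theorem descProd_mem_gradedMat {x : R} (hx : x ∈ 𝒜 1) (i d : ℕ) :
    descProd (nilGen R n) x i d ∈ gradedMat 𝒜 n := by
  induction d generalizing i with
  | zero => exact Subalgebra.one_mem _
  | succ d ih => exact Subalgebra.mul_mem _ (ih _) (hFac_mem_gradedMat hx i)

theorem ascProd_mem_gradedMat {x : R} (hx : x ∈ 𝒜 1) (i d : ℕ) :
    ascProd (nilGen R n) x i d ∈ gradedMat 𝒜 n := by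
  induction d generalizing i with
  | zero => exact Subalgebra.one_mem _
  | succ d ih => exact Subalgebra.mul_mem _ (hFac_mem_gradedMat hx i) (ih _)

theorem gammaProd_mem_gradedMat {x : R} (hx : x ∈ 𝒜 1) (N : ℕ) :
    gammaProd (nilGen R n) N x ∈ gradedMat 𝒜 n :=
  Subalgebra.mul_mem _ (descProd_mem_gradedMat hx 0 N) (ascProd_mem_gradedMat hx 0 N)

theorem stairProd_mem_gradedMat {z : ℕ → R} (hz : ∀ j, z j ∈ 𝒜 1) (q d : ℕ) :
    stairProd (nilGen R n) z q d ∈ gradedMat 𝒜 n := by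
  induction d generalizing q with
  | zero => exact Subalgebra.one_mem _
  | succ d ih => exact Subalgebra.mul_mem _ (descProd_mem_gradedMat (hz q) _ _) (ih _)

end

end TypeC

namespace TypeC

/-! ### The logarithm of the generating function of a `Γ`-block -/

/-- The largest length of an element of `BC n`. -/
noncomputable def maxLength (n : ℕ) : ℕ := Finset.univ.sup fun w : Idx n => length w.1

theorem length_le_maxLength {n : ℕ} (w : Idx n) : length w.1 ≤ maxLength n :=
  Finset.le_sup (f := fun w : Idx n => length w.1) (Finset.mem_univ w)

/-- The homogeneous elements of degree `d` of the nilCoxeter algebra, as matrices. -/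
def IsNilHomogeneous {n : ℕ} (d : ℕ) (X : Matrix (Idx n) (Idx n) ℚ) : Prop :=
  ∀ v w, length w.1 ≠ length v.1 + d → X v w = 0

namespace IsNilHomogeneous

variable {n : ℕ}

theorem one : IsNilHomogeneous 0 (1 : Matrix (Idx n) (Idx n) ℚ) := fun v w h => by
  rw [Matrix.one_apply, if_neg]
  rintro rfl
  exact h rfl

theorem mul {d e : ℕ} {X Y : Matrix (Idx n) (Idx n) ℚ} (hX : IsNilHomogeneous d X)
    (hY : IsNilHomogeneous e Y) : IsNilHomogeneous (d + e) (X * Y) := fun v w h => by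
  rw [Matrix.mul_apply]
  refine Finset.sum_eq_zero fun t _ => ?_
  by_cases h1 : length t.1 = length v.1 + d
  · rw [hY t w (by omega), mul_zero]
  · rw [hX v t h1, zero_mul]

theorem smul {d : ℕ} {X : Matrix (Idx n) (Idx n) ℚ} (q : ℚ) (hX : IsNilHomogeneous d X) :
    IsNilHomogeneous d (q • X) := fun v w h => by
  rw [Matrix.smul_apply, hX v w h, smul_zero]

theorem sum {ι : Type*} {d : ℕ} {X : ι → Matrix (Idx n) (Idx n) ℚ} {S : Finset ι}
    (hX : ∀ i ∈ S, IsNilHomogeneous d (X i)) : IsNilHomogeneous d (∑ i ∈ S, X i) :=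
  fun v w h => by
    rw [Matrix.sum_apply]
    exact Finset.sum_eq_zero fun i hi => hX i hi v w h

theorem pow {d : ℕ} {X : Matrix (Idx n) (Idx n) ℚ} (hX : IsNilHomogeneous d X) (k : ℕ) :
    IsNilHomogeneous (k * d) (X ^ k) := by
  induction k with
  | zero => rw [zero_mul, pow_zero]; exact one
  | succ k ih => rw [pow_succ, add_mul, one_mul]; exact ih.mul hX

theorem eq_zero {d : ℕ} {X : Matrix (Idx n) (Idx n) ℚ} (hX : IsNilHomogeneous d X)
    (hd : maxLength n < d) : X = 0 := by
  ext v w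
  refine hX v w ?_
  have := length_le_maxLength w
  omega

theorem isNilpotent {d : ℕ} {X : Matrix (Idx n) (Idx n) ℚ} (hX : IsNilHomogeneous d X)
    (hd : 1 ≤ d) : IsNilpotent X :=
  ⟨maxLength n + 1, (hX.pow _).eq_zero (by nlinarith)⟩

end IsNilHomogeneous

/-! ### Coefficients of a Γ-block in one variable. -/

section

open Polynomial

/-- The homogeneous polynomials in one variable. -/
noncomputable def monomialGrading (d : ℕ) : Submodule ℚ ℚ[X] :=
  LinearMap.range (Polynomial.monomial (R := ℚ) d)

instance : SetLike.GradedMonoid monomialGrading where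
  one_mem := ⟨1, rfl⟩
  mul_mem := by
    rintro i j _ _ ⟨a, rfl⟩ ⟨b, rfl⟩
    exact ⟨a * b, (Polynomial.monomial_mul_monomial i j a b).symm⟩

variable {n : ℕ}

/-- The coefficient of `x ^ k` in the generating function of a `Γ`-block. -/
noncomputable def gammaCoeff (n k : ℕ) : Matrix (Idx n) (Idx n) ℚ :=
  (gammaProd (nilGen ℚ[X] n) n (X : ℚ[X])).map fun p => p.coeff k

theorem gammaCoeff_apply (k : ℕ) (v w : Idx n) :
    gammaCoeff n k v w = (gammaProd (nilGen ℚ[X] n) n (X : ℚ[X]) v w).coeff k := rfl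

theorem isNilHomogeneous_gammaCoeff (k : ℕ) : IsNilHomogeneous k (gammaCoeff n k) := by
  intro v w h
  have hX : (X : ℚ[X]) ∈ monomialGrading 1 := ⟨1, rfl⟩
  have hm := mem_gradedMat.1 (gammaProd_mem_gradedMat (n := n) hX n) v w
  rw [gammaCoeff_apply]
  rcases lt_or_ge (length w.1) (length v.1) with h1 | h1
  · rw [hm.2 h1, coeff_zero]
  · obtain ⟨a, ha⟩ := hm.1 (length w.1 - length v.1) (by omega)
    rw [← ha, coeff_monomial, if_neg (by omega)]

/-- A polynomial over ℚ is determined by its values, so commuting with all specialisations means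
commuting over ℚ[X], hence with every coefficient. -/
theorem coeff_commute {K : Matrix (Idx n) (Idx n) ℚ} {G : Matrix (Idx n) (Idx n) ℚ[X]}
    (h : ∀ y : ℚ, Commute K (G.map fun p => p.eval y)) (k : ℕ) :
    Commute K (G.map fun p => p.coeff k) := by
  have key : K.map C * G = G * K.map C := by
    ext1 v w
    refine Polynomial.funext fun y => ?_
    have := congrFun (congrFun (h y).eq v) w
    simpa [Matrix.mul_apply, eval_finsetSum] using this
  have := congrArg (fun Y : Matrix (Idx n) (Idx n) ℚ[X] => Y.map fun p => p.coeff k) key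
  ext v w
  have := congrFun (congrFun this v) w
  simpa [Matrix.mul_apply, finsetSum_coeff] using this

theorem gammaProd_eval (y : ℚ) : (gammaProd (nilGen ℚ[X] n) n (X : ℚ[X])).map
    (fun p => p.eval y) = gammaProd (nilGen ℚ n) n y := by
  have := mapMatrix_gammaProd (n := n) (evalRingHom y) n (X : ℚ[X])
  rw [coe_evalRingHom, eval_X] at this
  exact this

theorem gammaCoeff_commute (k l : ℕ) : Commute (gammaCoeff n k) (gammaCoeff n l) := by
  have h1 : ∀ x : ℚ, Commute (gammaProd (nilGen ℚ n) n x) (gammaCoeff n k) := fun x =>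
    coeff_commute (fun y => by rw [gammaProd_eval]; exact gammaProd_nilGen_commute x y) k
  exact coeff_commute (fun y => by rw [gammaProd_eval]; exact (h1 y).symm) l

theorem gammaProd_eq_sum {R : Type*} [CommRing R] [Algebra ℚ R] (x : R) :
    gammaProd (nilGen R n) n x =
      ∑ k ∈ Finset.range (maxLength n + 1), x ^ k • (algebraMap ℚ R).mapMatrix (gammaCoeff n k) := by
  have h := mapMatrix_gammaProd (n := n) (aeval x : ℚ[X] →ₐ[ℚ] R).toRingHom n (X : ℚ[X])
  have hx : (aeval x : ℚ[X] →ₐ[ℚ] R).toRingHom X = x := aeval_X x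
  rw [hx] at h
  rw [← h]
  ext v w
  rw [Matrix.sum_apply]
  simp only [RingHom.mapMatrix_apply, Matrix.map_apply, Matrix.smul_apply, smul_eq_mul,
    gammaCoeff_apply, AlgHom.toRingHom_eq_coe, RingHom.coe_coe]
  rw [aeval_eq_sum_range' (n := maxLength n + 1)]
  · simp only [Algebra.smul_def, mul_comm]
  · rw [Nat.lt_succ_iff, natDegree_le_iff_coeff_eq_zero]
    intro N hN
    exact congrFun (congrFun ((isNilHomogeneous_gammaCoeff N).eq_zero hN) v) w

theorem gammaProd_zero {R : Type*} [CommRing R] [Algebra ℚ R] :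
    gammaProd (nilGen R n) n (0 : R) = 1 := by
  have h : ∀ d i, descProd (nilGen R n) (0 : R) i d = 1 := by
    intro d
    induction d with
    | zero => intro i; rfl
    | succ d ih => intro i; rw [descProd, ih, hFac_zero, one_mul]
  have h' : ∀ d i, ascProd (nilGen R n) (0 : R) i d = 1 := by
    intro d
    induction d with
    | zero => intro i; rfl
    | succ d ih => intro i; rw [ascProd, ih, hFac_zero, one_mul]
  rw [gammaProd, h, h', one_mul]

theorem gammaCoeff_zero : gammaCoeff n 0 = 1 := by
  rw [← gammaProd_zero (n := n), ← gammaProd_eval, gammaCoeff]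
  congr 1
  funext p
  exact coeff_zero_eq_eval_zero p

/-- This is the coefficient of X^m in Γ(X) Γ(-X) = 1, the relation that leaves only odd powers in
the logarithm. -/
theorem sum_gammaCoeff_mul (m : ℕ) : ∑ p ∈ Finset.HasAntidiagonal.antidiagonal m,
    gammaCoeff n p.1 * ((-1 : ℚ) ^ p.2 • gammaCoeff n p.2) = if m = 0 then 1 else 0 := by
  have h := gammaProd_mul_neg (isNilCoxeter_nilGen (R := ℚ[X]) (n := n)) n (X : ℚ[X])
  have h2 : gammaProd (nilGen ℚ[X] n) n (-X : ℚ[X]) =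
      (compRingHom (-X : ℚ[X])).mapMatrix (gammaProd (nilGen ℚ[X] n) n (X : ℚ[X])) := by
    rw [mapMatrix_gammaProd, coe_compRingHom_apply, X_comp]
  rw [h2] at h
  ext v w
  have h3 := congrArg (fun p : ℚ[X] => p.coeff m) (congrFun (congrFun h v) w)
  have h4 : (-X : ℚ[X]) = C (-1) * X := by simp
  simp only [Matrix.mul_apply, finsetSum_coeff, RingHom.mapMatrix_apply, Matrix.map_apply,
    coe_compRingHom_apply, coeff_mul] at h3
  rw [Matrix.sum_apply]
  simp only [Matrix.mul_apply, Matrix.smul_apply, gammaCoeff_apply, smul_eq_mul]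
  rw [Finset.sum_comm]
  have h5 : ((1 : Matrix (Idx n) (Idx n) ℚ[X]) v w).coeff m =
      (if m = 0 then (1 : Matrix (Idx n) (Idx n) ℚ) else 0) v w := by
    rw [Matrix.one_apply]
    split_ifs with h6 h7 h7 <;> simp [coeff_one, h6, h7, Matrix.one_apply]
  rw [← h5, ← h3]
  refine Finset.sum_congr rfl fun t _ => Finset.sum_congr rfl fun p _ => ?_
  rw [h4, comp_C_mul_X_coeff, mul_comm ((-1) ^ p.2)]

/-- The logarithm is formed in A[X] with A commutative, as `exp_log` demands; A stands for the
algebra generated by the commuting coefficients. Injectivity of ι pulls the identities of matrices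
back to A, and sending X to the scalar matrix x carries the exponential forward to any R. -/
theorem exists_gammaLog_of_injective {A : Type*} [CommRing A] [Algebra ℚ A]
    (ι : A →ₐ[ℚ] Matrix (Idx n) (Idx n) ℚ) (hι : Function.Injective ι) (g : ℕ → A)
    (hg : ∀ k, ι (g k) = gammaCoeff n k) : ∃ (M : ℕ) (L : ℕ → Matrix (Idx n) (Idx n) ℚ),
    (∀ i j, Commute (L i) (L j)) ∧ (∀ m, IsNilHomogeneous (2 * m + 1) (L m)) ∧
    ∀ (R : Type) [CommRing R] [Algebra ℚ R] (x : R), IsNilpotent.exp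
      (∑ m ∈ Finset.range M, x ^ (2 * m + 1) • (algebraMap ℚ R).mapMatrix (L m)) =
        gammaProd (nilGen R n) n x := by
  have hg0 : ∀ k, maxLength n < k → g k = 0 := fun k hk =>
    hι (by rw [hg, (isNilHomogeneous_gammaCoeff k).eq_zero hk, map_zero])
  let c : A[X] := ∑ k ∈ Finset.range (maxLength n + 1), C (g k) * X ^ k
  have hc : ∀ k, c.coeff k = g k := by
    intro k
    rw [finsetSum_coeff]
    simp only [coeff_C_mul, coeff_X_pow, mul_ite, mul_one, mul_zero, Finset.sum_ite_eq,
      Finset.mem_range]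
    split_ifs with h
    · rfl
    · exact (hg0 k (by omega)).symm
  have hc0 : c.coeff 0 = 1 := by
    rw [hc]
    exact hι (by rw [hg, gammaCoeff_zero, map_one])
  have hneg : (-X : A[X]) = C (-1) * X := by rw [C_neg, C_1, neg_one_mul]
  have hpow : ∀ k, ((-1 : A) ^ k) = algebraMap ℚ A ((-1) ^ k) := fun k => by simp
  have hcn : ∀ k, (c.comp (-X)).coeff k = ((-1 : ℚ) ^ k) • g k := by
    intro k
    rw [hneg, comp_C_mul_X_coeff, hc, hpow, mul_comm, ← Algebra.smul_def]
  have hcc : c * c.comp (-X) = 1 := by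
    ext1 m
    rw [coeff_mul, coeff_one]
    apply hι
    have h6 : ι (if m = 0 then 1 else 0) = if m = 0 then 1 else 0 := by split_ifs <;> simp
    rw [map_sum, h6, ← sum_gammaCoeff_mul (n := n) m]
    refine Finset.sum_congr rfl fun p _ => ?_
    rw [hc, hcn, map_mul, map_smul, hg, hg]
  have hnil : ∀ k, 1 ≤ k → IsNilpotent (c.coeff k) := by
    intro k hk
    obtain ⟨N, hN⟩ := (isNilHomogeneous_gammaCoeff (n := n) k).isNilpotent hk
    exact ⟨N, hι (by rw [hc, map_pow, hg, hN, map_zero])⟩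
  have hexp := exp_log hc0 hcc hnil (M := c.natDegree) le_rfl
  have hLn := isNilpotent_logCoeff hnil
  refine ⟨c.natDegree, fun m => ι (logCoeff c m), fun i j => ?_, fun m => ?_, ?_⟩
  · exact (Commute.all (logCoeff c i) (logCoeff c j)).map ι
  -- In degree 2m the derivative contributes the coefficient of index p.1 + 1 and the other factor
  -- that of index p.2, so each product has degree 2m + 1.
  · have e : logCoeff c m = ((2 * m + 1 : ℕ) : ℚ)⁻¹ •
        ∑ p ∈ Finset.HasAntidiagonal.antidiagonal (2 * m),
          (((p.1 + 1 : ℕ) : ℚ) • g (p.1 + 1)) * (((-1 : ℚ) ^ p.2) • g p.2) := by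
      rw [logCoeff, coeff_mul]
      congr 1
      refine Finset.sum_congr rfl fun p _ => ?_
      rw [hcn, coeff_derivative, hc]
      congr 1
      rw [Algebra.smul_def, mul_comm, map_natCast]
      push_cast
      rfl
    simp only [e]
    rw [map_smul, map_sum]
    refine IsNilHomogeneous.smul _ (IsNilHomogeneous.sum fun p hp => ?_)
    have h1 := ((isNilHomogeneous_gammaCoeff (n := n) (p.1 + 1)).smul ((p.1 + 1 : ℕ) : ℚ)).mul
      ((isNilHomogeneous_gammaCoeff (n := n) p.2).smul ((-1 : ℚ) ^ p.2))
    rw [Finset.HasAntidiagonal.mem_antidiagonal] at hp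
    rw [show p.1 + 1 + p.2 = 2 * m + 1 by omega] at h1
    rwa [map_mul, map_smul, map_smul, hg, hg]
  · intro R _ _ x
    let j : A →+* Matrix (Idx n) (Idx n) R :=
      (algebraMap ℚ R).mapMatrix.comp (ι : A →+* Matrix (Idx n) (Idx n) ℚ)
    let Φ : A[X] →+* Matrix (Idx n) (Idx n) R :=
      eval₂RingHom' j (x • 1) fun a => (Commute.one_right _).smul_right x
    have hΦ : ∀ (a : A) (k : ℕ), Φ (C a * X ^ k) = x ^ k • j a := by
      intro a k
      rw [map_mul, map_pow]
      have e1 : Φ (C a) = j a := eval₂_C j _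
      have e2 : Φ X = x • 1 := eval₂_X j _
      rw [e1, e2, _root_.smul_pow, one_pow, mul_smul_comm, mul_one]
    have hP : IsNilpotent (∑ m ∈ Finset.range c.natDegree,
        C (logCoeff c m) * X ^ (2 * m + 1) : A[X]) := by
      rw [← mem_nilradical]
      exact Ideal.sum_mem _ fun m _ => Ideal.mul_mem_right _ _
        (mem_nilradical.2 ((hLn m).map C))
    have h := IsNilpotent.map_exp hP Φ
    rw [hexp, map_sum, map_sum] at h
    simp only [hΦ, j, RingHom.comp_apply, RingHom.coe_coe, hg] at h
    rw [gammaProd_eq_sum]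
    exact h.symm

open scoped IsMulCommutative in
/-- The generating function of a `Γ`-block is an exponential of odd powers, with commuting
coefficients. -/
theorem exists_gammaLog (n : ℕ) : ∃ (M : ℕ) (L : ℕ → Matrix (Idx n) (Idx n) ℚ),
    (∀ i j, Commute (L i) (L j)) ∧ (∀ m, IsNilHomogeneous (2 * m + 1) (L m)) ∧
    ∀ (R : Type) [CommRing R] [Algebra ℚ R] (x : R), IsNilpotent.exp
      (∑ m ∈ Finset.range M, x ^ (2 * m + 1) • (algebraMap ℚ R).mapMatrix (L m)) =
        gammaProd (nilGen R n) n x := by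
  let S : Set (Matrix (Idx n) (Idx n) ℚ) := Set.range (gammaCoeff n)
  have hS : ∀ a ∈ S, ∀ b ∈ S, a * b = b * a := by
    rintro _ ⟨k, rfl⟩ _ ⟨l, rfl⟩
    exact gammaCoeff_commute k l
  have := Algebra.isMulCommutative_adjoin ℚ hS
  exact exists_gammaLog_of_injective (A := Algebra.adjoin ℚ S) (Algebra.adjoin ℚ S).val
    Subtype.val_injective (fun k => ⟨gammaCoeff n k, Algebra.subset_adjoin ⟨k, rfl⟩⟩) fun _ => rfl

end

end TypeC

namespace TypeC

/-! ### Uniqueness of Schubert polynomials -/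

open MvPolynomial

/-- Translation of `p_i`, for `i ≥ m`, by the powers `t ^ (2 * i + 1)`. -/
noncomputable def shiftHom (m : ℕ) :
    MvPolynomial ℕ ℚ →ₐ[ℚ] Polynomial (MvPolynomial ℕ ℚ) :=
  aeval fun i => Polynomial.C (X i) + if m ≤ i then Polynomial.X ^ (2 * i + 1) else 0

/-- Later variables are shifted by t^{2m+3} or more, and two shifts of p_m together give at least
t^{4m+2}. So the first nontrivial term, at t^{2m+1}, is the partial derivative in p_m. -/
theorem shiftHom_taylor (m : ℕ) (g : MvPolynomial ℕ ℚ) : ∃ q, shiftHom m g =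
    Polynomial.C g + Polynomial.X ^ (2 * m + 1) * Polynomial.C (pderiv m g) +
      Polynomial.X ^ (2 * m + 2) * q := by
  induction g using MvPolynomial.induction_on with
  | C a => exact ⟨0, by simp [shiftHom, MvPolynomial.algebraMap_eq]⟩
  | add f g hf hg =>
    obtain ⟨q, hq⟩ := hf
    obtain ⟨r, hr⟩ := hg
    refine ⟨q + r, ?_⟩
    rw [map_add, hq, hr, map_add, map_add, map_add]
    ring
  | mul_X f i hf =>
    obtain ⟨q, hq⟩ := hf
    have hX : shiftHom m (X i) =
      Polynomial.C (X i) + if m ≤ i then Polynomial.X ^ (2 * i + 1) else 0 := aeval_X _ _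
    rw [map_mul, hq, hX, Derivation.leibniz, pderiv_X]
    rcases lt_trichotomy m i with h | rfl | h
    · obtain ⟨d, rfl⟩ : ∃ d, i = m + 1 + d := ⟨i - (m + 1), by omega⟩
      rw [if_pos (by omega), Pi.single_eq_of_ne (by omega)]
      simp only [smul_eq_mul, mul_zero, zero_add, map_mul]
      refine ⟨q * Polynomial.C (X (m + 1 + d)) + Polynomial.X ^ (2 * d + 1) *
        (Polynomial.C f + Polynomial.X ^ (2 * m + 1) * Polynomial.C (pderiv m f) +
          Polynomial.X ^ (2 * m + 2) * q), ?_⟩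
      ring
    · rw [if_pos le_rfl, Pi.single_eq_same]
      simp only [smul_eq_mul, map_mul, map_add, mul_one]
      refine ⟨q * Polynomial.C (X m) + Polynomial.X ^ (2 * m) *
        Polynomial.C (pderiv m f) + Polynomial.X ^ (2 * m + 1) * q, ?_⟩
      ring
    · rw [if_neg (by omega), Pi.single_eq_of_ne (by omega)]
      simp only [smul_eq_mul, mul_zero, zero_add, map_mul, add_zero]
      exact ⟨q * Polynomial.C (X i), by ring⟩

theorem mem_vars_of_pderiv_eq_zero {m : ℕ} {g : MvPolynomial ℕ ℚ} (h : pderiv m g = 0) :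
    m ∉ g.vars := by
  rw [mem_vars_iff_mem_support]
  rintro ⟨d, hd, hm⟩
  rw [Finsupp.mem_support_iff] at hm
  have h1 := congrArg (coeff (d - Finsupp.single m 1)) h
  rw [coeff_pderiv, coeff_zero] at h1
  have h2 : d - Finsupp.single m 1 + Finsupp.single m 1 = d :=
    tsub_add_cancel_of_le (Finsupp.single_le_iff.2 (Nat.one_le_iff_ne_zero.2 hm))
  rw [h2] at h1
  rw [mem_support_iff] at hd
  rcases mul_eq_zero.1 h1 with h3 | h3
  · exact hd h3
  · norm_cast at h3

/-- A polynomial in the `p_i` that is invariant under `p_i ↦ p_i + t ^ (2 * i + 1)` is constant. -/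
theorem vars_eq_empty_of_shiftHom_eq {g : MvPolynomial ℕ ℚ}
    (h : shiftHom 0 g = Polynomial.C g) : g.vars = ∅ := by
  rw [Finset.eq_empty_iff_forall_notMem]
  intro m
  induction m using Nat.strong_induction_on with
  | _ m ih =>
    -- By induction no variable below `m` occurs in `g`, so it does not matter whether these are
    -- shifted.
    have h1 : shiftHom m g = shiftHom 0 g := by
      refine hom_congr_vars (f₁ := (shiftHom m).toRingHom) (f₂ := (shiftHom 0).toRingHom) ?_ ?_ rfl
      · ext a
        simp [shiftHom]
      · intro i hi _
        have : m ≤ i := by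
          by_contra h'
          exact ih i (by omega) hi
        simp [shiftHom, this]
    obtain ⟨q, hq⟩ := shiftHom_taylor m g
    rw [h1, h] at hq
    apply mem_vars_of_pderiv_eq_zero
    have h2 := congrArg (fun p => Polynomial.coeff p (2 * m + 1)) hq
    have h3 : (Polynomial.X ^ (2 * m + 2) * q).coeff (2 * m + 1) = 0 := by
      rw [Polynomial.coeff_X_pow_mul', if_neg (by omega)]
    have h4 : (Polynomial.X ^ (2 * m + 1) * Polynomial.C (pderiv m g)).coeff (2 * m + 1) =
        pderiv m g := by
      rw [Polynomial.coeff_X_pow_mul', if_pos le_rfl, Nat.sub_self, Polynomial.coeff_C_zero]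
    simp only [Polynomial.coeff_add, h3, h4, Polynomial.coeff_C_succ, zero_add, add_zero] at h2
    exact h2.symm

theorem act_succ_eq_rename (i : ℕ) (f : SRing) :
    act (i + 1) f = rename (Sum.map (Equiv.swap i (i + 1)) id) f := by
  rw [rename_eq_aeval, act]
  congr 2
  funext v
  rcases v with j | m <;> rfl

/-- Invariance under the transpositions spreads one z variable to all later ones, while a polynomial
has only finitely many. -/
theorem inl_notMem_vars {f : SRing} (h : ∀ i, act i f = f) (j : ℕ) : Sum.inl j ∉ f.vars := by
  intro hj
  have hstep : ∀ j, Sum.inl j ∈ f.vars → Sum.inl (j + 1) ∈ f.vars := by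
    intro j hj
    have h1 := h (j + 1)
    rw [act_succ_eq_rename] at h1
    rw [← h1] at hj
    obtain ⟨v, hv, hvj⟩ := Finset.mem_image.1 (vars_rename _ _ hj)
    rcases v with i | m
    · have h2 : Equiv.swap j (j + 1) i = j := Sum.inl.inj hvj
      rw [Equiv.swap_apply_eq_iff, Equiv.swap_apply_left] at h2
      rwa [← h2]
    · exact absurd hvj (by simp)
  have hall : ∀ k, Sum.inl (j + k) ∈ f.vars := by
    intro k
    induction k with
    | zero => exact hj
    | succ k ih => exact hstep _ ih
  refine Set.infinite_of_injective_forall_mem (f := fun k : ℕ => (Sum.inl (j + k) : ℕ ⊕ ℕ))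
    (fun a b hab => ?_) (s := (f.vars : Set (ℕ ⊕ ℕ))) (fun k => hall k) f.vars.finite_toSet
  have := Sum.inl.inj hab
  omega

theorem eq_C_of_act_eq {f : SRing} (h : ∀ i, act i f = f) : ∃ a, f = C a := by
  obtain ⟨g, rfl⟩ := exists_rename_eq_of_vars_subset_range f (Sum.inr : ℕ → ℕ ⊕ ℕ)
    Sum.inr_injective (by
      rintro (j | m) hv
      · exact absurd hv (inl_notMem_vars h j)
      · exact ⟨m, rfl⟩)
  -- With z_1 renamed t and the other z set to zero, invariance under s_0 becomes invariance under
  -- p_i ↦ p_i + t^{2i+1}.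
  let φ : SRing →ₐ[ℚ] Polynomial (MvPolynomial ℕ ℚ) :=
    aeval (Sum.elim (fun j => if j = 0 then Polynomial.X else 0) fun m => Polynomial.C (X m))
  have h1 : ∀ g, φ (rename Sum.inr g) = Polynomial.C g := by
    intro g
    have : (φ.comp (rename Sum.inr)).toRingHom = Polynomial.C := by
      apply MvPolynomial.ringHom_ext
      · intro a
        simp [φ]
      · intro i
        simp [φ]
    exact congrArg (fun ψ => ψ g) this
  have h2 : ∀ g, φ (act 0 (rename Sum.inr g)) = shiftHom 0 g := by
    intro g
    have : (φ.comp (act 0)).comp (rename Sum.inr) = shiftHom 0 := by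
      apply MvPolynomial.algHom_ext
      intro i
      simp [φ, act, shiftHom, zS, pS]
    exact congrArg (fun ψ => ψ g) this
  have h3 := vars_eq_empty_of_shiftHom_eq (g := g) (by rw [← h2, h 0, h1])
  exact ⟨coeff 0 g, by conv_lhs => rw [vars_eq_empty_iff_eq_C.1 h3, rename_C]⟩

theorem denom_ne_zero (i : ℕ) : denom i ≠ 0 := by
  intro h
  cases i with
  | zero =>
    have := congrArg (aeval fun _ => (1 : ℚ)) h
    simp [denom, zS] at this
  | succ i =>
    have := congrArg (aeval (Sum.elim (fun j => if j = i then (1 : ℚ) else 0) fun _ => 0)) h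
    simp [denom, zS] at this

theorem divDiff_unique {i : ℕ} {f g : SRing} (h : denom i * g = f - act i f) :
    divDiff i f = g :=
  mul_left_cancel₀ (denom_ne_zero i) ((denom_mul_divDiff i f).trans h.symm)

theorem act_eq_of_divDiff_eq {i : ℕ} {f g : SRing} (h : divDiff i f = divDiff i g) :
    act i (f - g) = f - g := by
  have h1 := denom_mul_divDiff i f
  have h2 := denom_mul_divDiff i g
  rw [h] at h1
  rw [map_sub]
  linear_combination h1 - h2

theorem eq_C_of_homogeneous_zero {f : SRing} (h : IsWeightedHomogeneous deg f 0) :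
    f = C (coeff 0 f) := by
  ext d
  rw [coeff_C]
  split_ifs with hd
  · rw [hd]
  · by_contra hne
    have := h hne
    rw [Finsupp.weight_apply] at this
    apply hd
    ext v
    by_contra hv
    have h1 := Finset.sum_eq_zero_iff.1 this v (Finsupp.mem_support_iff.2 fun h => hv (by rw [h]; rfl))
    rcases v with j | m
    · simp [deg] at h1; exact hv (by rw [h1]; rfl)
    · simp [deg] at h1; exact hv (by rw [h1]; rfl)

open Classical in
/-- The defining properties of type `C` Schubert polynomials, for elements of `BC n` only. -/
structure IsSchubertOn (n : ℕ) (S : BCInf → SRing) : Prop where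
  homogeneous : ∀ w ∈ BC n, ∃ d : ℕ, IsWeightedHomogeneous deg (S w) d
  one : S 1 = 1
  divDiff_eq : ∀ (i : ℕ), ∀ w ∈ BC n,
    divDiff i (S w) = if length (w * s i) < length w then S (w * s i) else 0

theorem IsSchubertFamily.on {S : BCInf → SRing} (h : IsSchubertFamily S) (n : ℕ) :
    IsSchubertOn n S :=
  ⟨fun w _ => h.homogeneous w, h.one, fun i w _ => h.divDiff_eq i w⟩

theorem IsSchubertOn.mono {S : BCInf → SRing} {m n : ℕ} (h : IsSchubertOn n S) (hmn : m ≤ n) :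
    IsSchubertOn m S :=
  ⟨fun w hw => h.homogeneous w (BC_mono hmn hw), h.one,
    fun i w hw => h.divDiff_eq i w (BC_mono hmn hw)⟩

/-- At a descent the divided difference is nonzero by induction, so `S w` is not constant.
Homogeneity, of whatever degree, then forces positive degree and a zero constant term. -/
theorem IsSchubertOn.ne_zero {S : BCInf → SRing} {n : ℕ} (h : IsSchubertOn n S) (l : ℕ) :
    ∀ w ∈ BC n, length w = l → S w ≠ 0 ∧ (w ≠ 1 → coeff 0 (S w) = 0) := by
  induction l using Nat.strong_induction_on with
  | _ l ih =>
    rintro w hw rfl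
    by_cases h1 : w = 1
    · exact ⟨by rw [h1, h.one]; exact one_ne_zero, fun h2 => absurd h1 h2⟩
    obtain ⟨i, hi⟩ := exists_length_mul_s_lt h1
    have h2 := (ih _ hi _ (mul_s_mem_BC hw hi) rfl).1
    have h3 := h.divDiff_eq i w hw
    rw [if_pos hi] at h3
    have h4 : ∀ a, S w ≠ C a := by
      intro a ha
      apply h2
      rw [← h3]
      apply divDiff_unique
      rw [ha, algHom_C, mul_zero, algebraMap_eq, sub_self]
    refine ⟨fun h5 => h4 0 (by rw [h5, C_0]), fun _ => ?_⟩
    obtain ⟨d, hd⟩ := h.homogeneous w hw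
    by_contra h5
    have h6 := hd h5
    rw [map_zero] at h6
    subst h6
    exact h4 _ (eq_C_of_homogeneous_zero hd)

/-- Type `C` Schubert polynomials are uniquely determined. -/
theorem IsSchubertOn.unique {S S' : BCInf → SRing} {n : ℕ} (h : IsSchubertOn n S)
    (h' : IsSchubertOn n S') (l : ℕ) : ∀ w ∈ BC n, length w = l → S w = S' w := by
  induction l using Nat.strong_induction_on with
  | _ l ih =>
    rintro w hw rfl
    by_cases h1 : w = 1
    · rw [h1, h.one, h'.one]
    -- Both candidates have the same divided differences by induction, so their difference is
    -- invariant under all simple reflections.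
    have h2 : ∀ i, act i (S w - S' w) = S w - S' w := by
      intro i
      apply act_eq_of_divDiff_eq
      rw [h.divDiff_eq i w hw, h'.divDiff_eq i w hw]
      split_ifs with hi
      · exact ih _ hi _ (mul_s_mem_BC hw hi) rfl
      · rfl
    obtain ⟨a, ha⟩ := eq_C_of_act_eq h2
    have h3 := congrArg (coeff 0) ha
    rw [coeff_sub, (h.ne_zero _ w hw rfl).2 h1, (h'.ne_zero _ w hw rfl).2 h1, coeff_zero_C,
      sub_self] at h3
    rw [← h3, C_0] at ha
    exact sub_eq_zero.1 ha

end TypeC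

namespace TypeC

/-! ### Existence of Schubert polynomials -/

/-! ### Exponentials with free power sums. -/

section

variable {R : Type} [CommRing R] [Algebra ℚ R] {n : ℕ}

/-- The logarithms of the generating function of a `Γ`-block. -/
noncomputable def gammaLog (n : ℕ) : ℕ → Matrix (Idx n) (Idx n) ℚ :=
  (exists_gammaLog n).choose_spec.choose

/-- The number of odd powers that occur in the logarithm of a `Γ`-block. -/
noncomputable def gammaLogBound (n : ℕ) : ℕ := (exists_gammaLog n).choose

theorem gammaLog_commute (i j : ℕ) : Commute (gammaLog n i) (gammaLog n j) :=
  (exists_gammaLog n).choose_spec.choose_spec.1 i j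

theorem isNilHomogeneous_gammaLog (m : ℕ) : IsNilHomogeneous (2 * m + 1) (gammaLog n m) :=
  (exists_gammaLog n).choose_spec.choose_spec.2.1 m

/-- The linear combination of the logarithms with given coefficients. -/
noncomputable def gammaLogSum (n : ℕ) (p : ℕ → R) : Matrix (Idx n) (Idx n) R :=
  ∑ m ∈ Finset.range (gammaLogBound n), p m • (algebraMap ℚ R).mapMatrix (gammaLog n m)

/-- The exponential of `gammaLogSum`. For power sums `p m = ∑ x_j ^ (2 * m + 1)`, this is the
product of the generating functions of `Γ`-blocks with variables `x_j`. -/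
noncomputable def gammaExp (n : ℕ) (p : ℕ → R) : Matrix (Idx n) (Idx n) R :=
  IsNilpotent.exp (gammaLogSum n p)

theorem gammaExp_pow (x : R) :
    gammaExp n (fun m => x ^ (2 * m + 1)) = gammaProd (nilGen R n) n x :=
  (exists_gammaLog n).choose_spec.choose_spec.2.2 R x

theorem gammaLog_map_commute (i j : ℕ) : Commute ((algebraMap ℚ R).mapMatrix (gammaLog n i))
    ((algebraMap ℚ R).mapMatrix (gammaLog n j)) :=
  (gammaLog_commute i j).map (algebraMap ℚ R).mapMatrix

theorem gammaLogSum_commute (p q : ℕ → R) : Commute (gammaLogSum n p) (gammaLogSum n q) :=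
  Commute.sum_left _ _ _ fun i _ => Commute.sum_right _ _ _ fun j _ =>
    ((gammaLog_map_commute i j).smul_left (p i)).smul_right (q j)

theorem isNilpotent_gammaLogSum (p : ℕ → R) : IsNilpotent (gammaLogSum n p) := by
  refine Commute.isNilpotent_sum (fun m _ => ?_) fun i j _ _ =>
    ((gammaLog_map_commute i j).smul_left (p i)).smul_right (p j)
  exact (((isNilHomogeneous_gammaLog m).isNilpotent (by omega)).map
    (algebraMap ℚ R).mapMatrix).smul (p m)

theorem gammaLogSum_add (p q : ℕ → R) :
    gammaLogSum n (fun m => p m + q m) = gammaLogSum n p + gammaLogSum n q := by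
  simp only [gammaLogSum, add_smul, Finset.sum_add_distrib]

theorem gammaExp_add (p q : ℕ → R) :
    gammaExp n (fun m => p m + q m) = gammaExp n p * gammaExp n q := by
  rw [gammaExp, gammaLogSum_add, IsNilpotent.exp_add_of_commute (gammaLogSum_commute p q)
    (isNilpotent_gammaLogSum p) (isNilpotent_gammaLogSum q)]
  rfl

theorem gammaExp_zero : gammaExp n (fun _ => (0 : R)) = 1 := by
  simp [gammaExp, gammaLogSum]

theorem map_gammaExp {R' : Type} [CommRing R'] [Algebra ℚ R'] (f : R →ₐ[ℚ] R') (p : ℕ → R) :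
    (f : R →+* R').mapMatrix (gammaExp n p) = gammaExp n (fun m => f (p m)) := by
  rw [gammaExp, IsNilpotent.map_exp (isNilpotent_gammaLogSum p), gammaExp]
  congr 1
  rw [gammaLogSum, map_sum, gammaLogSum]
  refine Finset.sum_congr rfl fun m _ => ?_
  rw [mapMatrix_smul]
  congr 1
  ext v w
  simp

theorem gammaExp_mem_gradedMat {𝒜 : ℕ → Submodule ℚ R} [SetLike.GradedMonoid 𝒜] {p : ℕ → R}
    (hp : ∀ m, p m ∈ 𝒜 (2 * m + 1)) : gammaExp n p ∈ gradedMat 𝒜 n := by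
  obtain ⟨k, hk⟩ := isNilpotent_gammaLogSum (n := n) p
  rw [gammaExp, IsNilpotent.exp_eq_sum hk]
  refine Subalgebra.sum_mem _ fun i _ => Subalgebra.smul_mem _ (Subalgebra.pow_mem _ ?_ _) _
  exact Subalgebra.sum_mem _ fun m _ => smul_mem_gradedMat (hp m) (isNilHomogeneous_gammaLog m)

/-- The product of the factors of the `Γ`-blocks with variables `x (k - 1), …, x 0`. -/
noncomputable def blocksProd (n : ℕ) (x : ℕ → R) : ℕ → Matrix (Idx n) (Idx n) R
  | 0 => 1
  | k + 1 => gammaProd (nilGen R n) n (x k) * blocksProd n x k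

theorem gammaExp_powerSum (x : ℕ → R) (k : ℕ) :
    gammaExp n (fun m => ∑ j ∈ Finset.range k, x j ^ (2 * m + 1)) = blocksProd n x k := by
  induction k with
  | zero => simp only [Finset.range_zero, Finset.sum_empty, gammaExp_zero, blocksProd]
  | succ k ih =>
    simp only [Finset.sum_range_succ_comm]
    rw [gammaExp_add, ih, gammaExp_pow, blocksProd]

end

/-! ### The generating function of Schubert polynomials. -/

open MvPolynomial

/-- The generating function of the Schubert polynomials of `BC n`. -/
noncomputable def schubertGen (n : ℕ) : Matrix (Idx n) (Idx n) SRing :=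
  gammaExp n pS * stairProd (nilGen SRing n) zS 0 n

/-- The Schubert polynomials of `BC n`. -/
noncomputable def schubert (n : ℕ) (w : BCInf) : SRing := nilCoeff (schubertGen n) w

theorem schubertGen_eq (n e : ℕ) :
    schubertGen n = gammaExp n pS * stairProd (nilGen SRing n) zS 0 (n + e) := by
  rw [schubertGen, stairProd_add zS (fun j hj => nilGen_eq_zero hj) e 0 n (by omega)]

instance : SetLike.GradedMonoid (weightedHomogeneousSubmodule ℚ deg) :=
  WeightedHomogeneousSubmodule.gradedMonoid

theorem isWeightedHomogeneous_schubert (n : ℕ) {w : BCInf} (hw : w ∈ BC n) :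
    IsWeightedHomogeneous deg (schubert n w) (length w) := by
  have h : schubertGen n ∈ gradedMat (weightedHomogeneousSubmodule ℚ deg) n := by
    refine Subalgebra.mul_mem _ (gammaExp_mem_gradedMat fun m => ?_)
      (stairProd_mem_gradedMat (fun j => ?_) _ _)
    · exact isWeightedHomogeneous_X ℚ deg (Sum.inr m)
    · exact isWeightedHomogeneous_X ℚ deg (Sum.inl j)
  rw [schubert, nilCoeff_of_mem _ hw]
  exact (h (idxOne n) ⟨w, hw⟩).1 _ (by simp [idxOne])

theorem mapMatrix_schubertGen {R : Type} [CommRing R] [Algebra ℚ R] (f : SRing →ₐ[ℚ] R) (n e : ℕ) :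
    (f : SRing →+* R).mapMatrix (schubertGen n) = gammaExp n (fun m => f (pS m)) *
      stairProd (nilGen R n) (fun j => f (zS j)) 0 (n + e) := by
  rw [schubertGen_eq n e, map_mul, map_gammaExp, mapMatrix_stairProd]
  rfl

theorem stairProd_zero {R : Type*} [CommRing R] (n q d : ℕ) :
    stairProd (nilGen R n) (fun _ => (0 : R)) q d = 1 := by
  have h : ∀ d i, descProd (nilGen R n) (0 : R) i d = 1 := by
    intro d
    induction d with
    | zero => intro i; rfl
    | succ d ih => intro i; rw [descProd, ih, hFac_zero, one_mul]
  induction d generalizing q with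
  | zero => rfl
  | succ d ih => rw [stairProd, h, ih, one_mul]

/-- Degree 0 makes it a constant, and at the point where all variables vanish the generating matrix
is the identity. -/
theorem schubert_one (n : ℕ) : schubert n 1 = 1 := by
  have h := isWeightedHomogeneous_schubert n (one_mem_BC n)
  rw [length_one] at h
  have h1 := mapMatrix_schubertGen (aeval fun _ => (0 : ℚ)) n 0
  simp only [zS, pS, aeval_X] at h1
  rw [gammaExp_zero, stairProd_zero, one_mul] at h1
  have h2 := nilCoeff_map ((aeval fun _ => (0 : ℚ) : SRing →ₐ[ℚ] ℚ) : SRing →+* ℚ)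
    (schubertGen n) 1
  rw [h1, nilCoeff_one, if_pos rfl] at h2
  change 1 = (aeval fun _ => (0 : ℚ)) (schubert n 1) at h2
  rw [eq_C_of_homogeneous_zero h, algHom_C] at h2
  rw [eq_C_of_homogeneous_zero h]
  have h3 : coeff 0 (schubert n 1) = 1 := h2.symm
  rw [h3, C_1]

/-- For s_0, the shift of the power sums splits off a block Γ(z_1), which merges with the first
staircase row at -z_1; the resulting h_0(2 z_1) commutes with the other rows. For `i ≥ 1`, two
adjacent rows are exchanged and the power sums stay. -/
theorem act_schubertGen (n i : ℕ) : (act i : SRing →+* SRing).mapMatrix (schubertGen n) =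
    schubertGen n * hFac (nilGen SRing n) i (-denom i) := by
  have hu := isNilCoxeter_nilGen (R := SRing) (n := n)
  cases i with
  | zero =>
    rw [mapMatrix_schubertGen _ n 1, schubertGen_eq n 1]
    have e1 : ∀ m, act 0 (pS m) = pS m + zS 0 ^ (2 * m + 1) := fun m => aeval_X _ _
    have e2 : act 0 (zS 0) = -zS 0 := aeval_X _ _
    have e3 : ∀ j, 1 ≤ j → act 0 (zS j) = zS j := fun j hj =>
      (aeval_X _ _).trans (if_neg (by omega))
    simp only [e1]
    have hz : ∀ j, n ≤ j → nilGen SRing n j = 0 := fun j hj => nilGen_eq_zero hj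
    -- The block is enlarged to size `n + 2` to match the first row, which has `n + 1` factors in
    -- the staircase with one extra row.
    rw [gammaExp_add, gammaExp_pow, ← gammaProd_add _ hz 2, stairProd, stairProd, e2,
      stairProd_congr n e3, mul_assoc, ← mul_assoc (gammaProd _ _ _),
      gammaProd_mul_descProd_neg hu]
    have e4 : -denom 0 = 2 * zS 0 := by simp [denom]
    rw [e4, mul_assoc _ _ (hFac _ _ _), mul_assoc _ _ (hFac _ _ _), mul_assoc _ (hFac _ _ _) _,
      (hFac_commute_stairProd hu _ zS n le_rfl).eq]
  | succ i =>
    -- With `n + i + 1` rows the staircase contains row `i` for every `i`, even beyond `n`.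
    rw [mapMatrix_schubertGen _ n (i + 1), schubertGen_eq n (i + 1)]
    have e1 : ∀ m, act (i + 1) (pS m) = pS m := fun m => aeval_X _ _
    have e2 : ∀ j, act (i + 1) (zS j) = zS (Equiv.swap i (i + 1) j) := fun j => aeval_X _ _
    simp only [e1, e2]
    rw [stairProd_swap hu (z := zS) (i := i) (Nat.zero_le _) (by omega) (by simp) (by simp)
      (fun j h1 h2 => by rw [Equiv.swap_apply_of_ne_of_ne h1 h2]), mul_assoc]
    congr 3
    simp [denom]

theorem isSchubertOn_schubert (n : ℕ) : IsSchubertOn n (schubert n) where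
  homogeneous w hw := ⟨_, isWeightedHomogeneous_schubert n hw⟩
  one := schubert_one n
  divDiff_eq i w hw := by
    apply divDiff_unique
    have h := nilCoeff_map (act i : SRing →+* SRing) (schubertGen n) w
    rw [act_schubertGen, nilCoeff_mul_hFac _ hw] at h
    change schubert n w + -denom i * _ = act i (schubert n w) at h
    rw [← h]
    change denom i * (if length (w * s i) < length w then nilCoeff (schubertGen n) (w * s i) else 0)
      = _
    ring

/-- The size is chosen separately for each `w`. Uniqueness on the smaller of two hyperoctahedral
groups shows that the choice is irrelevant. -/
theorem isSchubertFamily_schubert :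
    IsSchubertFamily fun w => schubert (exists_mem_BC w).choose w := by
  have key : ∀ n w, w ∈ BC n → schubert (exists_mem_BC w).choose w = schubert n w := by
    intro n w hw
    have hw' := (exists_mem_BC w).choose_spec
    rcases le_total n (exists_mem_BC w).choose with h | h
    · exact ((isSchubertOn_schubert _).mono h).unique (isSchubertOn_schubert n) _ w hw rfl
    · exact (isSchubertOn_schubert _).unique ((isSchubertOn_schubert n).mono h) _ w hw' rfl
  refine ⟨fun w => ⟨_, isWeightedHomogeneous_schubert _ (exists_mem_BC w).choose_spec⟩, ?_, ?_⟩
  · exact (key 0 1 (one_mem_BC 0)).trans (schubert_one 0)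
  · intro i w
    have hw := (exists_mem_BC w).choose_spec
    rw [(isSchubertOn_schubert _).divDiff_eq i w hw]
    split_ifs with h
    · exact (key _ _ (mul_s_mem_BC hw h)).symm
    · rfl

theorem existsUnique_isSchubertFamily : ∃! S : BCInf → SRing, IsSchubertFamily S := by
  refine ⟨_, isSchubertFamily_schubert, fun S hS => funext fun w => ?_⟩
  have hw := (exists_mem_BC w).choose_spec
  exact (hS.on _).unique (isSchubertFamily_schubert.on _) _ w hw rfl

theorem trunc_eq_nilCoeff {S : BCInf → SRing} (hS : IsSchubertFamily S) {n : ℕ} {w : BCInf}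
    (hw : w ∈ BC n) (k e : ℕ) : trunc k (S w) =
      nilCoeff (blocksProd n xP k * stairProd (nilGen PRing n) zP 0 (n + e)) w := by
  rw [(hS.on n).unique (isSchubertOn_schubert n) _ w hw rfl, schubert]
  have h := nilCoeff_map (trunc k : SRing →+* PRing) (schubertGen n) w
  rw [mapMatrix_schubertGen _ n e] at h
  have e1 : ∀ m, trunc k (pS m) = ∑ j ∈ Finset.range k, xP j ^ (2 * m + 1) := fun m => aeval_X _ _
  have e2 : ∀ j, trunc k (zS j) = zP j := fun j => aeval_X _ _
  simp only [e1, e2] at h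
  rw [gammaExp_powerSum] at h
  exact h.symm

end TypeC

namespace TypeC

/-! ### Sums over subwords -/

section

variable {R : Type*} [CommRing R]

/-- The sum, over the sublists of a list of letters with weights that have a given word, of the
product of the weights. -/
def subwordSum : List (ℕ × R) → List ℕ → R
  | [], [] => 1
  | [], _ :: _ => 0
  | _ :: l, [] => subwordSum l []
  | p :: l, j :: c => subwordSum l (j :: c) + if p.1 = j then p.2 * subwordSum l c else 0

@[simp] theorem subwordSum_nil_right (l : List (ℕ × R)) : subwordSum l [] = 1 := by
  induction l with
  | nil => rfl
  | cons p l ih => rw [subwordSum, ih]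

theorem subwordSum_nil_left (c : List ℕ) :
    subwordSum ([] : List (ℕ × R)) c = if c = [] then 1 else 0 := by
  cases c <;> rfl

/-- The letters taken from the first list spell a prefix of the word; the sum is over its length. -/
theorem subwordSum_append (l₁ l₂ : List (ℕ × R)) (c : List ℕ) : subwordSum (l₁ ++ l₂) c =
    ∑ p ∈ Finset.range (c.length + 1),
      subwordSum l₁ (c.take p) * subwordSum l₂ (c.drop p) := by
  induction l₁ generalizing c with
  | nil =>
    rw [Finset.sum_eq_single 0]
    · simp
    · intro p hp hp0
      rw [subwordSum_nil_left, if_neg, zero_mul]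
      rw [List.take_eq_nil_iff]
      rintro (h | rfl)
      · exact hp0 h
      · simp at hp; exact hp0 hp
    · simp
  | cons q l ih =>
    cases c with
    | nil => simp
    | cons j c =>
      rw [List.cons_append, subwordSum, ih, ih, List.length_cons, Finset.sum_range_succ',
        Finset.sum_range_succ' _ (c.length + 1)]
      simp only [List.take_succ_cons, List.drop_succ_cons, subwordSum, List.take_zero,
        List.drop_zero, subwordSum_nil_right, add_mul, Finset.sum_add_distrib]
      split_ifs
      · rw [Finset.mul_sum]
        simp only [mul_assoc]
        ring
      · simp

/-- The defining recursion read from the other end, as required by right multiplication in the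
nilCoxeter algebra. -/
theorem subwordSum_concat (l : List (ℕ × R)) (q : ℕ × R) (c : List ℕ) (j : ℕ) :
    subwordSum (l ++ [q]) (c ++ [j]) =
      subwordSum l (c ++ [j]) + if q.1 = j then q.2 * subwordSum l c else 0 := by
  induction l generalizing c with
  | nil =>
    cases c with
    | nil => simp [subwordSum]
    | cons a c =>
      cases c <;> simp [subwordSum]
  | cons p l ih =>
    cases c with
    | nil =>
      have := ih []
      simp only [List.nil_append] at this
      simp only [List.cons_append, List.nil_append, subwordSum, this, subwordSum_nil_right]
      ring
    | cons a c =>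
      have h1 := ih (a :: c)
      simp only [List.cons_append] at h1
      simp only [List.cons_append, subwordSum, h1, ih]
      split_ifs <;> ring

theorem subwordSum_map_of_nodup {l : List ℕ} (hl : l.Nodup) (x : R) (c : List ℕ) :
    subwordSum (l.map fun i => (i, x)) c = if c.Sublist l then x ^ c.length else 0 := by
  induction l generalizing c with
  | nil => rw [List.map_nil, subwordSum_nil_left]; cases c <;> simp
  | cons i l ih =>
    cases c with
    | nil => simp
    | cons j c =>
      rw [List.nodup_cons] at hl
      rw [List.map_cons, subwordSum, ih hl.2, ih hl.2]
      by_cases hij : i = j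
      · subst hij
        rw [if_neg fun h => hl.1 (h.subset List.mem_cons_self), zero_add, if_pos rfl,
          List.length_cons, pow_succ']
        simp only [List.cons_sublist_cons]
        split_ifs <;> simp
      · rw [if_neg hij, add_zero]
        refine if_congr ?_ rfl rfl
        rw [List.sublist_cons_iff]
        constructor
        · exact Or.inl
        · rintro (h | ⟨r, hr, -⟩)
          · exact h
          · exact absurd (List.cons.inj hr).1.symm hij

theorem sublist_range'_iff {a d : ℕ} {c : List ℕ} :
    c.Sublist (List.range' a d) ↔ c.IsChain (· < ·) ∧ ∀ x ∈ c, a ≤ x ∧ x < a + d := by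
  have hr : (List.range' a d).Pairwise (· < ·) := List.pairwise_lt_range' 1
  constructor
  · intro h
    refine ⟨(hr.sublist h).isChain, fun x hx => ?_⟩
    simpa using h.subset hx
  · rintro ⟨h1, h2⟩
    rw [List.isChain_iff_pairwise] at h1
    refine List.sublist_of_subperm_of_sortedLE ?_ (h1.imp le_of_lt).sortedLE
      (hr.imp le_of_lt).sortedLE
    refine List.subperm_of_subset (h1.imp ne_of_lt) fun x hx => ?_
    simpa using h2 x hx

theorem sublist_reverse_range'_iff {a d : ℕ} {c : List ℕ} :
    c.Sublist (List.range' a d).reverse ↔ c.IsChain (· > ·) ∧ ∀ x ∈ c, a ≤ x ∧ x < a + d := by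
  rw [← List.reverse_sublist, List.reverse_reverse, sublist_range'_iff, List.isChain_reverse]
  simp only [List.mem_reverse, gt_iff_lt]

/-! ### Words of a `Γ`-block -/

/-- A word has no peaks. -/
def NoPeak : List ℕ → Prop
  | i :: j :: k :: t => ¬(i < j ∧ k < j) ∧ NoPeak (j :: k :: t)
  | _ => True

/-- Once a peakless word with distinct neighbours goes up, it can never come down again. -/
theorem noPeak_cons_of_lt {i j : ℕ} {t : List ℕ} (h : i < j) (hc : (j :: t).IsChain (· ≠ ·)) :
    NoPeak (i :: j :: t) ↔ (j :: t).IsChain (· < ·) := by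
  induction t generalizing i j with
  | nil => simp [NoPeak]
  | cons k t ih =>
    rw [List.isChain_cons_cons] at hc
    rw [NoPeak, List.isChain_cons_cons]
    constructor
    · rintro ⟨h1, h2⟩
      have h3 : j < k := by have := hc.1; omega
      exact ⟨h3, (ih h3 hc.2).1 h2⟩
    · rintro ⟨h1, h2⟩
      exact ⟨by omega, (ih h1 hc.2).2 h2⟩

theorem noPeak_cons_of_gt {i j : ℕ} {t : List ℕ} (h : j < i) :
    NoPeak (i :: j :: t) ↔ NoPeak (j :: t) := by
  cases t with
  | nil => simp [NoPeak]
  | cons k t => simp [NoPeak, h.not_gt]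

open Classical in
-- A nonempty peakless word with distinct neighbours falls to a single lowest letter and then rises.
-- That letter may end the falling half or begin the rising one, which gives two cuts and is the
-- source of 2^{i(α)}.
theorem card_valley_splits {c : List ℕ} (hc : c.IsChain (· ≠ ·)) :
    (∑ p ∈ Finset.range (c.length + 1),
      if (c.take p).IsChain (· > ·) ∧ (c.drop p).IsChain (· < ·) then (1 : R) else 0) =
      if c = [] then 1 else if NoPeak c then 2 else 0 := by
  induction c with
  | nil => simp
  | cons i c ih =>
    cases c with
    | nil =>
      rw [List.length_singleton, Finset.sum_range_succ, Finset.sum_range_one]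
      simp only [List.take_zero, List.take_succ_cons, List.drop_zero, List.drop_succ_cons,
        List.isChain_nil, List.isChain_singleton, and_self, if_true,
        List.cons_ne_nil, if_false]
      rw [if_pos (show NoPeak [i] from trivial)]
      norm_num
    | cons j t =>
      have hne := (List.isChain_cons_cons.1 hc).1
      have hc' := (List.isChain_cons_cons.1 hc).2
      rw [List.length_cons, Finset.sum_range_succ', if_neg (List.cons_ne_nil _ _)]
      simp only [List.take_succ_cons, List.drop_succ_cons, List.take_zero, List.drop_zero]
      rcases lt_or_gt_of_ne hne with h | h
      · rw [List.length_cons, Finset.sum_range_succ']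
        simp only [List.take_succ_cons, List.drop_succ_cons, List.take_zero, List.drop_zero]
        rw [Finset.sum_eq_zero]
        · simp only [noPeak_cons_of_lt h hc', List.isChain_cons_cons, h, true_and,
            List.isChain_singleton, List.isChain_nil]
          split_ifs <;> norm_num
        · intro p _
          rw [if_neg]
          rintro ⟨h1, -⟩
          rw [List.isChain_cons_cons] at h1
          exact absurd h1.1 (by simp only [gt_iff_lt]; omega)
      · have h0 : ¬(([] : List ℕ).IsChain (· > ·) ∧ (i :: j :: t).IsChain (· < ·)) := by
          rintro ⟨-, h1⟩
          exact absurd (List.isChain_cons_cons.1 h1).1 h.not_gt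
        rw [if_neg h0, add_zero, noPeak_cons_of_gt h]
        have := ih hc'
        rw [if_neg (List.cons_ne_nil _ _)] at this
        rw [← this]
        refine Finset.sum_congr rfl fun p _ => if_congr ?_ rfl rfl
        cases p with
        | zero => simp
        | succ p =>
          rw [List.take_succ_cons, List.isChain_cons_cons]
          simp only [gt_iff_lt, h, true_and]

/-- The letters of a `Γ`-block in reading order, with weights `x`. -/
def gammaList (n : ℕ) (x : R) : List (ℕ × R) :=
  ((List.range' 0 n).reverse.map fun i => (i, x)) ++ (List.range' 0 n).map fun i => (i, x)

open Classical in
theorem subwordSum_gammaList {n : ℕ} (x : R) {c : List ℕ} (hc : c.IsChain (· ≠ ·))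
    (hn : ∀ i ∈ c, i < n) : subwordSum (gammaList n x) c =
      (if c = [] then 1 else if NoPeak c then 2 else 0) * x ^ c.length := by
  have hnd : (List.range' 0 n).Nodup := List.nodup_range'
  rw [gammaList, subwordSum_append, ← card_valley_splits hc, Finset.sum_mul]
  refine Finset.sum_congr rfl fun p hp => ?_
  rw [Finset.mem_range] at hp
  rw [subwordSum_map_of_nodup (List.nodup_reverse.2 hnd), subwordSum_map_of_nodup hnd]
  have h1 : (c.take p).Sublist (List.range' 0 n).reverse ↔ (c.take p).IsChain (· > ·) := by
    rw [sublist_reverse_range'_iff, and_iff_left]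
    intro i hi
    have := hn i (List.mem_of_mem_take hi)
    omega
  have h2 : (c.drop p).Sublist (List.range' 0 n) ↔ (c.drop p).IsChain (· < ·) := by
    rw [sublist_range'_iff, and_iff_left]
    intro i hi
    have := hn i (List.mem_of_mem_drop hi)
    omega
  simp only [h1, h2]
  by_cases h3 : (c.take p).IsChain (· > ·) <;> by_cases h4 : (c.drop p).IsChain (· < ·) <;>
    simp only [h3, h4, if_true, if_false, and_self, and_true, and_false, zero_mul, mul_zero,
      one_mul]
  rw [← pow_add, List.length_take, List.length_drop]
  congr 1
  omega

/-- The letters of a sequence of `Γ`-blocks with weights `x (k - 1), …, x 0`. -/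
def blocksList (n : ℕ) (x : ℕ → R) : ℕ → List (ℕ × R)
  | 0 => []
  | k + 1 => gammaList n (x k) ++ blocksList n x k

/-- The letters of the rows `q, …, q + d - 1` of a staircase, of lengths `d - 1, …, 0`. -/
def stairList (z : ℕ → R) : ℕ → ℕ → List (ℕ × R)
  | _, 0 => []
  | q, d + 1 => ((List.range' (q + 1) d).reverse.map fun i => (i, z q)) ++ stairList z (q + 1) d

end

/-! ### From products of factors to sums over subwords. -/

section

variable {R : Type} [CommRing R] {n : ℕ}

/-- The product of the factors of a list of letters with weights. -/
noncomputable def listProd (n : ℕ) (l : List (ℕ × R)) : Matrix (Idx n) (Idx n) R :=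
  (l.map fun p => hFac (nilGen R n) p.1 p.2).prod

theorem listProd_append (l₁ l₂ : List (ℕ × R)) :
    listProd n (l₁ ++ l₂) = listProd n l₁ * listProd n l₂ := by
  simp [listProd]

theorem listProd_desc (x : R) (i d : ℕ) :
    listProd n ((List.range' i d).reverse.map fun i => (i, x)) = descProd (nilGen R n) x i d := by
  induction d generalizing i with
  | zero => rfl
  | succ d ih =>
    rw [List.range'_succ, List.reverse_cons, List.map_append, listProd_append, ih, descProd]
    simp [listProd]

theorem listProd_asc (x : R) (i d : ℕ) :
    listProd n ((List.range' i d).map fun i => (i, x)) = ascProd (nilGen R n) x i d := by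
  induction d generalizing i with
  | zero => rfl
  | succ d ih =>
    rw [List.range'_succ, List.map_cons, ← List.singleton_append, listProd_append, ih, ascProd]
    simp [listProd]

theorem listProd_blocksList (x : ℕ → R) (k : ℕ) :
    listProd n (blocksList n x k) = blocksProd n x k := by
  induction k with
  | zero => rfl
  | succ k ih =>
    rw [blocksList, listProd_append, ih, blocksProd, gammaList, listProd_append, listProd_desc,
      listProd_asc, gammaProd]

/-- The shift by one comes from the empty last row that `stairList` keeps. -/
theorem listProd_stairList (z : ℕ → R) (q d : ℕ) :
    listProd n (stairList z q (d + 1)) = stairProd (nilGen R n) z q d := by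
  induction d generalizing q with
  | zero => simp [stairList, stairProd, listProd]
  | succ d ih => rw [stairList, listProd_append, ih, stairProd, listProd_desc]

open Classical in
/-- The coefficients of a product of factors are sums over subwords that are reduced words. -/
theorem nilCoeff_listProd (l : List (ℕ × R)) {w : BCInf} (hw : w ∈ BC n) :
    nilCoeff (listProd n l) w = ∑ c ∈ (finite_redWords w).toFinset, subwordSum l c := by
  induction l using List.reverseRecOn generalizing w with
  | nil =>
    simp only [listProd, List.map_nil, List.prod_nil, nilCoeff_one, subwordSum_nil_left,
      Finset.sum_ite_eq', Set.Finite.mem_toFinset]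
    refine if_congr ⟨?_, fun h => h.1.symm⟩ rfl rfl
    rintro rfl
    exact ⟨rfl, length_one.symm⟩
  | append_singleton l q ih =>
    have h1 : listProd n [q] = hFac (nilGen R n) q.1 q.2 := by simp [listProd]
    rw [listProd_append, h1, nilCoeff_mul_hFac _ hw, ih hw]
    have h2 : ∀ c, subwordSum (l ++ [q]) c = subwordSum l c +
        if c.getLast? = some q.1 then q.2 * subwordSum l c.dropLast else 0 := by
      intro c
      rcases List.eq_nil_or_concat' c with rfl | ⟨c, j, rfl⟩
      · simp
      · rw [subwordSum_concat, List.getLast?_concat, List.dropLast_concat]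
        simp only [Option.some.injEq, eq_comm]
    simp only [h2, Finset.sum_add_distrib]
    congr 1
    rw [← Finset.sum_filter]
    split_ifs with h
    · rw [ih (mul_s_mem_BC hw h), Finset.mul_sum]
      have hl := length_le_mul_s w q.1
      refine Finset.sum_nbij' (fun c => c ++ [q.1]) (fun c => c.dropLast) ?_ ?_ ?_ ?_ ?_
      · intro c hc
        rw [Set.Finite.mem_toFinset] at hc
        rw [Finset.mem_filter, Set.Finite.mem_toFinset]
        refine ⟨⟨?_, ?_⟩, by simp⟩
        · rw [wordProd_append, hc.1, wordProd_cons, wordProd_nil, mul_one, mul_s_mul_s]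
        · rw [List.length_append, hc.2, List.length_singleton]
          omega
      · intro c hc
        rw [Finset.mem_filter, Set.Finite.mem_toFinset] at hc
        rw [Set.Finite.mem_toFinset]
        rcases List.eq_nil_or_concat' c with rfl | ⟨c, j, rfl⟩
        · simp at hc
        · obtain ⟨⟨hc1, hc2⟩, hc3⟩ := hc
          rw [List.getLast?_concat, Option.some.injEq] at hc3
          subst hc3
          rw [List.dropLast_concat]
          rw [wordProd_append, wordProd_cons, wordProd_nil, mul_one] at hc1
          rw [List.length_append, List.length_singleton] at hc2
          have h3 : wordProd c = w * s q.1 := by rw [← hc1, mul_s_mul_s]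
          have := length_wordProd_le c
          rw [h3] at this
          exact ⟨h3, by omega⟩
      · intro c _
        simp
      · intro c hc
        rw [Finset.mem_filter] at hc
        rcases List.eq_nil_or_concat' c with rfl | ⟨c, j, rfl⟩
        · simp at hc
        · rw [List.getLast?_concat, Option.some.injEq] at hc
          rw [List.dropLast_concat, hc.2]
      · intro c _
        simp
    -- A reduced word of `w` ending in this letter would make it a descent, so none exists.
    · rw [mul_zero, eq_comm]
      refine Finset.sum_eq_zero fun c hc => ?_
      exfalso
      rw [Finset.mem_filter, Set.Finite.mem_toFinset] at hc
      rcases List.eq_nil_or_concat' c with rfl | ⟨c, j, rfl⟩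
      · simp at hc
      · obtain ⟨⟨hc1, hc2⟩, hc3⟩ := hc
        rw [List.getLast?_concat, Option.some.injEq] at hc3
        subst hc3
        rw [wordProd_append, wordProd_cons, wordProd_nil, mul_one] at hc1
        rw [List.length_append, List.length_singleton] at hc2
        have h3 : wordProd c = w * s q.1 := by rw [← hc1, mul_s_mul_s]
        have := length_wordProd_le c
        rw [h3] at this
        omega

end

open Classical in
/-- The truncated Schubert polynomials are sums over subwords of the base of pipe dreams. -/
theorem trunc_eq_sum_subwordSum {S : BCInf → SRing} (hS : IsSchubertFamily S) {n : ℕ} {w : BCInf}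
    (hw : w ∈ BC n) (k : ℕ) : trunc k (S w) = ∑ c ∈ (finite_redWords w).toFinset,
      subwordSum (blocksList n xP k ++ stairList zP 0 n) c := by
  rw [← nilCoeff_listProd _ hw, trunc_eq_nilCoeff hS hw k 0, listProd_append, listProd_blocksList]
  congr 2
  cases n with
  | zero => rfl
  | succ m =>
    -- The depth on the nilCoxeter side puts one surplus factor of index `n` into each row, and its
    -- generator vanishes.
    rw [listProd_stairList, ← stairProd_add zP (fun j hj => nilGen_eq_zero hj) 1 0 m (by omega)]

end TypeC

namespace TypeC

/-! ### Admissible sequences -/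

theorem getD_take_of_lt {a : List ℕ} {p i : ℕ} (h : i < p) : (a.take p).getD i 0 = a.getD i 0 := by
  simp [List.getD_eq_getElem?_getD, h]

theorem getD_drop' (a : List ℕ) (p i : ℕ) : (a.drop p).getD i 0 = a.getD (p + i) 0 := by
  simp [List.getD_eq_getElem?_getD]

theorem getD_replicate_append_of_lt {p i x : ℕ} (j : List ℕ) (h : i < p) :
    (List.replicate p x ++ j).getD i 0 = x := by
  rw [List.getD_append _ _ _ _ (by simpa using h)]
  simp [List.getD_eq_getElem?_getD, h]

theorem getD_replicate_append_add (p i x : ℕ) (j : List ℕ) :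
    (List.replicate p x ++ j).getD (p + i) 0 = j.getD i 0 := by
  rw [List.getD_append_right _ _ _ _ (by simp)]
  simp

theorem getD_mem {j : List ℕ} {i : ℕ} (h : i < j.length) : j.getD i 0 ∈ j := by
  rw [List.getD_eq_getElem _ _ h]
  exact List.getElem_mem h

theorem noPeak_iff (a : List ℕ) : NoPeak a ↔ ∀ i, i + 2 < a.length →
    ¬(a.getD i 0 < a.getD (i + 1) 0 ∧ a.getD (i + 2) 0 < a.getD (i + 1) 0) := by
  induction a with
  | nil => simp [NoPeak]
  | cons x a ih =>
    rcases a with _ | ⟨y, _ | ⟨z, t⟩⟩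
    · simp [NoPeak]
    · simp [NoPeak]
    · rw [NoPeak, ih]
      constructor
      · rintro ⟨h1, h2⟩ i hi
        cases i with
        | zero => exact h1
        | succ i => exact h2 i (by simpa using hi)
      · intro h
        exact ⟨h 0 (by simp), fun i hi => h (i + 1) (by simpa using hi)⟩

theorem isChain_gt_iff_getD (a : List ℕ) : a.IsChain (· > ·) ↔
    ∀ i, i + 1 < a.length → a.getD (i + 1) 0 < a.getD i 0 := by
  rw [List.isChain_iff_getElem]
  constructor
  · intro h i hi
    rw [List.getD_eq_getElem _ _ hi, List.getD_eq_getElem _ _ (by omega)]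
    exact h i hi
  · intro h i hi
    have := h i hi
    rwa [List.getD_eq_getElem _ _ hi, List.getD_eq_getElem _ _ (by omega)] at this

theorem isXAdmissible_iff {a j : List ℕ} : IsXAdmissible a j ↔
    j.length = a.length ∧ j.Pairwise (· ≥ ·) ∧ ∀ i, i + 2 < a.length →
      j.getD i 0 = j.getD (i + 1) 0 → j.getD (i + 1) 0 = j.getD (i + 2) 0 →
        ¬(a.getD i 0 < a.getD (i + 1) 0 ∧ a.getD (i + 2) 0 < a.getD (i + 1) 0) := by
  refine and_congr_right fun _ => and_congr_right fun _ => ⟨fun h i hi h1 h2 h3 => ?_,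
    fun h i hi hi' h1 h2 h3 => ?_⟩
  · exact h (i + 1) (by omega) hi h1 h2 ⟨by omega, hi, h3⟩
  · obtain ⟨i, rfl⟩ : ∃ k, i = k + 1 := ⟨i - 1, by omega⟩
    exact h i hi' h1 h2 h3.2.2

/-- The peak condition concerns three equal variables, so it acts only within one run. For the run
of the largest variable it says that the matching prefix has no peak. -/
theorem isXAdmissible_replicate_append {a j : List ℕ} {p k : ℕ} (hp : p ≤ a.length)
    (hj : ∀ t ∈ j, t < k) : IsXAdmissible a (List.replicate p k ++ j) ↔
      NoPeak (a.take p) ∧ IsXAdmissible (a.drop p) j := by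
  rw [isXAdmissible_iff, isXAdmissible_iff, noPeak_iff, List.length_append, List.length_replicate,
    List.length_drop, List.length_take, min_eq_left hp, List.pairwise_append]
  constructor
  · rintro ⟨h1, ⟨-, h2, -⟩, h3⟩
    refine ⟨fun i hi => ?_, by omega, h2, fun i hi e1 e2 => ?_⟩
    · rw [getD_take_of_lt (by omega), getD_take_of_lt (by omega), getD_take_of_lt (by omega)]
      refine h3 i (by omega) ?_ ?_ <;>
        rw [getD_replicate_append_of_lt _ (by omega), getD_replicate_append_of_lt _ (by omega)]
    · simp only [getD_drop']
      refine h3 (p + i) (by omega) ?_ ?_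
      · rw [add_assoc, getD_replicate_append_add, getD_replicate_append_add, e1]
      · rw [add_assoc, add_assoc, getD_replicate_append_add, getD_replicate_append_add, e2]
  · rintro ⟨h1, h2, h3, h4⟩
    refine ⟨by omega, ⟨?_, h3, ?_⟩, fun i hi e1 e2 => ?_⟩
    · rw [List.pairwise_replicate]; right; exact le_rfl
    · intro x hx y hy
      rw [List.eq_of_mem_replicate hx]
      exact (hj y hy).le
    · rcases lt_or_ge (i + 2) p with h5 | h5
      · have := h1 i h5
        rwa [getD_take_of_lt (by omega), getD_take_of_lt (by omega),
          getD_take_of_lt (by omega)] at this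
      rcases lt_or_ge i p with h6 | h6
      -- A triple of equal variables across the end of the run would place the entry `k` in `j`.
      · exfalso
        obtain ⟨m, hm⟩ : ∃ m, i + 2 = p + m := ⟨i + 2 - p, by omega⟩
        rw [getD_replicate_append_of_lt _ h6] at e1
        rw [← e1, hm, getD_replicate_append_add] at e2
        have := hj _ (getD_mem (j := j) (i := m) (by omega))
        omega
      · obtain ⟨m, rfl⟩ : ∃ m, i = p + m := ⟨i - p, by omega⟩
        have := h4 m (by omega)
        simp only [getD_drop', ← add_assoc] at this
        rw [add_assoc, getD_replicate_append_add, getD_replicate_append_add] at e1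
        rw [add_assoc, add_assoc, getD_replicate_append_add, getD_replicate_append_add] at e2
        exact this e1 e2

/-- Within a run of one variable, admissibility says that the letters strictly decrease and exceed
`q`: such words are the subwords of one staircase row. -/
theorem isZAdmissible_replicate_append {b j : List ℕ} {p q : ℕ} (hp : p ≤ b.length)
    (hj : ∀ t ∈ j, q < t) : IsZAdmissible b (List.replicate p q ++ j) ↔
      ((b.take p).IsChain (· > ·) ∧ ∀ x ∈ b.take p, q < x) ∧ IsZAdmissible (b.drop p) j := by
  rw [IsZAdmissible, IsZAdmissible, isChain_gt_iff_getD, List.length_append,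
    List.length_replicate, List.length_drop, List.length_take, min_eq_left hp,
    List.pairwise_append]
  constructor
  · rintro ⟨h1, ⟨-, h2, -⟩, h3, h4⟩
    refine ⟨⟨fun i hi => ?_, fun x hx => ?_⟩, by omega, h2, fun i hi => ?_, fun i hi e => ?_⟩
    · rw [getD_take_of_lt (by omega), getD_take_of_lt (by omega)]
      refine h4 i (by omega) ?_
      rw [getD_replicate_append_of_lt _ (by omega), getD_replicate_append_of_lt _ (by omega)]
    · obtain ⟨i, hi, rfl⟩ := List.getElem_of_mem hx
      have hi' := hi
      rw [List.length_take, lt_min_iff] at hi'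
      have := h3 i hi'.2
      rw [getD_replicate_append_of_lt _ hi'.1] at this
      rw [← List.getD_eq_getElem _ 0 hi, getD_take_of_lt hi'.1]
      exact this
    · have := h3 (p + i) (by omega)
      rwa [getD_replicate_append_add, ← getD_drop'] at this
    · have := h4 (p + i) (by omega)
      rw [add_assoc, getD_replicate_append_add, getD_replicate_append_add, ← getD_drop' b p,
        ← getD_drop' b p] at this
      exact this e
  · rintro ⟨⟨h1, h2⟩, h3, h4, h5, h6⟩
    refine ⟨by omega, ⟨?_, h4, ?_⟩, fun i hi => ?_, fun i hi e => ?_⟩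
    · rw [List.pairwise_replicate]; right; exact le_rfl
    · intro x hx y hy
      rw [List.eq_of_mem_replicate hx]
      exact (hj y hy).le
    · rcases lt_or_ge i p with h | h
      · rw [getD_replicate_append_of_lt _ h, ← getD_take_of_lt h]
        exact h2 _ (getD_mem (by rw [List.length_take]; omega))
      · obtain ⟨m, rfl⟩ : ∃ m, i = p + m := ⟨i - p, by omega⟩
        rw [getD_replicate_append_add, ← getD_drop']
        exact h5 m (by omega)
    · rcases lt_or_ge (i + 1) p with h | h
      · have := h1 i h
        rwa [getD_take_of_lt (by omega), getD_take_of_lt (by omega)] at this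
      rcases lt_or_ge i p with h' | h'
      · exfalso
        obtain ⟨m, hm⟩ : ∃ m, i + 1 = p + m := ⟨i + 1 - p, by omega⟩
        rw [getD_replicate_append_of_lt _ h', hm, getD_replicate_append_add] at e
        have := hj _ (getD_mem (j := j) (i := m) (by omega))
        omega
      · obtain ⟨m, rfl⟩ : ∃ m, i = p + m := ⟨i - p, by omega⟩
        rw [add_assoc, getD_replicate_append_add, getD_replicate_append_add] at e
        have := h6 m (by omega) e
        rwa [getD_drop', getD_drop', ← add_assoc] at this

theorem exists_replicate_append_of_le {j : List ℕ} {k : ℕ} (h : j.Pairwise (· ≥ ·))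
    (hk : ∀ t ∈ j, t < k + 1) : ∃ p j', j = List.replicate p k ++ j' ∧ ∀ t ∈ j', t < k := by
  induction j with
  | nil => exact ⟨0, [], rfl, by simp⟩
  | cons x j ih =>
    rw [List.pairwise_cons] at h
    obtain ⟨p, j', h1, h2⟩ := ih h.2 fun t ht => hk t (List.mem_cons_of_mem _ ht)
    rcases eq_or_lt_of_le (Nat.lt_succ_iff.1 (hk x List.mem_cons_self)) with rfl | hx
    · exact ⟨p + 1, j', by rw [List.replicate_succ, List.cons_append, ← h1], h2⟩
    · refine ⟨0, x :: j, rfl, fun t ht => ?_⟩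
      rcases List.mem_cons.1 ht with rfl | ht
      · exact hx
      · exact lt_of_le_of_lt (h.1 t ht) hx

theorem exists_replicate_append_of_ge {j : List ℕ} {q : ℕ} (h : j.Pairwise (· ≤ ·))
    (hq : ∀ t ∈ j, q ≤ t) : ∃ p j', j = List.replicate p q ++ j' ∧ ∀ t ∈ j', q < t := by
  induction j with
  | nil => exact ⟨0, [], rfl, by simp⟩
  | cons x j ih =>
    rw [List.pairwise_cons] at h
    obtain ⟨p, j', h1, h2⟩ := ih h.2 fun t ht => hq t (List.mem_cons_of_mem _ ht)
    rcases eq_or_lt_of_le (hq x List.mem_cons_self) with rfl | hx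
    · exact ⟨p + 1, j', by rw [List.replicate_succ, List.cons_append, ← h1], h2⟩
    · refine ⟨0, x :: j, rfl, fun t ht => ?_⟩
      rcases List.mem_cons.1 ht with rfl | ht
      · exact hx
      · exact lt_of_lt_of_le hx (h.1 t ht)

theorem replicate_append_inj {p p' x : ℕ} {j j' : List ℕ} (hj : x ∉ j) (hj' : x ∉ j')
    (h : List.replicate p x ++ j = List.replicate p' x ++ j') : p = p' ∧ j = j' := by
  have h1 := congrArg (List.count x) h
  simp only [List.count_append, List.count_replicate_self, List.count_eq_zero_of_not_mem hj,
    List.count_eq_zero_of_not_mem hj', add_zero] at h1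
  subst h1
  exact ⟨rfl, List.append_cancel_left h⟩

open Classical in
/-- The `x`-admissible sequences with entries less than `k`. -/
noncomputable def xSeqs : ℕ → List ℕ → Finset (List ℕ)
  | 0, a => if a = [] then {[]} else ∅
  | k + 1, a => ((Finset.range (a.length + 1)).filter fun p => NoPeak (a.take p)).biUnion fun p =>
      (xSeqs k (a.drop p)).image fun j => List.replicate p k ++ j

open Classical in
/-- The `z`-admissible sequences with entries from `q, …, q + d - 1`. -/
noncomputable def zSeqs : ℕ → ℕ → List ℕ → Finset (List ℕ)
  | _, 0, b => if b = [] then {[]} else ∅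
  | q, d + 1, b => ((Finset.range (b.length + 1)).filter fun p =>
      (b.take p).IsChain (· > ·) ∧ ∀ x ∈ b.take p, q < x).biUnion fun p =>
        (zSeqs (q + 1) d (b.drop p)).image fun j => List.replicate p q ++ j

theorem mem_xSeqs {k : ℕ} {a j : List ℕ} :
    j ∈ xSeqs k a ↔ IsXAdmissible a j ∧ ∀ t ∈ j, t < k := by
  induction k generalizing a j with
  | zero =>
    rw [xSeqs]
    constructor
    · intro h
      split_ifs at h with ha
      · rw [Finset.mem_singleton] at h
        subst h ha
        exact ⟨⟨rfl, List.Pairwise.nil, fun i _ hi => by simp at hi⟩, by simp⟩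
      · simp at h
    · rintro ⟨h1, h2⟩
      obtain rfl : j = [] := List.eq_nil_iff_forall_not_mem.2 fun t ht => by simpa using h2 t ht
      have := h1.1
      rw [if_pos (List.length_eq_zero_iff.1 this.symm), Finset.mem_singleton]
  | succ k ih =>
    rw [xSeqs]
    simp only [Finset.mem_biUnion, Finset.mem_filter, Finset.mem_range, Finset.mem_image, ih]
    constructor
    · rintro ⟨p, ⟨hp, hp'⟩, j', ⟨h1, h2⟩, rfl⟩
      refine ⟨(isXAdmissible_replicate_append (by omega) h2).2 ⟨hp', h1⟩, fun t ht => ?_⟩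
      rcases List.mem_append.1 ht with h | h
      · rw [List.eq_of_mem_replicate h]; omega
      · have := h2 t h
        omega
    · rintro ⟨h1, h2⟩
      obtain ⟨p, j', rfl, hj'⟩ := exists_replicate_append_of_le h1.2.1 h2
      have hp : p ≤ a.length := by
        have := h1.1
        rw [List.length_append, List.length_replicate] at this
        omega
      have h3 := (isXAdmissible_replicate_append hp hj').1 h1
      exact ⟨p, ⟨by omega, h3.1⟩, j', ⟨h3.2, hj'⟩, rfl⟩

theorem mem_zSeqs {q d : ℕ} {b j : List ℕ} :
    j ∈ zSeqs q d b ↔ IsZAdmissible b j ∧ ∀ t ∈ j, q ≤ t ∧ t < q + d := by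
  induction d generalizing q b j with
  | zero =>
    rw [zSeqs]
    constructor
    · intro h
      split_ifs at h with ha
      · rw [Finset.mem_singleton] at h
        subst h ha
        exact ⟨⟨rfl, List.Pairwise.nil, fun i hi => by simp at hi, fun i hi => by simp at hi⟩,
          by simp⟩
      · simp at h
    · rintro ⟨h1, h2⟩
      obtain rfl : j = [] := List.eq_nil_iff_forall_not_mem.2 fun t ht => by
        have := h2 t ht
        omega
      have := h1.1
      rw [if_pos (List.length_eq_zero_iff.1 this.symm), Finset.mem_singleton]
  | succ d ih =>
    rw [zSeqs]
    simp only [Finset.mem_biUnion, Finset.mem_filter, Finset.mem_range, Finset.mem_image, ih]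
    constructor
    · rintro ⟨p, ⟨hp, hp'⟩, j', ⟨h1, h2⟩, rfl⟩
      refine ⟨(isZAdmissible_replicate_append (by omega) fun t ht => (h2 t ht).1).2 ⟨hp', h1⟩,
        fun t ht => ?_⟩
      rcases List.mem_append.1 ht with h | h
      · rw [List.eq_of_mem_replicate h]; omega
      · have := h2 t h
        omega
    · rintro ⟨h1, h2⟩
      obtain ⟨p, j', rfl, hj'⟩ := exists_replicate_append_of_ge h1.2.1 fun t ht => (h2 t ht).1
      have hp : p ≤ b.length := by
        have := h1.1
        rw [List.length_append, List.length_replicate] at this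
        omega
      have h3 := (isZAdmissible_replicate_append hp hj').1 h1
      refine ⟨p, ⟨by omega, h3.1⟩, j', ⟨h3.2, fun t ht => ⟨hj' t ht, ?_⟩⟩, rfl⟩
      have := h2 t (List.mem_append_right _ ht)
      omega

/-! ### Weighted sums over admissible sequences. -/

section

variable {R : Type*} [CommRing R]

/-- The weight `2^i(α) x^α` of a sequence of variables. -/
def xWeight (x : ℕ → R) (j : List ℕ) : R := 2 ^ j.toFinset.card * (j.map x).prod

theorem xWeight_replicate_append (x : ℕ → R) (p : ℕ) {k : ℕ} {j : List ℕ}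
    (hj : ∀ t ∈ j, t < k) : xWeight x (List.replicate p k ++ j) =
      (if p = 0 then 1 else 2) * x k ^ p * xWeight x j := by
  have hk : k ∉ j := fun h => lt_irrefl _ (hj k h)
  rw [xWeight, xWeight, List.map_append, List.prod_append, List.map_replicate,
    List.prod_replicate]
  split_ifs with hp
  · simp [hp]
  · rw [List.toFinset_append, List.toFinset_replicate_of_ne_zero hp, Finset.card_union_of_disjoint,
      Finset.card_singleton, pow_add]
    · ring
    · rw [Finset.disjoint_singleton_left, List.mem_toFinset]
      exact hk

theorem sum_xSeqs_succ {k : ℕ} {a : List ℕ} (f : List ℕ → R) [DecidablePred NoPeak] :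
    ∑ j ∈ xSeqs (k + 1) a, f j = ∑ p ∈ Finset.range (a.length + 1),
      if NoPeak (a.take p) then ∑ j ∈ xSeqs k (a.drop p), f (List.replicate p k ++ j) else 0 := by
  have hk : ∀ {b j : List ℕ}, j ∈ xSeqs k b → k ∉ j := fun hj h =>
    lt_irrefl _ ((mem_xSeqs.1 hj).2 k h)
  rw [xSeqs, Finset.sum_biUnion, ← Finset.sum_filter]
  · refine Finset.sum_congr (by ext; simp) fun p _ => ?_
    rw [Finset.sum_image]
    exact fun j hj j' hj' h => (replicate_append_inj (hk hj) (hk hj') h).2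
  · intro p _ p' _ hpp
    rw [Function.onFun, Finset.disjoint_left]
    intro j hj hj'
    obtain ⟨j₁, h1, rfl⟩ := Finset.mem_image.1 hj
    obtain ⟨j₂, h2, h3⟩ := Finset.mem_image.1 hj'
    exact hpp (replicate_append_inj (hk h1) (hk h2) h3.symm).1

open Classical in
theorem sum_zSeqs_succ {q d : ℕ} {b : List ℕ} (f : List ℕ → R) :
    ∑ j ∈ zSeqs q (d + 1) b, f j = ∑ p ∈ Finset.range (b.length + 1),
      if (b.take p).IsChain (· > ·) ∧ ∀ x ∈ b.take p, q < x then
        ∑ j ∈ zSeqs (q + 1) d (b.drop p), f (List.replicate p q ++ j) else 0 := by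
  have hk : ∀ {b j : List ℕ}, j ∈ zSeqs (q + 1) d b → q ∉ j := fun hj h =>
    absurd ((mem_zSeqs.1 hj).2 q h).1 (by omega)
  rw [zSeqs, Finset.sum_biUnion, ← Finset.sum_filter]
  · refine Finset.sum_congr rfl fun p _ => ?_
    rw [Finset.sum_image]
    exact fun j hj j' hj' h => (replicate_append_inj (hk hj) (hk hj') h).2
  · intro p _ p' _ hpp
    rw [Function.onFun, Finset.disjoint_left]
    intro j hj hj'
    obtain ⟨j₁, h1, rfl⟩ := Finset.mem_image.1 hj
    obtain ⟨j₂, h2, h3⟩ := Finset.mem_image.1 hj'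
    exact hpp (replicate_append_inj (hk h1) (hk h2) h3.symm).1

open Classical in
-- Both sides satisfy the same recursion: the prefix spelled in the top block is the run of the
-- largest variable, and the two ways to place a nonempty one match the factor 2 of a new variable.
theorem subwordSum_blocksList {n : ℕ} (x : ℕ → R) (k : ℕ) {a : List ℕ} (ha : a.IsChain (· ≠ ·))
    (hn : ∀ i ∈ a, i < n) :
    subwordSum (blocksList n x k) a = ∑ j ∈ xSeqs k a, xWeight x j := by
  induction k generalizing a with
  | zero =>
    rw [blocksList, subwordSum_nil_left, xSeqs]
    split_ifs <;> simp [xWeight]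
  | succ k ih =>
    rw [blocksList, subwordSum_append, sum_xSeqs_succ]
    refine Finset.sum_congr rfl fun p hp => ?_
    rw [Finset.mem_range, Nat.lt_succ_iff] at hp
    rw [subwordSum_gammaList _ (ha.take p) fun i hi => hn i (List.mem_of_mem_take hi),
      ih (ha.drop p) fun i hi => hn i (List.mem_of_mem_drop hi), List.length_take,
      min_eq_left hp, Finset.mul_sum]
    have h0 : a.take p = [] ↔ p = 0 := by
      rw [List.take_eq_nil_iff]
      constructor
      · rintro (h | rfl)
        · exact h
        · simpa using hp
      · exact Or.inl
    by_cases h : NoPeak (a.take p)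
    · simp only [if_pos h]
      refine Finset.sum_congr rfl fun j hj => ?_
      rw [xWeight_replicate_append x p (mem_xSeqs.1 hj).2, if_congr h0 rfl rfl]
    · simp only [if_neg h]
      rw [if_neg]
      · simp
      · intro h1
        rw [h1] at h
        exact h trivial

open Classical in
theorem subwordSum_stairList (z : ℕ → R) (q d : ℕ) {b : List ℕ} (hb : ∀ i ∈ b, i < q + d) :
    subwordSum (stairList z q d) b = ∑ j ∈ zSeqs q d b, (j.map z).prod := by
  induction d generalizing q b with
  | zero =>
    rw [stairList, subwordSum_nil_left, zSeqs]
    split_ifs <;> simp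
  | succ d ih =>
    rw [stairList, subwordSum_append, sum_zSeqs_succ]
    refine Finset.sum_congr rfl fun p hp => ?_
    rw [Finset.mem_range, Nat.lt_succ_iff] at hp
    rw [subwordSum_map_of_nodup (List.nodup_reverse.2 List.nodup_range'),
      ih (q + 1) fun i hi => by
        have := hb i (List.mem_of_mem_drop hi)
        omega]
    have h : (b.take p).Sublist (List.range' (q + 1) d).reverse ↔
        (b.take p).IsChain (· > ·) ∧ ∀ x ∈ b.take p, q < x := by
      rw [sublist_reverse_range'_iff]
      refine and_congr_right fun _ => forall₂_congr fun x hx => ?_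
      have := hb x (List.mem_of_mem_take hx)
      omega
    simp only [h]
    split_ifs
    · rw [Finset.mul_sum, List.length_take, min_eq_left hp]
      refine Finset.sum_congr rfl fun j _ => ?_
      rw [List.map_append, List.prod_append, List.map_replicate, List.prod_replicate]
    · rw [zero_mul]

end

end TypeC

namespace TypeC

/-! ### The sum over pipe dreams -/

/-- Induction on the list: the first box is either outside the subset or supplies the first letter.
-/
theorem sum_powerset_eq_subwordSum {β R : Type*} [DecidableEq β] [CommRing R] (lab : β → ℕ)
    (f : β → R) {L : List β} (hL : L.Nodup) (c : List ℕ) :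
    (∑ t ∈ L.toFinset.powerset,
      if (L.filter (· ∈ t)).map lab = c then ∏ b ∈ t, f b else 0) =
      subwordSum (L.map fun b => (lab b, f b)) c := by
  induction L generalizing c with
  | nil =>
    rw [List.map_nil, subwordSum_nil_left]
    simp [eq_comm]
  | cons b L ih =>
    rw [List.nodup_cons] at hL
    have hb : b ∉ L.toFinset := by simpa using hL.1
    have h1 : ∀ t ∈ L.toFinset.powerset,
        (b :: L).filter (· ∈ t) = L.filter (· ∈ t) := by
      intro t ht
      have : b ∉ t := fun h => hb (Finset.mem_powerset.1 ht h)
      rw [List.filter_cons, if_neg (by simpa using this)]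
    have h2 : ∀ t : Finset β, (b :: L).filter (· ∈ insert b t) = b :: L.filter (· ∈ t) := by
      intro t
      rw [List.filter_cons_of_pos (by simp)]
      congr 1
      refine List.filter_congr fun x hx => ?_
      have : x ≠ b := fun h => hL.1 (h ▸ hx)
      simp [this]
    have h3 : ∀ t ∈ L.toFinset.powerset, ∏ x ∈ insert b t, f x = f b * ∏ x ∈ t, f x := by
      intro t ht
      exact Finset.prod_insert fun h => hb (Finset.mem_powerset.1 ht h)
    have h4 : (∑ t ∈ L.toFinset.powerset,
        if ((b :: L).filter (· ∈ t)).map lab = c then ∏ b ∈ t, f b else 0) =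
        subwordSum (L.map fun b => (lab b, f b)) c := by
      rw [← ih hL.2]
      exact Finset.sum_congr rfl fun t ht => by rw [h1 t ht]
    have h5 : (∑ t ∈ L.toFinset.powerset,
        if ((b :: L).filter (· ∈ insert b t)).map lab = c then ∏ x ∈ insert b t, f x else 0) =
        ∑ t ∈ L.toFinset.powerset,
          if lab b :: (L.filter (· ∈ t)).map lab = c then f b * ∏ x ∈ t, f x else 0 :=
      Finset.sum_congr rfl fun t ht => by rw [h2 t, h3 t ht, List.map_cons]
    rw [List.toFinset_cons, Finset.sum_powerset_insert hb, List.map_cons, h4, h5]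
    cases c with
    | nil => simp [subwordSum]
    | cons j c =>
      rw [subwordSum]
      congr 1
      simp only [List.cons.injEq]
      split_ifs with h
      · rw [← ih hL.2, Finset.mul_sum]
        refine Finset.sum_congr rfl fun t _ => ?_
        simp only [h, true_and, mul_ite, mul_zero]
      · simp [h]

theorem Tile.letter_eq {i : ℕ} (t : Tile i) : t.letter = if t.wt = 1 then [i] else [] := by
  cases t <;> rfl

theorem Tile.wt_eq {i : ℕ} (t : Tile i) : t.wt = if t.wt = 1 then 1 else 0 := by
  cases t <;> rfl

theorem wt_tileEquiv (i : ℕ) (b : Bool) : (tileEquiv i b).wt = if b then 1 else 0 := by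
  cases i <;> cases b <;> rfl

theorem Tile.eq_of_wt_eq {i : ℕ} {t t' : Tile i} (h : t.wt = t'.wt) : t = t' := by
  cases t <;> cases t' <;> first | rfl | (simp [Tile.wt] at h)

section

variable {n k : ℕ}

open Classical in
/-- The boxes that contain significant elements. -/
noncomputable def significant (D : PipeDream n k) : Finset (Box n k) :=
  Finset.univ.filter fun b => (D b).wt = 1

open Classical in
theorem word_eq (D : PipeDream n k) :
    word D = ((readingOrder n k).filter (· ∈ significant D)).map label := by
  rw [word]
  induction readingOrder n k with
  | nil => rfl
  | cons b L ih =>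
    rw [List.flatMap_cons, ih, Tile.letter_eq, List.filter_cons]
    by_cases h : (D b).wt = 1 <;> simp [significant, h]

theorem monomial_eq (D : PipeDream n k) : monomial D = ∏ b ∈ significant D, var b := by
  classical
  rw [significant, Finset.prod_filter, monomial]
  refine Finset.prod_congr rfl fun b _ => ?_
  split_ifs with h
  · rw [h, pow_one]
  · rw [Tile.wt_eq, if_neg h, pow_zero]

theorem sum_pipeDream {R : Type*} [AddCommMonoid R] (f : Finset (Box n k) → R) :
    ∑ D : PipeDream n k, f (significant D) = ∑ t, f t := by
  classical
  refine Finset.sum_nbij' significant (fun t b => tileEquiv (label b) (decide (b ∈ t)))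
    (fun _ _ => Finset.mem_univ _) (fun _ _ => Finset.mem_univ _) ?_ ?_ fun _ _ => rfl
  · intro D _
    funext b
    apply Tile.eq_of_wt_eq
    rw [wt_tileEquiv, Tile.wt_eq (D b)]
    simp [significant]
  · intro t _
    ext b
    simp [significant, wt_tileEquiv]

theorem mem_readingOrder (b : Box n k) : b ∈ readingOrder n k := by
  rw [readingOrder, List.mem_append]
  rcases b with ⟨⟨r, c⟩, h⟩ | ⟨g, i⟩ | ⟨g, i⟩
  · right
    rw [List.mem_flatMap]
    refine ⟨r, List.mem_finRange r, ?_⟩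
    rw [List.mem_filterMap]
    exact ⟨c, by simp, dif_pos h⟩
  · left
    rw [List.mem_flatMap]
    exact ⟨g, by simp, by simp⟩
  · left
    rw [List.mem_flatMap]
    exact ⟨g, by simp, by simp⟩

theorem nodup_readingOrder : (readingOrder n k).Nodup := by
  rw [readingOrder, List.nodup_append]
  refine ⟨?_, ?_, ?_⟩
  · rw [List.nodup_flatMap]
    constructor
    · intro g _
      rw [List.nodup_append]
      refine ⟨?_, ?_, ?_⟩
      · refine (List.nodup_reverse.2 (List.nodup_finRange n)).map fun i j h => ?_
        simpa using h
      · refine (List.nodup_finRange n).map fun i j h => ?_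
        simpa using h
      · intro a ha b hb
        obtain ⟨i, -, rfl⟩ := List.mem_map.1 ha
        obtain ⟨j, -, rfl⟩ := List.mem_map.1 hb
        simp
    · refine (List.nodup_reverse.2 (List.nodup_finRange k)).imp fun {g g'} hg => ?_
      intro a ha hb
      simp only [List.mem_append, List.mem_map] at ha hb
      rcases ha with ⟨i, -, rfl⟩ | ⟨i, -, rfl⟩ <;> rcases hb with ⟨j, -, hj⟩ | ⟨j, -, hj⟩ <;>
        simp at hj
      · exact hg hj.1.symm
      · exact hg hj.1.symm
  · rw [List.nodup_flatMap]
    constructor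
    · intro r _
      refine (List.nodup_reverse.2 (List.nodup_finRange n)).filterMap fun c c' b hb hb' => ?_
      simp only [Option.mem_def, Option.dite_none_right_eq_some, Option.some.injEq] at hb hb'
      obtain ⟨h, rfl⟩ := hb
      obtain ⟨h', e⟩ := hb'
      simp only [Sum.inl.injEq, Subtype.mk.injEq, Prod.mk.injEq, true_and] at e
      exact e.symm
    · refine (List.nodup_finRange n).imp fun {r r'} hr => ?_
      intro a ha hb
      simp only [List.mem_filterMap, Option.dite_none_right_eq_some, Option.some.injEq] at ha hb
      obtain ⟨c, -, h, rfl⟩ := ha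
      obtain ⟨c', -, h', e⟩ := hb
      simp only [Sum.inl.injEq, Subtype.mk.injEq, Prod.mk.injEq] at e
      exact hr e.1.symm
  · intro a ha b hb
    rw [List.mem_flatMap] at ha hb
    obtain ⟨g, -, ha⟩ := ha
    obtain ⟨r, -, hb⟩ := hb
    simp only [List.mem_filterMap, Option.dite_none_right_eq_some, Option.some.injEq] at hb
    obtain ⟨c, -, h, rfl⟩ := hb
    simp only [List.mem_append, List.mem_map] at ha
    rcases ha with ⟨i, -, rfl⟩ | ⟨i, -, rfl⟩ <;> simp

theorem range'_eq_map_finRange (n : ℕ) : List.range' 0 n = (List.finRange n).map Fin.val := by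
  rw [← List.range_eq_range', List.map_coe_finRange_eq_range]

theorem blocksList_eq {R : Type*} [CommRing R] (n : ℕ) (x : ℕ → R) (k : ℕ) :
    blocksList n x k = (List.range k).reverse.flatMap fun g => gammaList n (x g) := by
  induction k with
  | zero => rfl
  | succ k ih =>
    rw [List.range_succ, List.reverse_append, List.reverse_singleton, List.singleton_append,
      List.flatMap_cons, blocksList, ih]

theorem stairList_eq {R : Type*} [CommRing R] (z : ℕ → R) (q d : ℕ) :
    stairList z q d = (List.range' q d).flatMap fun r =>
      (List.range' (r + 1) (q + d - 1 - r)).reverse.map fun i => (i, z r) := by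
  induction d generalizing q with
  | zero => rfl
  | succ d ih =>
    rw [List.range'_succ, List.flatMap_cons, stairList, ih]
    congr 4
    · omega
    · funext r
      congr 3
      omega

theorem filterMap_range_row {R : Type*} (n r : ℕ) (z : R) :
    (List.range' 0 n).filterMap (fun c => if r + c + 1 < n then some (r + c + 1, z) else none) =
      (List.range' (r + 1) (n - 1 - r)).map fun i => (i, z) := by
  have h : List.range' 0 n = List.range' 0 (n - 1 - r) ++ List.range' (n - 1 - r) (n - (n - 1 - r)) := by
    have := List.range'_append (s := 0) (m := n - 1 - r) (n := n - (n - 1 - r)) (step := 1)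
    rw [zero_add, one_mul] at this
    rw [this]
    congr 1
    omega
  have h2 : List.range' (r + 1) (n - 1 - r) = (List.range' 0 (n - 1 - r)).map (r + 1 + ·) := by
    rw [List.map_add_range']
  rw [h, List.filterMap_append, h2, List.map_map, ← List.filterMap_eq_map]
  have h3 : (List.range' (n - 1 - r) (n - (n - 1 - r))).filterMap
      (fun c => if r + c + 1 < n then some (r + c + 1, z) else none) = [] := by
    rw [List.filterMap_eq_nil_iff]
    intro c hc
    rw [List.mem_range'_1] at hc
    exact if_neg (by omega)
  rw [h3, List.append_nil]
  refine List.filterMap_congr fun c hc => ?_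
  rw [List.mem_range'_1] at hc
  rw [if_pos (by omega)]
  simp only [Function.comp_apply, Option.some.injEq, Prod.mk.injEq, and_true]
  omega

theorem map_readingOrder (n k : ℕ) : (readingOrder n k).map (fun b => (label b, var b)) =
    blocksList n xP k ++ stairList zP 0 n := by
  rw [readingOrder, List.map_append, blocksList_eq, stairList_eq]
  congr 1
  · rw [List.map_flatMap, ← List.map_coe_finRange_eq_range, ← List.map_reverse, List.flatMap_map]
    congr 1
    funext g
    rw [gammaList, range'_eq_map_finRange, List.map_append, List.map_map, List.map_map,
      ← List.map_reverse, List.map_map, List.map_map]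
    rfl
  · rw [List.map_flatMap, range'_eq_map_finRange, List.flatMap_map]
    congr 1
    funext r
    rw [zero_add, List.map_reverse, ← filterMap_range_row, range'_eq_map_finRange,
      List.filterMap_map, List.map_filterMap, ← List.filterMap_reverse]
    congr 1
    funext c
    simp only [Function.comp_apply]
    split_ifs <;> rfl

/-- The pipe dream polynomial is a sum over subwords. -/
theorem sum_PD_eq (n k : ℕ) (w : BCInf) : ∑ D ∈ PD n k w, monomial D =
    ∑ c ∈ (finite_redWords w).toFinset,
      subwordSum (blocksList n xP k ++ stairList zP 0 n) c := by
  classical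
  have h1 : ∀ c, subwordSum (blocksList n xP k ++ stairList zP 0 n) c =
      ∑ D : PipeDream n k, if word D = c then monomial D else 0 := by
    intro c
    rw [← map_readingOrder, ← sum_powerset_eq_subwordSum label var nodup_readingOrder c]
    have h2 : (readingOrder n k).toFinset.powerset = Finset.univ := by
      rw [Finset.eq_univ_iff_forall]
      intro t
      rw [Finset.mem_powerset]
      intro b _
      rw [List.mem_toFinset]
      exact mem_readingOrder b
    rw [h2, ← sum_pipeDream]
    refine Finset.sum_congr rfl fun D _ => ?_
    rw [word_eq, monomial_eq]
  simp only [h1]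
  rw [Finset.sum_comm, PD, Finset.sum_filter]
  refine Finset.sum_congr rfl fun D _ => ?_
  rw [Finset.sum_ite_eq]
  simp only [Set.Finite.mem_toFinset]

end

/-! ### The Billey–Haiman sum -/

/-- Two equal neighbours would cancel. This provides the hypothesis of the valley count. -/
theorem isChain_ne_of_mem_redWords {w : BCInf} {c : List ℕ} (h : c ∈ redWords w) :
    c.IsChain (· ≠ ·) := by
  rw [List.isChain_iff_getElem]
  intro i hi he
  obtain ⟨x, hx⟩ : ∃ y, y = getElem c i (by omega) := ⟨_, rfl⟩
  have h1 : c.take i ++ ([x, x] ++ c.drop (i + 2)) = c := by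
    have h2 := List.drop_eq_getElem_cons (l := c) (i := i) (by omega)
    rw [List.drop_eq_getElem_cons hi, ← he, ← hx] at h2
    rw [List.cons_append, List.singleton_append, ← h2, List.take_append_drop]
  rw [← h1] at h
  have h2 := (redWords_append_iff.1 (redWords_append_iff.1 h).2.2.2).2.2.1
  have h3 := h2.2
  simp [s_mul_self] at h3

theorem redWords_take_drop {w : BCInf} {c : List ℕ} (h : c ∈ redWords w) (p : ℕ) :
    wordProd (c.take p) * wordProd (c.drop p) = w ∧
      length (wordProd (c.take p)) + length (wordProd (c.drop p)) = length w ∧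
      c.take p ∈ redWords (wordProd (c.take p)) ∧ c.drop p ∈ redWords (wordProd (c.drop p)) :=
  redWords_append_iff.1 (by rwa [List.take_append_drop])

theorem mem_Sym_of_pos {n : ℕ} {b : List ℕ} (h : ∀ i ∈ b, 0 < i ∧ i < n) : wordProd b ∈ Sym n := by
  refine ⟨wordProd_mem_BC fun i hi => (h i hi).2, ?_⟩
  induction b with
  | nil => exact fun i hi => hi
  | cons c b ih =>
    intro x hx
    have h1 := ih (fun i hi => h i (List.mem_cons_of_mem _ hi)) x hx
    obtain ⟨m, rfl⟩ : ∃ m, c = m + 1 := ⟨c - 1, by have := (h c List.mem_cons_self).1; omega⟩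
    rw [wordProd_cons, mul_apply, s_apply]
    simp only [lo, hi]
    split_ifs <;> omega

theorem expVec_apply (j : List ℕ) (t : ℕ) : expVec j t = j.count t := by
  simp [expVec]

/-- A monomial determines its sorted sequence of variables, so summing over admissible monomials is
summing over admissible sequences. -/
theorem eq_of_expVec_eq_of_ge {j j' : List ℕ} (h : j.Pairwise (· ≥ ·)) (h' : j'.Pairwise (· ≥ ·))
    (he : expVec j = expVec j') : j = j' := by
  refine List.Perm.eq_of_sortedGE h.sortedGE h'.sortedGE ?_
  exact Multiset.coe_eq_coe.1 (Multiset.toFinsupp.injective he)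

theorem eq_of_expVec_eq_of_le {j j' : List ℕ} (h : j.Pairwise (· ≤ ·)) (h' : j'.Pairwise (· ≤ ·))
    (he : expVec j = expVec j') : j = j' := by
  refine List.Perm.eq_of_sortedLE h.sortedLE h'.sortedLE ?_
  exact Multiset.coe_eq_coe.1 (Multiset.toFinsupp.injective he)

theorem support_expVec (j : List ℕ) : (expVec j).support = j.toFinset := by
  ext t
  rw [Finsupp.mem_support_iff, expVec_apply, List.mem_toFinset, ne_eq, List.count_eq_zero,
    not_not]

theorem prod_expVec (f : ℕ → PRing) (j : List ℕ) :
    ((expVec j).prod fun i e => f i ^ e) = (j.map f).prod := by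
  rw [Finsupp.prod, support_expVec, Finset.prod_list_map_count]
  simp only [expVec_apply]

/-- The summands of the Billey–Haiman sum that belong to a reduced word of `w`, a splitting of it
and two admissible sequences. -/
noncomputable def bhIndex (t : (_ : List ℕ) × (_ : ℕ) × (List ℕ × List ℕ)) : BHIndex where
  u := wordProd (t.1.take t.2.1)
  v := wordProd (t.1.drop t.2.1)
  a := t.1.take t.2.1
  α := expVec t.2.2.1
  b := t.1.drop t.2.1
  β := expVec t.2.2.2

/-- The reduced words of `w` with a splitting and two admissible sequences. -/
noncomputable def bhFinset (n k : ℕ) (w : BCInf) :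
    Finset ((_ : List ℕ) × (_ : ℕ) × (List ℕ × List ℕ)) :=
  (finite_redWords w).toFinset.sigma fun c => (Finset.range (c.length + 1)).sigma fun p =>
    xSeqs k (c.take p) ×ˢ zSeqs 0 n (c.drop p)

theorem mem_bhFinset {n k : ℕ} {w : BCInf} {c : List ℕ} {p : ℕ} {i j : List ℕ} :
    (⟨c, p, i, j⟩ : (_ : List ℕ) × (_ : ℕ) × (List ℕ × List ℕ)) ∈ bhFinset n k w ↔
      c ∈ redWords w ∧ p ≤ c.length ∧ (IsXAdmissible (c.take p) i ∧ ∀ t ∈ i, t < k) ∧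
        IsZAdmissible (c.drop p) j ∧ ∀ t ∈ j, t < n := by
  simp only [bhFinset, Finset.mem_sigma, Set.Finite.mem_toFinset, Finset.mem_range,
    Finset.mem_product, mem_xSeqs, mem_zSeqs, Nat.lt_succ_iff, zero_add, Nat.zero_le, true_and]

theorem injOn_bhIndex (n k : ℕ) (w : BCInf) :
    Set.InjOn bhIndex (bhFinset n k w : Set ((_ : List ℕ) × (_ : ℕ) × (List ℕ × List ℕ))) := by
  rintro ⟨c, p, i, j⟩ h ⟨c', p', i', j'⟩ h' he
  rw [Finset.mem_coe, mem_bhFinset] at h h'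
  simp only [bhIndex, BHIndex.mk.injEq] at he
  obtain ⟨-, -, h1, h2, h3, h4⟩ := he
  have hc : c = c' := by rw [← List.take_append_drop p c, h1, h3, List.take_append_drop]
  have hp : p = p' := by
    have := congrArg List.length h1
    rw [List.length_take, List.length_take, min_eq_left h.2.1, min_eq_left h'.2.1] at this
    exact this
  have hi := eq_of_expVec_eq_of_ge h.2.2.1.1.2.1 h'.2.2.1.1.2.1 h2
  have hj := eq_of_expVec_eq_of_le h.2.2.2.1.2.1 h'.2.2.2.1.2.1 h4
  subst hc hp hi hj
  rfl

/-- The bounds on both sides match because of z-admissibility, j_i + 1 ≤ b_i. It excludes the letter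
0 from b, so that v has no sign changes, and together with b_i < n it bounds the entries of j by n.
-/
theorem image_bhIndex {n : ℕ} (k : ℕ) {w : BCInf} (hw : w ∈ BC n) :
    bhIndex '' (bhFinset n k w) = bhIndices n k w := by
  ext q
  constructor
  · rintro ⟨⟨c, p, i, j⟩, h, rfl⟩
    rw [Finset.mem_coe, mem_bhFinset] at h
    obtain ⟨hc, hp, ⟨hi, hik⟩, hj, hjn⟩ := h
    obtain ⟨h1, h2, h3, h4⟩ := redWords_take_drop hc p
    refine ⟨h1, h2, mem_Sym_of_pos fun x hx => ?_, h3, ⟨i, hi, rfl⟩, fun t ht => ?_, h4,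
      ⟨j, hj, rfl⟩⟩
    · refine ⟨?_, lt_of_mem_redWords c hw hc x (List.mem_of_mem_drop hx)⟩
      obtain ⟨m, hm, rfl⟩ := List.getElem_of_mem hx
      have := hj.2.2.1 m hm
      rw [List.getD_eq_getElem _ 0 hm] at this
      omega
    · change expVec i t = 0
      rw [expVec_apply, List.count_eq_zero]
      intro h
      have := hik t h
      omega
  · obtain ⟨u, v, a, α, b, β⟩ := q
    rintro ⟨h1, h2, h3, h4, ⟨i, hi, h5⟩, h6, h7, ⟨j, hj, h8⟩⟩
    simp only at h1 h2 h3 h4 hi h5 h6 h7 hj h8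
    subst h1 h5 h8
    have hab := mem_redWords_mul h4 h7 h2
    have ht : (a ++ b).take a.length = a := List.take_left
    have hd : (a ++ b).drop a.length = b := List.drop_left
    refine ⟨⟨a ++ b, a.length, i, j⟩, ?_, ?_⟩
    · rw [Finset.mem_coe, mem_bhFinset, ht, hd]
      refine ⟨hab, by simp, ⟨hi, fun t ht => ?_⟩, hj, fun t ht => ?_⟩
      · by_contra hk
        have := h6 t (by omega)
        rw [expVec_apply, List.count_eq_zero] at this
        exact this ht
      · obtain ⟨m, hm, rfl⟩ := List.getElem_of_mem ht
        have h9 := hj.2.2.1 m (hj.1 ▸ hm)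
        have h10 := lt_of_mem_redWords _ hw hab (b.getD m 0)
          (List.mem_append_right _ (getD_mem (hj.1 ▸ hm)))
        rw [List.getD_eq_getElem _ 0 hm] at h9
        omega
    · simp only [bhIndex, ht, hd, h4.1, h7.1]

theorem finsum_bhTerm {n : ℕ} (k : ℕ) {w : BCInf} (hw : w ∈ BC n) :
    ∑ᶠ q ∈ bhIndices n k w, bhTerm q = ∑ c ∈ (finite_redWords w).toFinset,
      subwordSum (blocksList n xP k ++ stairList zP 0 n) c := by
  rw [← image_bhIndex k hw, finsum_mem_image (injOn_bhIndex n k w), finsum_mem_coe_finset,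
    bhFinset, Finset.sum_sigma]
  refine Finset.sum_congr rfl fun c hc => ?_
  rw [Set.Finite.mem_toFinset] at hc
  have hn := lt_of_mem_redWords c hw hc
  have hne := isChain_ne_of_mem_redWords hc
  rw [Finset.sum_sigma, subwordSum_append]
  refine Finset.sum_congr rfl fun p _ => ?_
  rw [subwordSum_blocksList xP k (hne.take p) fun i hi => hn i (List.mem_of_mem_take hi),
    subwordSum_stairList zP 0 n fun i hi => by
      rw [zero_add]; exact hn i (List.mem_of_mem_drop hi),
    Finset.sum_mul_sum, Finset.sum_product]
  refine Finset.sum_congr rfl fun i _ => Finset.sum_congr rfl fun j _ => ?_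
  rw [bhTerm, xWeight, bhIndex, support_expVec, prod_expVec, prod_expVec]

end TypeC

theorem theorem3p2 :
    (∃! C : TypeC.BCInf → TypeC.SRing, TypeC.IsSchubertFamily C) ∧
    ∀ C : TypeC.BCInf → TypeC.SRing, TypeC.IsSchubertFamily C →
      ∀ (n k : ℕ) (w : TypeC.BCInf), w ∈ TypeC.BC n →
        (TypeC.bhIndices n k w).Finite ∧
        (∑ D ∈ TypeC.PD n k w, TypeC.monomial D) =
          (∑ᶠ q ∈ TypeC.bhIndices n k w, TypeC.bhTerm q) ∧
        (∑ᶠ q ∈ TypeC.bhIndices n k w, TypeC.bhTerm q) = TypeC.trunc k (C w) := by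
  refine ⟨TypeC.existsUnique_isSchubertFamily, fun C hC n k w hw => ⟨?_, ?_, ?_⟩⟩
  · rw [← TypeC.image_bhIndex k hw]
    exact (Finset.finite_toSet _).image _
  · rw [TypeC.sum_PD_eq, TypeC.finsum_bhTerm k hw]
  · rw [TypeC.trunc_eq_sum_subwordSum hC hw k, TypeC.finsum_bhTerm k hw]
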